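/- Let $\mathcal X\subset\mathbb R^d$ ($d\ge 1$) be a convex compact set with $0\in\mathcal X$ and $\|x-x'\|\le R$ on $\mathcal X$, and let $f(\cdot,z)$ be convex, $L$-Lipschitz and $\beta$-smooth on $\mathcal X$ for every $z\in\mathcal Z$ ($L>0$). A dataset is $\mathcal D=(Z_1,\dots,Z_n)$, where each user $Z_j$ holds $m\ge1$ samples. A randomized algorithm $\mathcal A$ is $(\varepsilon,\delta)$-user-level differentially private if $\mathbb P(\mathcal A(\mathcal D)\in S)\le e^{\varepsilon}\,\mathbb P(\mathcal A(\mathcal D')\in S)+\delta$ for all measurable $S$ and all $\mathcal D,\mathcal D'$ that differ in the data of one user. **Algorithm (accelerated phased ERM with outlier gradient removal).** Parameters: $\varepsilon,\delta,p,q,\lambda>0$, $\delta<1$, $x_0\in\mathcal X$, a constant $c>0$, numbers of steps $T_i\ge1$. Put $l=\lfloor\log_2 n\rfloor$, $\tau=cL\log(ndm)/\sqrt m$, and for $i=1,\dots,l$ $$n_i=\Big\lfloor\frac{(1-2^{-q})\,n}{2^{iq}}\Big\rfloor,\quad \lambda_i=\lambda 2^{pi},\quad K_i=\Big\lceil 500\log\Big(\frac{n_i^2m^2e^{\varepsilon}}{\delta}\Big)\Big(\frac1\varepsilon+\frac{n_i\varepsilon}{\sqrt{T_i\log(1/\delta)}}\Big)\Big\rceil,\quad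 \sigma_i=\frac{1000\,\tau\sqrt{T_i}\,\log(nde^{\varepsilon}/\delta)}{\varepsilon n_i}.$$ Disjoint groups $D_1,\dots,D_l$ of $n_1,\dots,n_l$ users are drawn in any way that does not depend on the data. Phase $i$ starts at $x_{i-1}$, draws $\xi_i\sim\mathrm{Lap}(8/\varepsilon)$ once, and performs steps $t=1,\dots,T_i$ at query points $x^t$ of accelerated stochastic approximation (AC-SA; any step-size parameters $\alpha\in(0,1]$, $\gamma>0$ and any restart schedule fixed in advance): 1. draw $K_i$ users $Z^t_1,\dots,Z^t_{K_i}$ from $D_i$ uniformly with replacement, and let $g_j=\frac1m\sum_{z\in Z^t_j}\nabla f(x^t,z)$, $h_j=\#\{j':\|g_j-g_{j'}\|\le2\tau\}$, $s=\frac1{K_i}\sum_j h_j$; 2. draw $v\sim\mathrm{Lap}(16/\varepsilon)$; if $s+v<\frac{4K_i}5+\xi_i$, the phase halts and returns $0$; 3. otherwise keep each $j$ independently with probability $0$ if $h_j<K_i/2$, $1$ if $h_j\ge 2K_i/3$, and $\frac{h_j-K_i/2}{K_i/6}$ in between; let $g$ be the average of the kept $g_j$ ($0$ if none is kept) and $\widehat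 g=g+\zeta$ with $\zeta\sim\mathcal N(0,\sigma_i^2I_d)$; 4. do one AC-SA iteration over $\mathcal X$ (with strong convexity parameter $\lambda_i$) with the gradient estimate $\widehat g+\lambda_i(x^t-x_{i-1})$. All noise is independent. If no step halts, $x_i$ is the (aggregated) AC-SA iterate after $T_i$ steps; if a step halts, then either $x_i=0$ and the next phase follows, or the whole run stops with output $0$ (the claim is made for both conventions). The output is $x_l$. **Theorem.** Let $0<\varepsilon\le10$, $0<\delta<1$, and let $q>0$ be such that $$n^{1-q}>\frac{100\log(20nmde^{\varepsilon}/\delta)}{\varepsilon\,(1-2^{-q})}.$$ Assume that the minibatches are no larger than the groups they are drawn from: $K_i\le n_i$ for all $1\le i\le l$. Then the algorithm is $(\varepsilon,\delta)$-user-level differentially private. -/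

import Mathlib

open MeasureTheory ProbabilityTheory
open scoped ENNReal

noncomputable section

namespace UserDP

/-- `ℝ^d` with the Euclidean norm. -/
abbrev Vec (d : ℕ) : Type := EuclideanSpace ℝ (Fin d)

/-- A dataset: `n` users, each holding `m` samples. -/
abbrev Dataset (n m : ℕ) (Z : Type*) : Type _ := Fin n → Fin m → Z

/-- Two datasets that differ in the data of (at most) one user. -/
def Neighbors {n m : ℕ} {Z : Type*} (D D' : Dataset n m Z) : Prop :=
  ∃ u : Fin n, ∀ v : Fin n, v ≠ u → D v = D' v

/-- `(ε, δ)`-user-level differential privacy of a randomized algorithm with values in `V`, run as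
`alg D ω` with the random seed `ω` drawn from `μ`. -/
def IsUserLevelDP {n m : ℕ} {Z V Ω : Type*} [MeasurableSpace V] [MeasurableSpace Ω]
    (μ : Measure Ω) (alg : Dataset n m Z → Ω → V) (ε δ : ℝ) : Prop :=
  ∀ D D' : Dataset n m Z, Neighbors D D' → ∀ S : Set V, MeasurableSet S →
    μ {ω | alg D ω ∈ S} ≤
      ENNReal.ofReal (Real.exp ε) * μ {ω | alg D' ω ∈ S} + ENNReal.ofReal δ

/-- The Laplace distribution `Lap(b)`. -/
def laplace (b : ℝ) : Measure ℝ :=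
  volume.withDensity fun x => ENNReal.ofReal ((1 / (2 * b)) * Real.exp (-|x| / b))

/-- The Gaussian distribution `N(0, σ² I_d)`. -/
def gaussianNoise (d : ℕ) (σ : ℝ) : Measure (Vec d) :=
  (stdGaussian (Vec d)).map fun w => σ • w

open Classical in
/-- Euclidean projection onto `X` (a point of `X` nearest to `u`). -/
def proj {d : ℕ} (X : Set (Vec d)) (u : Vec d) : Vec d :=
  if h : ∃ y ∈ X, ∀ x ∈ X, ‖u - y‖ ≤ ‖u - x‖ then h.choose else 0

/-- The standing assumptions on the domain and the loss: `X` is convex and compact of diameter at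
most `R`; every `f(·, z)` is convex, `L`-Lipschitz and `β`-smooth on `X`, with gradient
`grad · z`. -/
structure LossAssumptions {d : ℕ} {Z : Type*} (X : Set (Vec d)) (f : Vec d → Z → ℝ)
    (grad : Vec d → Z → Vec d) (R L β : ℝ) : Prop where
  convex_domain : Convex ℝ X
  compact_domain : IsCompact X
  diam_le : ∀ x ∈ X, ∀ y ∈ X, ‖x - y‖ ≤ R
  convex_loss : ∀ z, ConvexOn ℝ X fun x => f x z
  lipschitz_loss : ∀ z, ∀ x ∈ X, ∀ y ∈ X, |f x z - f y z| ≤ L * ‖x - y‖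
  hasGradient : ∀ z, ∀ x ∈ X, HasGradientWithinAt (fun y => f y z) (grad x z) X x
  smooth_loss : ∀ z, ∀ x ∈ X, ∀ y ∈ X, ‖grad x z - grad y z‖ ≤ β * ‖x - y‖

/-- What happens when the threshold test of a phase fails: either the phase returns `0` to the
outer loop, which goes on from that point, or the whole algorithm stops with output `0`. -/
inductive HaltRule
  | returnZero
  | stopAll

/-- The parameters of the algorithm. Phases are numbered `1, …, l`, steps `0, …, T i - 1`. -/
structure Params where
  /-- number of users -/
  n : ℕ
  /-- samples per user -/
  m : ℕ
  /-- dimension -/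
  d : ℕ
  /-- privacy parameter -/
  ε : ℝ
  /-- privacy parameter -/
  δ : ℝ
  /-- growth exponent of the regularization -/
  p : ℝ
  /-- decay exponent of the phase sizes -/
  q : ℝ
  /-- base regularization -/
  lam : ℝ
  /-- Lipschitz constant -/
  L : ℝ
  /-- the constant in `τ = c L log(ndm) / √m` -/
  c : ℝ
  /-- number of steps of each phase -/
  T : ℕ → ℕ
  /-- AC-SA weights (phase, step) -/
  α : ℕ → ℕ → ℝ
  /-- AC-SA step-size parameters (phase, step) -/
  γ : ℕ → ℕ → ℝ
  /-- steps at which multi-stage AC-SA starts a new stage (phase, step) -/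
  restart : ℕ → ℕ → Bool
  /-- behaviour after a failed threshold test -/
  halt : HaltRule

namespace Params

variable (P : Params)

/-- The number of phases `⌊log₂ n⌋`. -/
def l : ℕ := Nat.log 2 P.n

/-- The number of users of phase `i`, `(1 - 2^{-q}) n / 2^{iq}` rounded down. -/
def size (i : ℕ) : ℕ :=
  ⌊(1 - (1 / 2 : ℝ) ^ P.q) * P.n / (2 : ℝ) ^ ((i : ℝ) * P.q)⌋₊

/-- `λ_i = λ 2^{pi}`. -/
def reg (i : ℕ) : ℝ := P.lam * (2 : ℝ) ^ (P.p * i)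

/-- The concentration radius `τ`. -/
def τ : ℝ := P.c * P.L * Real.log ((P.n : ℝ) * P.d * P.m) / √(P.m : ℝ)

/-- The minibatch size `K_i`, rounded up. -/
def K (i : ℕ) : ℕ :=
  ⌈500 * Real.log ((P.size i : ℝ) ^ 2 * (P.m : ℝ) ^ 2 * Real.exp P.ε / P.δ) *
    (1 / P.ε + P.size i * P.ε / √((P.T i : ℝ) * Real.log (1 / P.δ)))⌉₊

/-- The standard deviation `σ_i` of the Gaussian noise of phase `i`. -/
def σ (i : ℕ) : ℝ :=
  1000 * P.τ * √(P.T i : ℝ) * Real.log ((P.n : ℝ) * P.d * Real.exp P.ε / P.δ) /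
    (P.ε * P.size i)

end Params

/-! ### One step on a minibatch -/

/-- `q(Z) = (1/m) ∑_{z ∈ Z} ∇f(x, z)`, the gradient at `x` of the empirical loss of one user. -/
def userGrad {d m : ℕ} {Z : Type*} (grad : Vec d → Z → Vec d) (x : Vec d) (user : Fin m → Z) :
    Vec d :=
  (1 / (m : ℝ)) • ∑ j, grad x (user j)

/-- `h(j)`: the number of members of the minibatch whose gradient is `2τ`-close to that of the
`j`-th member. -/
def closeCount {d K : ℕ} (g : Fin K → Vec d) (τ : ℝ) (j : Fin K) : ℕ :=
  Nat.card {j' : Fin K // ‖g j - g j'‖ ≤ 2 * τ}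

/-- The concentration score of the minibatch. -/
def score {d K : ℕ} (g : Fin K → Vec d) (τ : ℝ) : ℝ :=
  (1 / (K : ℝ)) * ∑ j, (closeCount g τ j : ℝ)

/-- The probability of keeping a member with `h` close members. -/
def keepProb (K : ℕ) (h : ℝ) : ℝ :=
  if h < (K : ℝ) / 2 then 0
  else if 2 * (K : ℝ) / 3 ≤ h then 1
  else (h - (K : ℝ) / 2) / ((K : ℝ) / 6)

open Classical in
/-- The kept members: member `j` is kept iff its uniform seed `U j ∈ [0,1]` is less than its
keeping probability. -/
def kept {d K : ℕ} (g : Fin K → Vec d) (τ : ℝ) (U : Fin K → ℝ) : Finset (Fin K) :=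
  Finset.univ.filter fun j => U j < keepProb K (closeCount g τ j)

/-- The average of the kept gradients. -/
def keptMean {d K : ℕ} (g : Fin K → Vec d) (τ : ℝ) (U : Fin K → ℝ) : Vec d :=
  (1 / ((kept g τ U).card : ℝ)) • ∑ j ∈ kept g τ U, g j

/-! ### AC-SA -/

/-- The state of AC-SA: the prox iterate and the aggregated iterate. -/
structure ACSAState (d : ℕ) where
  /-- prox iterate -/
  prox : Vec d
  /-- aggregated iterate -/
  ag : Vec d

/-- Start of a new stage. -/
def ACSAState.enter {d : ℕ} (s : ACSAState d) (restart : Bool) : ACSAState d :=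
  if restart then ⟨s.ag, s.ag⟩ else s

/-- The query point of an AC-SA iteration for a `μ`-strongly convex objective. -/
def ACSAState.query {d : ℕ} (s : ACSAState d) (μ α γ : ℝ) : Vec d :=
  ((1 - α) * (μ + γ) / (γ + (1 - α ^ 2) * μ)) • s.ag +
    (α * ((1 - α) * μ + γ) / (γ + (1 - α ^ 2) * μ)) • s.prox

/-- One AC-SA iteration with the gradient estimate `G` at the query point. The new prox iterate is
the minimizer over `x ∈ X` of
`α (⟨G, x⟩ + (μ/2) ‖x - query‖²) + (((1 - α) μ + γ)/2) ‖x - prox‖²`. -/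
def ACSAState.update {d : ℕ} (s : ACSAState d) (X : Set (Vec d)) (μ α γ : ℝ) (G : Vec d) :
    ACSAState d :=
  let prox' := proj X ((1 / (μ + γ)) •
    ((α * μ) • s.query μ α γ + ((1 - α) * μ + γ) • s.prox - α • G))
  ⟨prox', α • prox' + (1 - α) • s.ag⟩

/-! ### Randomness -/

/-- Random seed of one step: the sampled users, the Laplace noise of the score, the uniform seeds
of the outlier removal, the Gaussian noise. -/
abbrev StepSeed (d n K : ℕ) : Type := (Fin K → Fin n) × ℝ × (Fin K → ℝ) × Vec d

/-- Law of the seed of one step. Sampling of users is uniform with replacement. -/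
def stepLaw (d n K : ℕ) (ε σ : ℝ) : Measure (StepSeed d n K) :=
  (uniformOn (Set.univ : Set (Fin K → Fin n))).prod
    ((laplace (16 / ε)).prod
      ((Measure.pi fun _ : Fin K => volume.restrict (Set.Icc (0 : ℝ) 1)).prod
        (gaussianNoise d σ)))

/-- Random seed of phase `i`: the Laplace noise of the threshold and the seeds of the steps. -/
abbrev PhaseSeed (P : Params) (i : ℕ) : Type :=
  ℝ × (Fin (P.T i) → StepSeed P.d (P.size i) (P.K i))

/-- Law of the seed of phase `i`. -/
def phaseLaw (P : Params) (i : ℕ) : Measure (PhaseSeed P i) :=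
  (laplace (8 / P.ε)).prod
    (Measure.pi fun _ => stepLaw P.d (P.size i) (P.K i) P.ε (P.σ i))

/-- A choice of disjoint groups of users `D_1, …, D_l`, with `D_i` of size `n_i`. -/
def Selection (P : Params) : Type :=
  (Σ i : Fin P.l, Fin (P.size (i + 1))) ↪ Fin P.n

instance (P : Params) : MeasurableSpace (Selection P) := ⊤

/-- Random seed of the whole run. -/
abbrev Seed (P : Params) : Type :=
  Selection P × ((i : Fin P.l) → PhaseSeed P (i + 1))

/-- Law of the seed of the whole run; `draw` is the (data-independent) way of drawing the
groups. -/
def seedLaw (P : Params) (draw : PMF (Selection P)) : Measure (Seed P) :=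
  draw.toMeasure.prod (Measure.pi fun i : Fin P.l => phaseLaw P (i + 1))

/-! ### The algorithm -/

section Algorithm

variable {Z : Type*} (P : Params) (X : Set (Vec P.d)) (grad : Vec P.d → Z → Vec P.d)

/-- Step `t` of phase `i` of accelerated minibatch SGD on the users `D_i`, with center `x_{i-1}`
and threshold noise `ξ`; `none` means that the threshold test failed. -/
def step (i : ℕ) (Di : Fin (P.size i) → Fin P.m → Z) (center : Vec P.d) (ξ : ℝ) (t : ℕ)
    (seed : StepSeed P.d (P.size i) (P.K i)) (s : ACSAState P.d) : Option (ACSAState P.d) :=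
  let s₁ := s.enter (P.restart i t)
  let x := s₁.query (P.reg i) (P.α i t) (P.γ i t)
  let g : Fin (P.K i) → Vec P.d := fun j => userGrad grad x (Di (seed.1 j))
  if 4 * (P.K i : ℝ) / 5 + ξ ≤ score g P.τ + seed.2.1 then
    let ghat := keptMean g P.τ seed.2.2.1 + seed.2.2.2
    some (s₁.update X (P.reg i) (P.α i t) (P.γ i t) (ghat + P.reg i • (x - center)))
  else none

/-- Phase `i` (user-level DP accelerated minibatch SGD) started at `x_{i-1} = center`; `none` means
that some threshold test failed. -/
def phase (i : ℕ) (Di : Fin (P.size i) → Fin P.m → Z) (center : Vec P.d) (seed : PhaseSeed P i) :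
    Option (Vec P.d) :=
  (Fin.foldl (P.T i)
    (fun (o : Option (ACSAState P.d)) t =>
      o.bind (step P X grad i Di center seed.1 t (seed.2 t)))
    (some ⟨center, center⟩)).map ACSAState.ag

/-- The result of a phase as the outer loop sees it. -/
def afterPhase (halt : HaltRule) {d : ℕ} : Option (Vec d) → Option (Vec d)
  | some x => some x
  | none => match halt with
    | HaltRule.returnZero => some 0
    | HaltRule.stopAll => none

/-- Accelerated phased ERM with outlier gradient removal, started at `x₀`. -/
def acceleratedPhasedERM (x₀ : Vec P.d) (D : Dataset P.n P.m Z) (ω : Seed P) : Vec P.d :=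
  (Fin.foldl P.l
    (fun (o : Option (Vec P.d)) i =>
      o.bind fun x => afterPhase P.halt
        (phase P X grad (i + 1) (fun j => D (ω.1.toFun ⟨i, j⟩)) x (ω.2 i)))
    (some x₀)).getD 0

end Algorithm

end UserDP

end

noncomputable section

namespace UserDP

/-! ### Gaussian shifts -/

/-! The groups are disjoint, so the changed user enters at most one phase. Earlier phases have a
common law and later ones are post-processing, so it suffices that one phase is private
(`lintegral_foldl_le`, `lintegral_outer_le`).

Fix a phase with N users, minibatches of size K and T steps. Its data form a table of gradients
indexed by position in the minibatch and by user. The changed user is replaced one position at a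
time (`hybrid`), which gives K comparisons of tables that differ in a single entry. A step reads
this entry only when the user is drawn at that position, with probability 1/N.

The threshold test. One entry changes the score by at most 2. The lost pass probability is made up
by moving the threshold by s = 21/(5N), because the other N - 1 possible users at this position all
gain from the move (`lapTail_transport`, `sum_mul_le_of_transport`). The K moves add up to Ks ≤
21/5, which the Laplace noise of the threshold absorbs once per phase, at the price 21ε/40.

The gradient estimate. In a concentrated minibatch at least K/5 members are surely kept, and members
that may be kept are within 4τ of each other. One entry changes the keeping probabilities by at most
8 in total, and each flip moves the mean by at most 20τ/K (`FlipBound.bern_sub_le`,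
`NoiseRegime.abs_estMean_sub_le`). A Gaussian likelihood ratio has mean one, so Young's inequality
between entropy and exponential bounds the effect on a test function by a small multiple of its
entropy plus a term of second order in the shift (`abs_integral_shift_sub_le`).

Composition over steps. The entropy is absorbed by passing from a mean to a power mean of exponent b
(`add_mul_entr_le`). Power means iterate, so induction over the steps gives a Rényi-type comparison
of whole runs with factor (1 + ρ)^T (`StepRegime.runMean_le`). Above a level δ₂ the power mean
returns to the mean at the price exp((1 - 1/b) log(1/δ₂)) (`rpow_le_exp_mul_max`). Minibatches that
are not concentrated rarely pass and otherwise halt the phase. Their loss is charged to the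
probability of halting, which is at most one for the whole phase, so no factor T arises.

Budget. With 1 - 1/b = 3ε/(10 K log(1/δ₂)) the K comparisons cost 3ε/10 + KTρ ≤ 3ε/10 + 7ε/40
(`PhaseBounds.growth_le`). Together with 21ε/40 this is ε. A test function splits into its part on
surviving runs and its value at a halt. These need opposite moves of the threshold, and each leaves
an additive error of at most δ/2 (`PhaseBounds.slack_le`). -/

lemma gaussianReal_eq_withDensity_gaussianReal_zero (a : ℝ) :
    gaussianReal a 1 =
      (gaussianReal 0 1).withDensity fun x => ENNReal.ofReal (Real.exp (a * x - a ^ 2 / 2)) := by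
  rw [gaussianReal_of_var_ne_zero a one_ne_zero, gaussianReal_of_var_ne_zero 0 one_ne_zero,
    ← withDensity_mul _ (measurable_gaussianPDF 0 1) (by fun_prop)]
  congr 1
  ext x
  simp only [gaussianPDF, Pi.mul_apply]
  rw [← ENNReal.ofReal_mul (gaussianPDFReal_nonneg _ _ _)]
  congr 1
  simp only [gaussianPDFReal, mul_assoc, ← Real.exp_add]
  congr 2
  simp
  ring

lemma pi_gaussianReal_eq_withDensity {ι : Type*} [Fintype ι] (a : ι → ℝ) :
    Measure.pi (fun i => gaussianReal (a i) 1) =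
      (Measure.pi fun _ : ι => gaussianReal 0 1).withDensity
        fun x => ENNReal.ofReal (Real.exp (∑ i, (a i * x i - a i ^ 2 / 2))) := by
  refine Measure.pi_eq fun s hs => ?_
  rw [withDensity_apply _ (MeasurableSet.univ_pi hs), ← lintegral_indicator (MeasurableSet.univ_pi hs)]
  -- On a box the indicator and the density both factor over the coordinates, so independence
  -- reduces the integral to one-dimensional ones.
  have h1 : ∀ x : ι → ℝ, (Set.univ.pi s).indicator
      (fun x => ENNReal.ofReal (Real.exp (∑ i, (a i * x i - a i ^ 2 / 2)))) x =
      ∏ i, (s i).indicator (fun y => ENNReal.ofReal (Real.exp (a i * y - a i ^ 2 / 2))) (x i) := by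
    intro x
    by_cases hx : x ∈ Set.univ.pi s
    · rw [Set.indicator_of_mem hx, Real.exp_sum,
        ENNReal.ofReal_prod_of_nonneg fun i _ => (Real.exp_pos _).le]
      exact Finset.prod_congr rfl fun i _ => by rw [Set.indicator_of_mem (hx i trivial)]
    · rw [Set.indicator_of_notMem hx]
      obtain ⟨i, hi⟩ : ∃ i, x i ∉ s i := by simpa [Set.mem_pi] using hx
      exact (Finset.prod_eq_zero (Finset.mem_univ i) (Set.indicator_of_notMem hi _)).symm
  have hm : ∀ i, Measurable
      ((s i).indicator fun y => ENNReal.ofReal (Real.exp (a i * y - a i ^ 2 / 2))) :=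
    fun i => Measurable.indicator (by fun_prop) (hs i)
  have hi := iIndepFun_pi (μ := fun _ : ι => gaussianReal 0 1) fun i => (hm i).aemeasurable
  simp_rw [h1]
  rw [lintegral_prod_eq_prod_lintegral_of_indepFun _ _ hi
    fun i => (hm i).comp (measurable_pi_apply i)]
  refine Finset.prod_congr rfl fun i _ => ?_
  have he : ∫⁻ x : ι → ℝ, (s i).indicator
      (fun y => ENNReal.ofReal (Real.exp (a i * y - a i ^ 2 / 2))) (x i)
        ∂(Measure.pi fun _ : ι => gaussianReal 0 1) =
      ∫⁻ y, (s i).indicator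
        (fun y => ENNReal.ofReal (Real.exp (a i * y - a i ^ 2 / 2))) y ∂gaussianReal 0 1 :=
    (measurePreserving_eval (fun _ : ι => gaussianReal 0 1) i).lintegral_comp (hm i)
  rw [he, lintegral_indicator (hs i), ← withDensity_apply _ (hs i),
    ← gaussianReal_eq_withDensity_gaussianReal_zero]

/-- The density of a shifted standard Gaussian. -/
def shiftDensity {d : ℕ} (v w : Vec d) : ℝ := Real.exp (inner ℝ v w - ‖v‖ ^ 2 / 2)

lemma shiftDensity_pos {d : ℕ} (v w : Vec d) : 0 < shiftDensity v w := Real.exp_pos _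

@[fun_prop]
lemma measurable_shiftDensity {d : ℕ} (v : Vec d) : Measurable (shiftDensity v) := by
  unfold shiftDensity; fun_prop

/-- Cameron–Martin formula for the standard Gaussian on `ℝ^d`. -/
lemma stdGaussian_map_add {d : ℕ} (v : Vec d) :
    (stdGaussian (Vec d)).map (· + v) =
      (stdGaussian (Vec d)).withDensity fun w => ENNReal.ofReal (shiftDensity v w) := by
  have hto : Measurable (WithLp.toLp 2 : (Fin d → ℝ) → Vec d) := by fun_prop
  rw [← map_pi_eq_stdGaussian, Measure.map_map (by fun_prop) hto]
  have h1 : ((· + v) ∘ (WithLp.toLp 2 : (Fin d → ℝ) → Vec d)) =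
      (WithLp.toLp 2 : (Fin d → ℝ) → Vec d) ∘ fun x i => x i + v i := by
    ext x i; simp
  rw [h1, ← Measure.map_map hto (by fun_prop),
    Measure.pi_map_pi (f := fun i x => x + v i) (fun i => by fun_prop)]
  simp_rw [gaussianReal_map_add_const, zero_add]
  rw [pi_gaussianReal_eq_withDensity]
  ext s hs
  rw [Measure.map_apply hto hs, withDensity_apply _ (hto hs), withDensity_apply _ hs,
    setLIntegral_map hs (by fun_prop) hto]
  refine lintegral_congr fun x => ?_
  congr 2
  rw [Finset.sum_sub_distrib, EuclideanSpace.norm_sq_eq]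
  simp [PiLp.inner_apply, Finset.sum_div, mul_comm]

lemma integral_stdGaussian_add {d : ℕ} (v : Vec d) (f : Vec d → ℝ) :
    ∫ w, f (w + v) ∂stdGaussian (Vec d) =
      ∫ w, f w * shiftDensity v w ∂stdGaussian (Vec d) := by
  have h := (MeasurableEquiv.addRight v).measurableEmbedding.integral_map (μ := stdGaussian (Vec d)) f
  rw [show (⇑(MeasurableEquiv.addRight v) : Vec d → Vec d) = (· + v) from rfl,
    stdGaussian_map_add,
    integral_withDensity_eq_integral_toReal_smul (by fun_prop) (by simp)] at h
  rw [← h]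
  refine integral_congr_ae (Filter.Eventually.of_forall fun w => ?_)
  simp [ENNReal.toReal_ofReal (shiftDensity_pos v w).le, mul_comm]

lemma integrable_shiftDensity {d : ℕ} (v : Vec d) :
    Integrable (shiftDensity v) (stdGaussian (Vec d)) := by
  refine ⟨by fun_prop, ?_⟩
  have h : ∫⁻ w, ENNReal.ofReal (shiftDensity v w) ∂stdGaussian (Vec d) = 1 := by
    have := congrArg (fun μ => μ Set.univ) (stdGaussian_map_add v)
    simp only [withDensity_apply _ MeasurableSet.univ, Measure.restrict_univ] at this
    rw [← this, Measure.map_apply (by fun_prop) MeasurableSet.univ]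
    simp
  rw [hasFiniteIntegral_iff_ofReal (Filter.Eventually.of_forall fun w => (shiftDensity_pos v w).le), h]
  exact ENNReal.one_lt_top

lemma integral_shiftDensity {d : ℕ} (v : Vec d) :
    ∫ w, shiftDensity v w ∂stdGaussian (Vec d) = 1 := by
  have := integral_stdGaussian_add v fun _ => 1
  simpa using this.symm

/-- Completing the square: an exponential of a linear form is a multiple of a shift density, so
Gaussian moment generating functions follow from the total mass one of such densities. -/
lemma exp_inner_eq {d : ℕ} (s : ℝ) (v w : Vec d) :
    Real.exp (s * inner ℝ v w) = Real.exp (s ^ 2 * ‖v‖ ^ 2 / 2) * shiftDensity (s • v) w := by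
  rw [shiftDensity, ← Real.exp_add, norm_smul, mul_pow, Real.norm_eq_abs, sq_abs, inner_smul_left]
  congr 1
  simp

lemma integrable_exp_inner {d : ℕ} (s : ℝ) (v : Vec d) :
    Integrable (fun w => Real.exp (s * inner ℝ v w)) (stdGaussian (Vec d)) := by
  simp_rw [exp_inner_eq]
  exact (integrable_shiftDensity _).const_mul _

lemma integral_exp_inner {d : ℕ} (s : ℝ) (v : Vec d) :
    ∫ w, Real.exp (s * inner ℝ v w) ∂stdGaussian (Vec d) = Real.exp (s ^ 2 * ‖v‖ ^ 2 / 2) := by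
  simp_rw [exp_inner_eq]
  rw [integral_const_mul, integral_shiftDensity, mul_one]

/-- The Bregman-type entropy integrand `y log (y / c) - y + c`. -/
def entr (c y : ℝ) : ℝ := y * Real.log (y / c) - y + c

/-- Fenchel–Young inequality: `entr c` is the convex conjugate of r ↦ c (e^r - 1). It comes from 1 +
x ≤ e^x at x = r - log(y/c). -/
lemma mul_le_entr_add {c y : ℝ} (hc : 0 < c) (hy : 0 ≤ y) (r : ℝ) :
    y * r ≤ entr c y + c * (Real.exp r - 1) := by
  rcases hy.eq_or_lt with rfl | hy
  · have := Real.exp_pos r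
    simp only [entr, zero_mul, zero_sub]
    nlinarith
  · have h := Real.add_one_le_exp (r - Real.log (y / c))
    have hyc : 0 < y / c := by positivity
    rw [Real.exp_sub, Real.exp_log hyc] at h
    have h2 : y * (r - Real.log (y / c) + 1) ≤ c * Real.exp r := by
      calc y * (r - Real.log (y / c) + 1) ≤ y * (Real.exp r / (y / c)) :=
            mul_le_mul_of_nonneg_left h hy.le
        _ = c * Real.exp r := by field_simp
    unfold entr
    linarith

lemma entr_nonneg {c y : ℝ} (hc : 0 < c) (hy : 0 ≤ y) : 0 ≤ entr c y := by
  simpa using mul_le_entr_add hc hy 0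

lemma entr_le {c y : ℝ} (hc : 0 < c) (hc1 : c ≤ 1) (hy : 0 ≤ y) (hy1 : y ≤ 1) :
    entr c y ≤ 1 + Real.log (1 / c) := by
  have hl : 0 ≤ Real.log (1 / c) := Real.log_nonneg (by rw [le_div_iff₀ hc]; linarith)
  have h : y * Real.log (y / c) ≤ y * Real.log (1 / c) := by
    rcases hy.eq_or_lt with rfl | hy
    · simp
    · gcongr
  unfold entr
  nlinarith

@[fun_prop]
lemma measurable_entr (c : ℝ) : Measurable (entr c) := by unfold entr; fun_prop

/-- The second-order constant of the Gaussian shift estimate. -/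
def shiftConst (t : ℝ) : ℝ :=
  Real.exp (t ^ 2 / 2) * (Real.exp (1 / 8) * (Real.exp (t / 2) + Real.exp (-(t / 2))) - 2)

/-- The right side is 2 + 4 sinh²(x/2), and |sinh y| ≥ |y|. -/
lemma two_le_exp_add_exp_neg (x : ℝ) : 2 + x ^ 2 ≤ Real.exp x + Real.exp (-x) := by
  have h1 : Real.exp x = Real.exp (x / 2) ^ 2 := by rw [← Real.exp_nat_mul]; congr 1; push_cast; ring
  have h2 : Real.exp (-x) = Real.exp (-(x / 2)) ^ 2 := by
    rw [← Real.exp_nat_mul]; congr 1; push_cast; ring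
  have h3 : Real.exp (x / 2) * Real.exp (-(x / 2)) = 1 := by rw [← Real.exp_add]; simp
  have h4 : (x / 2) ^ 2 ≤ Real.sinh (x / 2) ^ 2 := by
    rcases le_total 0 (x / 2) with h | h
    · exact pow_le_pow_left₀ h (Real.self_le_sinh_iff.2 h) 2
    · have := Real.sinh_le_self_iff.2 h
      nlinarith
  rw [Real.sinh_eq] at h4
  nlinarith

lemma exp_add_exp_neg_mono {s t : ℝ} (hs : 0 ≤ s) (hst : s ≤ t) :
    Real.exp s + Real.exp (-s) ≤ Real.exp t + Real.exp (-t) := by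
  have := Real.cosh_eq s
  have := Real.cosh_eq t
  have : Real.cosh s ≤ Real.cosh t := by
    rw [Real.cosh_le_cosh, abs_of_nonneg hs, abs_of_nonneg (hs.trans hst)]; exact hst
  linarith

/-- Serves to absorb terms with a plain factor exp(t²/2) into the second-order term, and to see that
`shiftConst` is nonnegative. -/
lemma shiftConst_ge (t : ℝ) : 1 / 4 * Real.exp (t ^ 2 / 2) ≤ shiftConst t := by
  have h1 := two_le_exp_add_exp_neg (t / 2)
  have h2 : (9 / 8 : ℝ) ≤ Real.exp (1 / 8) := by
    have := Real.add_one_le_exp (1 / 8 : ℝ); linarith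
  have h3 := Real.exp_pos (t ^ 2 / 2)
  unfold shiftConst
  have : (9 / 8 : ℝ) * 2 ≤ Real.exp (1 / 8) * (Real.exp (t / 2) + Real.exp (-(t / 2))) :=
    mul_le_mul h2 (by nlinarith) (by norm_num) (by positivity)
  nlinarith

lemma shiftConst_mono {s t : ℝ} (hs : 0 ≤ s) (hst : s ≤ t) : shiftConst s ≤ shiftConst t := by
  unfold shiftConst
  have h1 := two_le_exp_add_exp_neg (s / 2)
  have h0 : (1 : ℝ) ≤ Real.exp (1 / 8) := Real.one_le_exp (by norm_num)
  have h2 := exp_add_exp_neg_mono (by positivity : 0 ≤ s / 2) (by linarith : s / 2 ≤ t / 2)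
  refine mul_le_mul (Real.exp_le_exp.2 (by nlinarith)) (by nlinarith) ?_ (Real.exp_pos _).le
  nlinarith

/-- The probability bound for a Gaussian of standard deviation at most `a` to exceed `1 / 100`. -/
def tailBound (a : ℝ) : ℝ := 3 * Real.exp (-(1 / (20000 * a ^ 2)))

lemma tailBound_pos (a : ℝ) : 0 < tailBound a := by unfold tailBound; positivity

/-! ### Typical and atypical directions of a Gaussian shift -/

section Shift

variable {d : ℕ} {v : Vec d} {a : ℝ}

/-- The atypical directions. -/
def atypical (v : Vec d) : Set (Vec d) := {w | 1 / 100 < |inner ℝ v w|}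

lemma measurableSet_atypical (v : Vec d) : MeasurableSet (atypical v) :=
  measurableSet_lt measurable_const (by fun_prop)

/-- Two-sided Chernoff bound with parameter 1/(100a²), which is optimal for the level 1/100 when the
standard deviation is a. -/
lemma indicator_atypical_le (ha : 0 < a) (w : Vec d) :
    (atypical v).indicator (fun _ => (1 : ℝ)) w ≤
      Real.exp (-(1 / (10000 * a ^ 2))) * (Real.exp ((1 / (100 * a ^ 2)) * inner ℝ v w) +
        Real.exp (-(1 / (100 * a ^ 2)) * inner ℝ v w)) := by
  by_cases hw : w ∈ atypical v
  · rw [Set.indicator_of_mem hw]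
    have hw' : 1 / 100 < |inner ℝ v w| := hw
    rw [mul_add, ← Real.exp_add, ← Real.exp_add]
    have e1 := Real.exp_pos (-(1 / (10000 * a ^ 2)) + 1 / (100 * a ^ 2) * inner ℝ v w)
    have e2 := Real.exp_pos (-(1 / (10000 * a ^ 2)) + -(1 / (100 * a ^ 2)) * inner ℝ v w)
    have hp : 0 < 1 / (100 * a ^ 2) := by positivity
    have hr : 1 / (10000 * a ^ 2) = 1 / (100 * a ^ 2) * (1 / 100) := by field_simp; norm_num
    rcases lt_abs.1 hw' with h | h
    · have : 1 ≤ Real.exp (-(1 / (10000 * a ^ 2)) + 1 / (100 * a ^ 2) * inner ℝ v w) := by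
        apply Real.one_le_exp; rw [hr]; nlinarith
      linarith
    · have : 1 ≤ Real.exp (-(1 / (10000 * a ^ 2)) + -(1 / (100 * a ^ 2)) * inner ℝ v w) := by
        apply Real.one_le_exp; rw [hr]; nlinarith
      linarith
  · rw [Set.indicator_of_notMem hw]; positivity

lemma integrable_indicator_atypical (v : Vec d) :
    Integrable ((atypical v).indicator fun _ => (1 : ℝ)) (stdGaussian (Vec d)) :=
  (integrable_const 1).indicator (measurableSet_atypical v)

lemma integrable_indicator_atypical_shiftDensity (v : Vec d) :
    Integrable ((atypical v).indicator (shiftDensity v)) (stdGaussian (Vec d)) :=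
  (integrable_shiftDensity v).indicator (measurableSet_atypical v)

lemma integral_indicator_atypical_le (ha : 0 < a) (hv : ‖v‖ ≤ a) :
    ∫ w, (atypical v).indicator (fun _ => (1 : ℝ)) w ∂stdGaussian (Vec d) ≤ tailBound a := by
  refine (integral_mono (integrable_indicator_atypical v)
    (((integrable_exp_inner _ v).add (integrable_exp_inner _ v)).const_mul _)
    (indicator_atypical_le ha)).trans ?_
  simp only [Pi.add_apply]
  rw [integral_const_mul, integral_add (integrable_exp_inner _ v) (integrable_exp_inner _ v),
    integral_exp_inner, integral_exp_inner, neg_sq, ← two_mul, mul_left_comm, ← Real.exp_add]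
  have hv2 : ‖v‖ ^ 2 ≤ a ^ 2 := by gcongr
  have : -(1 / (10000 * a ^ 2)) + (1 / (100 * a ^ 2)) ^ 2 * ‖v‖ ^ 2 / 2 ≤
      -(1 / (20000 * a ^ 2)) := by
    have h : (1 / (100 * a ^ 2)) ^ 2 * ‖v‖ ^ 2 ≤ (1 / (100 * a ^ 2)) ^ 2 * a ^ 2 := by gcongr
    have h2 : (1 / (100 * a ^ 2)) ^ 2 * a ^ 2 = 2 * (1 / (20000 * a ^ 2)) := by field_simp; norm_num
    have h3 : 1 / (10000 * a ^ 2) = 2 * (1 / (20000 * a ^ 2)) := by field_simp; norm_num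
    linarith
  unfold tailBound
  have := Real.exp_le_exp.2 this
  have := Real.exp_pos (-(1 / (20000 * a ^ 2)))
  linarith

/-- The same Chernoff bound under the shifted law. With Chernoff parameter l the shift only adds ±
l‖v‖² to the exponents, at most 1/100, and the constant 3 in `tailBound` leaves room for this. -/
lemma integral_indicator_atypical_shiftDensity_le (ha : 0 < a) (hv : ‖v‖ ≤ a) :
    ∫ w, (atypical v).indicator (shiftDensity v) w ∂stdGaussian (Vec d) ≤ tailBound a := by
  set l := 1 / (100 * a ^ 2) with hl
  have hl0 : 0 < l := by positivity
  have hpt : ∀ w, (atypical v).indicator (shiftDensity v) w ≤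
      (Real.exp (-(1 / (10000 * a ^ 2))) * Real.exp (-(‖v‖ ^ 2 / 2))) *
        (Real.exp ((1 + l) * inner ℝ v w) + Real.exp ((1 - l) * inner ℝ v w)) := by
    intro w
    have h := mul_le_mul_of_nonneg_left (indicator_atypical_le (v := v) ha w)
      (shiftDensity_pos v w).le
    have h1 : (atypical v).indicator (shiftDensity v) w =
        shiftDensity v w * (atypical v).indicator (fun _ => (1 : ℝ)) w := by
      by_cases hw : w ∈ atypical v <;> simp [hw]
    rw [h1]
    refine h.trans (le_of_eq ?_)
    rw [shiftDensity, sub_eq_add_neg, Real.exp_add, ← hl, add_mul, sub_mul, one_mul, neg_mul,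
      sub_eq_add_neg, Real.exp_add, Real.exp_add]
    ring
  refine (integral_mono (integrable_indicator_atypical_shiftDensity v)
    (((integrable_exp_inner _ v).add (integrable_exp_inner _ v)).const_mul _) hpt).trans ?_
  simp only [Pi.add_apply]
  rw [integral_const_mul, integral_add (integrable_exp_inner _ v) (integrable_exp_inner _ v),
    integral_exp_inner, integral_exp_inner, mul_add, ← Real.exp_add, ← Real.exp_add, ← Real.exp_add]
  have hv2 : ‖v‖ ^ 2 ≤ a ^ 2 := by gcongr
  have hla : l * a ^ 2 = 1 / 100 := by rw [hl]; field_simp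
  have hl1 : l * ‖v‖ ^ 2 ≤ 1 / 100 := by rw [← hla]; gcongr
  have hl2 : l ^ 2 * ‖v‖ ^ 2 ≤ 2 * (1 / (20000 * a ^ 2)) := by
    have : l ^ 2 * ‖v‖ ^ 2 ≤ l ^ 2 * a ^ 2 := by gcongr
    refine this.trans (le_of_eq ?_)
    rw [hl]; field_simp; norm_num
  have h3 : 1 / (10000 * a ^ 2) = 2 * (1 / (20000 * a ^ 2)) := by field_simp; norm_num
  have hv0 : 0 ≤ l * ‖v‖ ^ 2 := by positivity
  have key : ∀ x : ℝ, x ≤ 1 / 100 - 1 / (20000 * a ^ 2) →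
      Real.exp x ≤ 3 / 2 * Real.exp (-(1 / (20000 * a ^ 2))) := by
    intro x hx
    have : Real.exp x ≤ Real.exp (1 / 100 + -(1 / (20000 * a ^ 2))) := Real.exp_le_exp.2 (by linarith)
    rw [Real.exp_add] at this
    have h100 : Real.exp (1 / 100) ≤ 3 / 2 := by
      have := Real.exp_bound_div_one_sub_of_interval (x := 1 / 100) (by norm_num) (by norm_num)
      norm_num at this ⊢
      linarith
    refine this.trans ?_
    gcongr
  have k1 := key (-(1 / (10000 * a ^ 2)) + -(‖v‖ ^ 2 / 2) + (1 + l) ^ 2 * ‖v‖ ^ 2 / 2)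
    (by nlinarith)
  have k2 := key (-(1 / (10000 * a ^ 2)) + -(‖v‖ ^ 2 / 2) + (1 - l) ^ 2 * ‖v‖ ^ 2 / 2)
    (by nlinarith)
  unfold tailBound
  linarith

lemma shiftDensity_le_of_typical {w : Vec d} (hw : w ∉ atypical v) :
    shiftDensity v w ≤ Real.exp (1 / 100) := by
  have hw' : |inner ℝ v w| ≤ 1 / 100 := not_lt.1 hw
  refine Real.exp_le_exp.2 ?_
  have := le_abs_self (inner ℝ v w)
  have := sq_nonneg ‖v‖
  linarith

/-- A bounded test function sees a small Gaussian shift only up to a factor and a tail. -/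
lemma integral_mul_shiftDensity_le (ha : 0 < a) (hv : ‖v‖ ≤ a) {g : Vec d → ℝ} (hg : Measurable g)
    {B : ℝ} (hg0 : ∀ w, 0 ≤ g w) (hgB : ∀ w, g w ≤ B) :
    ∫ w, g w * shiftDensity v w ∂stdGaussian (Vec d) ≤
      Real.exp (1 / 100) * ∫ w, g w ∂stdGaussian (Vec d) + B * tailBound a := by
  have hB : 0 ≤ B := (hg0 0).trans (hgB 0)
  have hgi : Integrable g (stdGaussian (Vec d)) :=
    Integrable.of_bound hg.aestronglyMeasurable B
      (Filter.Eventually.of_forall fun w => by rw [Real.norm_of_nonneg (hg0 w)]; exact hgB w)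
  have hpt : ∀ w, g w * shiftDensity v w ≤
      Real.exp (1 / 100) * g w + B * (atypical v).indicator (shiftDensity v) w := by
    intro w
    by_cases hw : w ∈ atypical v
    · rw [Set.indicator_of_mem hw]
      have := mul_le_mul_of_nonneg_right (hgB w) (shiftDensity_pos v w).le
      have := mul_nonneg (Real.exp_pos (1 / 100)).le (hg0 w)
      linarith
    · rw [Set.indicator_of_notMem hw, mul_zero, add_zero, mul_comm]
      exact mul_le_mul_of_nonneg_right (shiftDensity_le_of_typical hw) (hg0 w)
  have hi : Integrable (fun w => g w * shiftDensity v w) (stdGaussian (Vec d)) :=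
    (integrable_shiftDensity v).bdd_mul hg.aestronglyMeasurable
      (Filter.Eventually.of_forall fun w => by rw [Real.norm_of_nonneg (hg0 w)]; exact hgB w)
  have hi2 := (integrable_indicator_atypical_shiftDensity v).const_mul B
  refine (integral_mono hi ((hgi.const_mul _).add hi2) hpt).trans ?_
  simp only [Pi.add_apply]
  rw [integral_add (hgi.const_mul _) hi2, integral_const_mul, integral_const_mul]
  gcongr
  exact integral_indicator_atypical_shiftDensity_le ha hv

end Shift

/-! ### Elementary inequalities for the second-order expansion of a likelihood ratio -/

lemma exp_le_quadratic (y : ℝ) :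
    Real.exp y ≤ 1 + y + y ^ 2 / 2 * (Real.exp y + Real.exp (-y)) := by
  rcases le_total 0 y with hy | hy
  · have hmono : MonotoneOn (fun y : ℝ => (1 + y) * Real.exp (-y) + y ^ 2 / 2) (Set.Ici 0) := by
      have hd : ∀ x : ℝ, HasDerivAt (fun y : ℝ => (1 + y) * Real.exp (-y) + y ^ 2 / 2)
          (x * (1 - Real.exp (-x))) x := by
        intro x
        have h1 := ((hasDerivAt_id x).const_add 1).mul (hasDerivAt_neg x).exp
        have h2 := (hasDerivAt_pow 2 x).div_const 2
        refine (h1.add h2).congr_deriv ?_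
        simp
        ring
      refine monotoneOn_of_deriv_nonneg (convex_Ici 0)
        (fun x _ => (hd x).continuousAt.continuousWithinAt)
        (fun x _ => (hd x).differentiableAt.differentiableWithinAt) fun x hx => ?_
      rw [(hd x).deriv]
      have hx' : 0 < x := by simpa using hx
      have : Real.exp (-x) ≤ 1 := Real.exp_le_one_iff.2 (by linarith)
      exact mul_nonneg hx'.le (by linarith)
    have h := hmono (Set.mem_Ici.2 le_rfl) (Set.mem_Ici.2 hy) hy
    simp only [add_zero, neg_zero, Real.exp_zero] at h
    have h1 : Real.exp y * Real.exp (-y) = 1 := by rw [← Real.exp_add]; simp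
    have h2 := mul_le_mul_of_nonneg_left h (Real.exp_pos y).le
    have h3 := Real.exp_pos (-y)
    nlinarith [mul_nonneg (sq_nonneg y) h3.le]
  · have h := Real.quadratic_le_exp_of_nonneg (neg_nonneg.2 hy)
    have h1 : Real.exp y * Real.exp (-y) = 1 := by rw [← Real.exp_add]; simp
    have hp := Real.exp_pos y
    -- For y ≤ 0 this comes from e^(-y) ≥ 1 - y + y²/2 and (1 + y + y²/2)(1 - y + y²/2) = 1 + y⁴/4.
    have h0 : Real.exp y ≤ 1 + y + y ^ 2 / 2 := by
      have h5 : Real.exp y * (1 + -y + (-y) ^ 2 / 2) ≤ 1 := by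
        calc _ ≤ Real.exp y * Real.exp (-y) := mul_le_mul_of_nonneg_left h hp.le
          _ = 1 := h1
      have h6 : (0 : ℝ) < 1 + -y + (-y) ^ 2 / 2 := by nlinarith
      have h7 : 1 ≤ (1 + y + y ^ 2 / 2) * (1 + -y + (-y) ^ 2 / 2) := by
        nlinarith [sq_nonneg (y ^ 2)]
      exact le_of_mul_le_mul_right (h5.trans h7) h6
    have h8 := two_le_exp_add_exp_neg y
    nlinarith [mul_nonneg (sq_nonneg y) (by nlinarith [sq_nonneg y] : 0 ≤ Real.exp y + Real.exp (-y) - 1)]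

lemma abs_exp_sub_one_le_of_small {y u : ℝ} (hy : |y| ≤ u) (hu : u ≤ 101 / 10000) :
    |Real.exp y - 1| ≤ 10101 / 10000 * u := by
  have h1 := Real.abs_exp_sub_one_sub_id_le (x := y) (by linarith)
  have hu0 : 0 ≤ u := (abs_nonneg y).trans hy
  have h2 : y ^ 2 ≤ u ^ 2 := sq_le_sq' (abs_le.1 hy).1 (abs_le.1 hy).2
  have h3 : |Real.exp y - 1| ≤ |Real.exp y - 1 - y| + |y| := by
    calc _ = |(Real.exp y - 1 - y) + y| := by congr 1; ring
      _ ≤ _ := abs_add_le _ _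
  have h4 : u ^ 2 ≤ 101 / 10000 * u := by rw [sq]; gcongr
  linarith

lemma exp_abs_add_exp_neg_abs (x : ℝ) :
    Real.exp |x| + Real.exp (-|x|) = Real.exp x + Real.exp (-x) := by
  rcases abs_choice x with h | h <;> rw [h]
  rw [neg_neg, add_comm]

lemma exp_add_exp_neg_le_of_abs_le {x y : ℝ} (h : |x| ≤ |y| + 1 / 1000) :
    Real.exp x + Real.exp (-x) ≤ 10011 / 10000 * (Real.exp y + Real.exp (-y)) := by
  rw [← exp_abs_add_exp_neg_abs x, ← exp_abs_add_exp_neg_abs y]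
  refine (exp_add_exp_neg_mono (abs_nonneg _) h).trans ?_
  have h3 : Real.exp (1 / 1000) ≤ 10011 / 10000 := by
    have := Real.exp_bound_div_one_sub_of_interval (x := 1 / 1000) (by norm_num) (by norm_num)
    norm_num at this ⊢
    linarith
  have h4 : Real.exp (-(|y| + 1 / 1000)) ≤ Real.exp (-|y|) := Real.exp_le_exp.2 (by linarith)
  rw [Real.exp_add]
  have := Real.exp_pos |y|
  have := Real.exp_pos (-|y|)
  nlinarith

/-- Here z stands for ⟨v, w⟩ and n for ‖v‖, so that e^(z - n²/2) is the likelihood ratio. On typical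
directions the ratio minus one is z up to a small relative error and a term of order n². The factor
1011/1000 in the exponent and the constants on the right pay for this replacement. -/
lemma sq_mul_exp_le_real {z n A : ℝ} (hn0 : 0 ≤ n) (hn : n ≤ 1 / 1000) (hz : |z| ≤ 1 / 100)
    (hA : 0 ≤ A) (hAn : 1011 / 1000 * A * n ≤ 2) :
    (Real.exp (z - n ^ 2 / 2) - 1) ^ 2 * (Real.exp (A * (Real.exp (z - n ^ 2 / 2) - 1)) +
        Real.exp (-(A * (Real.exp (z - n ^ 2 / 2) - 1)))) ≤
      10225 / 10000 * (z ^ 2 * (Real.exp (1011 / 1000 * A * z) + Real.exp (-(1011 / 1000 * A * z))) +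
        3 / 10000 * n ^ 2 *
          (Real.exp (1011 / 1000 * A * z) + Real.exp (-(1011 / 1000 * A * z)))) := by
  have hn2 : n ^ 2 ≤ 1 / 1000 * n := by rw [sq]; gcongr
  obtain ⟨u, hu⟩ : ∃ u, u = |z| + n ^ 2 / 2 := ⟨_, rfl⟩
  have hu0 : 0 ≤ u := by rw [hu]; positivity
  have hu1 : u ≤ 101 / 10000 := by rw [hu]; linarith
  have hy : |z - n ^ 2 / 2| ≤ u := by
    rw [hu]
    calc |z - n ^ 2 / 2| ≤ |z| + |n ^ 2 / 2| := abs_sub _ _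
      _ = _ := by rw [abs_of_nonneg (by positivity : 0 ≤ n ^ 2 / 2)]
  have hXle := abs_exp_sub_one_le_of_small hy hu1
  generalize Real.exp (z - n ^ 2 / 2) - 1 = X at hXle
  have hX2 : X ^ 2 ≤ (10101 / 10000 * u) ^ 2 := by
    rw [← sq_abs X]; gcongr
  obtain ⟨s, hs⟩ : ∃ s, s = 1011 / 1000 * A := ⟨_, rfl⟩
  rw [← hs] at hAn ⊢
  have hs0 : 0 ≤ s := by rw [hs]; positivity
  -- The term s n²/2 is at most s n/2000 ≤ 1/1000, by the bound on s n in `hAn`.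
  have hAX : |A * X| ≤ |s * z| + 1 / 1000 := by
    rw [abs_mul, abs_mul, abs_of_nonneg hA, abs_of_nonneg hs0]
    have h1 : A * |X| ≤ A * (10101 / 10000 * u) := by gcongr
    have h2 : A * (10101 / 10000 * u) ≤ s * u := by
      rw [hs]; linarith [mul_nonneg hA hu0]
    have h3 : s * n ^ 2 ≤ s * (1 / 1000 * n) := by gcongr
    have : s * u = s * |z| + s * n ^ 2 / 2 := by rw [hu]; ring
    linarith
  have hexp := exp_add_exp_neg_le_of_abs_le hAX
  have hu2 : u ^ 2 ≤ 1001 / 1000 * (z ^ 2 + 29 / 100000 * n ^ 2) := by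
    have h1 : u ^ 2 = |z| ^ 2 + |z| * n ^ 2 + n ^ 4 / 4 := by rw [hu]; ring
    have h2 : |z| * n ^ 2 ≤ n * |z| ^ 2 + n ^ 3 / 4 := by
      have := mul_nonneg hn0 (sq_nonneg (|z| - n / 2))
      linarith
    have h3 : n ^ 3 ≤ 1 / 1000 * n ^ 2 := by
      rw [pow_succ, mul_comm]; gcongr
    have h4 : n ^ 4 ≤ 1 / 1000000 * n ^ 2 := by
      have : n ^ 4 = n ^ 2 * n ^ 2 := by ring
      rw [this]; gcongr; linarith
    have h5 : n * |z| ^ 2 ≤ 1 / 1000 * |z| ^ 2 := by gcongr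
    have h6 := sq_nonneg n
    rw [h1, ← sq_abs z]
    linarith
  have ht0 : 0 ≤ Real.exp (s * z) + Real.exp (-(s * z)) := by positivity
  generalize Real.exp (s * z) + Real.exp (-(s * z)) = E at hexp ht0
  have h1 : 0 ≤ z ^ 2 * E := by positivity
  have h2 : 0 ≤ n ^ 2 * E := by positivity
  calc X ^ 2 * (Real.exp (A * X) + Real.exp (-(A * X)))
      ≤ (10101 / 10000 * u) ^ 2 * (10011 / 10000 * E) := by gcongr
    _ = (10101 / 10000) ^ 2 * (10011 / 10000) * (u ^ 2 * E) := by ring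
    _ ≤ (10101 / 10000) ^ 2 * (10011 / 10000) *
          (1001 / 1000 * (z ^ 2 + 29 / 100000 * n ^ 2) * E) := by gcongr
    _ ≤ 10225 / 10000 * (z ^ 2 * E + 3 / 10000 * n ^ 2 * E) := by
        ring_nf
        linarith

/-! ### Second moments of exponentially tilted Gaussian forms -/

section Shift

variable {d : ℕ} {v : Vec d} {a : ℝ}

/-- `e^{s z} + e^{-s z}` for `z = ⟨v, w⟩`. -/
def twoExp (s : ℝ) (v w : Vec d) : ℝ :=
  Real.exp (s * inner ℝ v w) + Real.exp (-s * inner ℝ v w)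

lemma integrable_twoExp (s : ℝ) (v : Vec d) : Integrable (twoExp s v) (stdGaussian (Vec d)) :=
  (integrable_exp_inner s v).add (integrable_exp_inner (-s) v)

lemma integral_twoExp (s : ℝ) (v : Vec d) :
    ∫ w, twoExp s v w ∂stdGaussian (Vec d) = 2 * Real.exp (s ^ 2 * ‖v‖ ^ 2 / 2) := by
  unfold twoExp
  rw [integral_add (integrable_exp_inner s v) (integrable_exp_inner (-s) v), integral_exp_inner,
    integral_exp_inner, neg_sq]
  ring

/-- From x² ≤ e^x + e^(-x) - 2 with x = z/(2‖v‖). The right side is a second difference in s of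
`twoExp`, so the second moment needs nothing but moment generating functions. -/
lemma inner_sq_mul_twoExp_le (hv : v ≠ 0) (s : ℝ) (w : Vec d) :
    (inner ℝ v w) ^ 2 * twoExp s v w ≤ 4 * ‖v‖ ^ 2 *
      (twoExp (s + 1 / (2 * ‖v‖)) v w + twoExp (s - 1 / (2 * ‖v‖)) v w - 2 * twoExp s v w) := by
  have hn : 0 < ‖v‖ := norm_pos_iff.2 hv
  set z : ℝ := inner ℝ v w with hz
  have h := two_le_exp_add_exp_neg (1 / (2 * ‖v‖) * z)
  have h2 : z ^ 2 = 4 * ‖v‖ ^ 2 * (1 / (2 * ‖v‖) * z) ^ 2 := by field_simp; norm_num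
  have hpos : 0 < twoExp s v w := by unfold twoExp; positivity
  have h3 : twoExp (s + 1 / (2 * ‖v‖)) v w + twoExp (s - 1 / (2 * ‖v‖)) v w =
      (Real.exp (1 / (2 * ‖v‖) * z) + Real.exp (-(1 / (2 * ‖v‖) * z))) * twoExp s v w := by
    simp only [twoExp, ← hz]
    have e1 : (s + 1 / (2 * ‖v‖)) * z = 1 / (2 * ‖v‖) * z + s * z := by ring
    have e2 : -(s + 1 / (2 * ‖v‖)) * z = -(1 / (2 * ‖v‖) * z) + -s * z := by ring
    have e3 : (s - 1 / (2 * ‖v‖)) * z = -(1 / (2 * ‖v‖) * z) + s * z := by ring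
    have e4 : -(s - 1 / (2 * ‖v‖)) * z = 1 / (2 * ‖v‖) * z + -s * z := by ring
    rw [e1, e2, e3, e4, Real.exp_add, Real.exp_add, Real.exp_add, Real.exp_add]
    ring
  have h4 : (1 / (2 * ‖v‖) * z) ^ 2 * twoExp s v w ≤
      twoExp (s + 1 / (2 * ‖v‖)) v w + twoExp (s - 1 / (2 * ‖v‖)) v w - 2 * twoExp s v w := by
    rw [h3]; nlinarith
  rw [h2, mul_assoc]
  exact mul_le_mul_of_nonneg_left h4 (by positivity)

lemma integrable_inner_sq_mul_twoExp (s : ℝ) (v : Vec d) :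
    Integrable (fun w => (inner ℝ v w) ^ 2 * twoExp s v w) (stdGaussian (Vec d)) := by
  by_cases hv : v = 0
  · simp [hv]
  refine Integrable.mono' ((((integrable_twoExp (s + 1 / (2 * ‖v‖)) v).add
    (integrable_twoExp (s - 1 / (2 * ‖v‖)) v)).sub ((integrable_twoExp s v).const_mul 2)).const_mul
      (4 * ‖v‖ ^ 2)) (by unfold twoExp; fun_prop) (Filter.Eventually.of_forall fun w => ?_)
  rw [Real.norm_of_nonneg (by unfold twoExp; positivity)]
  exact inner_sq_mul_twoExp_le hv s w

/-- With t = s‖v‖, `shiftConst t` is the second difference exp((t+1/2)²/2) + exp((t-1/2)²/2) - 2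
exp(t²/2) that integration of the preceding pointwise bound produces. -/
lemma integral_inner_sq_mul_twoExp_le (s : ℝ) (v : Vec d) :
    ∫ w, (inner ℝ v w) ^ 2 * twoExp s v w ∂stdGaussian (Vec d) ≤
      8 * ‖v‖ ^ 2 * shiftConst (s * ‖v‖) := by
  by_cases hv : v = 0
  · simp [hv]
  have hn : 0 < ‖v‖ := norm_pos_iff.2 hv
  refine (integral_mono (integrable_inner_sq_mul_twoExp s v)
    ((((integrable_twoExp (s + 1 / (2 * ‖v‖)) v).add (integrable_twoExp (s - 1 / (2 * ‖v‖)) v)).sub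
      ((integrable_twoExp s v).const_mul 2)).const_mul (4 * ‖v‖ ^ 2))
    (inner_sq_mul_twoExp_le hv s)).trans ?_
  simp only [Pi.add_apply, Pi.sub_apply]
  have hi : Integrable (fun w => twoExp (s + 1 / (2 * ‖v‖)) v w + twoExp (s - 1 / (2 * ‖v‖)) v w)
      (stdGaussian (Vec d)) := (integrable_twoExp _ v).add (integrable_twoExp _ v)
  rw [integral_const_mul, integral_sub hi ((integrable_twoExp s v).const_mul 2),
    integral_add (integrable_twoExp _ v) (integrable_twoExp _ v), integral_const_mul,
    integral_twoExp, integral_twoExp, integral_twoExp]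
  have e1 : (s + 1 / (2 * ‖v‖)) ^ 2 * ‖v‖ ^ 2 / 2 = (s * ‖v‖) ^ 2 / 2 + (1 / 8 + s * ‖v‖ / 2) := by
    field_simp; ring
  have e2 : (s - 1 / (2 * ‖v‖)) ^ 2 * ‖v‖ ^ 2 / 2 =
      (s * ‖v‖) ^ 2 / 2 + (1 / 8 + -(s * ‖v‖ / 2)) := by
    field_simp; ring
  have e3 : s ^ 2 * ‖v‖ ^ 2 / 2 = (s * ‖v‖) ^ 2 / 2 := by ring
  rw [e1, e2, e3, shiftConst]
  simp only [Real.exp_add]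
  apply le_of_eq
  ring

/-- Pointwise second-order bound on typical directions. -/
lemma sq_mul_exp_le_of_typical (hv : ‖v‖ ≤ 1 / 1000) {A : ℝ} (hA : 0 ≤ A)
    (hAv : 1011 / 1000 * A * ‖v‖ ≤ 2) {w : Vec d} (hw : w ∉ atypical v) :
    (shiftDensity v w - 1) ^ 2 * (Real.exp (A * (shiftDensity v w - 1)) +
        Real.exp (-(A * (shiftDensity v w - 1)))) ≤
      10225 / 10000 * ((inner ℝ v w) ^ 2 * twoExp (1011 / 1000 * A) v w +
        3 / 10000 * ‖v‖ ^ 2 * twoExp (1011 / 1000 * A) v w) := by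
  have h := sq_mul_exp_le_real (norm_nonneg v) hv (not_lt.1 hw) hA hAv
  simpa only [shiftDensity, twoExp, neg_mul] using h

end Shift

/-! ### The entropic estimate for a Gaussian shift -/

section Shift

variable {d : ℕ} {v : Vec d} {a A c t : ℝ}

/-- On typical directions this is `mul_le_entr_add` with r = A s (shiftDensity - 1), divided by A,
with the exponential expanded to second order. On atypical directions |y - c| ≤ 1 and the crude
bound by the density plus one is enough. -/
lemma signed_mul_shift_le (hv : ‖v‖ ≤ 1 / 1000) (hA : 0 < A) (hAv : 1011 / 1000 * A * ‖v‖ ≤ 2)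
    (hc : 0 < c) (hc1 : c ≤ 1) {y : ℝ} (hy0 : 0 ≤ y) (hy1 : y ≤ 1) {s : ℝ} (hs : s = 1 ∨ s = -1)
    (w : Vec d) :
    s * (y * (shiftDensity v w - 1)) ≤
      1 / A * entr c y + c * (s * (shiftDensity v w - 1)) +
        c * A / 2 * (10225 / 10000 * ((inner ℝ v w) ^ 2 * twoExp (1011 / 1000 * A) v w +
          3 / 10000 * ‖v‖ ^ 2 * twoExp (1011 / 1000 * A) v w)) +
        2 * ((atypical v).indicator (shiftDensity v) w +
          (atypical v).indicator (fun _ => (1 : ℝ)) w) := by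
  have hR : 0 ≤ 10225 / 10000 * ((inner ℝ v w) ^ 2 * twoExp (1011 / 1000 * A) v w +
      3 / 10000 * ‖v‖ ^ 2 * twoExp (1011 / 1000 * A) v w) := by
    unfold twoExp; positivity
  have hE := entr_nonneg hc hy0
  by_cases hw : w ∈ atypical v
  · rw [Set.indicator_of_mem hw, Set.indicator_of_mem hw]
    have hL := shiftDensity_pos v w
    generalize shiftDensity v w = l at hL
    have h1 : 0 ≤ 1 / A * entr c y := by positivity
    have h2 := mul_nonneg (by positivity : 0 ≤ c * A / 2) hR
    rcases hs with rfl | rfl <;> nlinarith [mul_nonneg hy0 hL.le, mul_nonneg hc.le hL.le]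
  · rw [Set.indicator_of_notMem hw, Set.indicator_of_notMem hw]
    have h1 := sq_mul_exp_le_of_typical hv hA.le hAv hw
    generalize 10225 / 10000 * ((inner ℝ v w) ^ 2 * twoExp (1011 / 1000 * A) v w +
      3 / 10000 * ‖v‖ ^ 2 * twoExp (1011 / 1000 * A) v w) = R at *
    generalize shiftDensity v w - 1 = X at *
    have h2 := mul_le_entr_add hc hy0 (A * (s * X))
    have h3 := exp_le_quadratic (A * (s * X))
    have h4 : (A * (s * X)) ^ 2 * (Real.exp (A * (s * X)) + Real.exp (-(A * (s * X)))) =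
        A ^ 2 * (X ^ 2 * (Real.exp (A * X) + Real.exp (-(A * X)))) := by
      rcases hs with rfl | rfl
      · simp only [one_mul]; ring
      · simp only [neg_mul, one_mul, mul_neg, neg_neg]; ring
    have h5 : Real.exp (A * (s * X)) - 1 ≤ A * (s * X) + A ^ 2 / 2 * R := by
      have : A ^ 2 * (X ^ 2 * (Real.exp (A * X) + Real.exp (-(A * X)))) ≤ A ^ 2 * R := by gcongr
      linarith
    have h6 : y * (A * (s * X)) ≤ entr c y + c * (A * (s * X) + A ^ 2 / 2 * R) :=
      h2.trans (by gcongr)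
    have h7 : A * (s * (y * X)) ≤
        A * (1 / A * entr c y + c * (s * X) + c * A / 2 * R + 2 * (0 + 0)) := by
      have : A * (1 / A * entr c y + c * (s * X) + c * A / 2 * R + 2 * (0 + 0)) =
          entr c y + c * (A * (s * X) + A ^ 2 / 2 * R) := by
        field_simp; ring
      rw [this]; linarith
    exact le_of_mul_le_mul_left h7 hA

/-- The main part is 8‖v‖² `shiftConst`. The correction with 3/10000 is at most a small multiple of
it by `shiftConst_ge`, and 33/4 leaves room for both numerical factors. -/
lemma integral_second_order_le (hv : ‖v‖ ≤ a) (hA : 0 < A) (hAt : 1011 / 1000 * A * a ≤ t) :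
    ∫ w, 10225 / 10000 * ((inner ℝ v w) ^ 2 * twoExp (1011 / 1000 * A) v w +
        3 / 10000 * ‖v‖ ^ 2 * twoExp (1011 / 1000 * A) v w) ∂stdGaussian (Vec d) ≤
      33 / 4 * a ^ 2 * shiftConst t := by
  set s := 1011 / 1000 * A with hs
  have hs0 : 0 ≤ s := by positivity
  have ha0 : 0 ≤ a := (norm_nonneg v).trans hv
  rw [integral_const_mul, integral_add (integrable_inner_sq_mul_twoExp s v)
    ((integrable_twoExp s v).const_mul _), integral_const_mul, integral_twoExp]
  have h1 := integral_inner_sq_mul_twoExp_le s v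
  have h2 := shiftConst_ge (s * ‖v‖)
  rw [mul_pow] at h2
  have h3 : shiftConst (s * ‖v‖) ≤ shiftConst t :=
    shiftConst_mono (by positivity) (le_trans (by gcongr) hAt)
  have h4 : ‖v‖ ^ 2 ≤ a ^ 2 := by gcongr
  have h5 := Real.exp_pos (s ^ 2 * ‖v‖ ^ 2 / 2)
  have h0 : 0 ≤ shiftConst (s * ‖v‖) := by linarith
  have h6 : ‖v‖ ^ 2 * shiftConst (s * ‖v‖) ≤ a ^ 2 * shiftConst t := by gcongr
  have h7 : ‖v‖ ^ 2 * Real.exp (s ^ 2 * ‖v‖ ^ 2 / 2) ≤ ‖v‖ ^ 2 * (4 * shiftConst (s * ‖v‖)) := by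
    gcongr; linarith
  nlinarith

lemma integrable_of_mem_Icc {α : Type*} [MeasurableSpace α] {μ : Measure α} [IsFiniteMeasure μ]
    {f : α → ℝ} (hf : Measurable f) {B : ℝ} (h0 : ∀ x, 0 ≤ f x) (hB : ∀ x, f x ≤ B) :
    Integrable f μ :=
  Integrable.of_bound hf.aestronglyMeasurable B
    (Filter.Eventually.of_forall fun w => by rw [Real.norm_of_nonneg (h0 w)]; exact hB w)

/-- Entropic form of the effect of a small Gaussian shift on a test function. -/
lemma abs_integral_shift_sub_le (ha : 0 < a) (ha1 : a ≤ 1 / 1000) (hv : ‖v‖ ≤ a) (hA : 0 < A)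
    (hAt : 1011 / 1000 * A * a ≤ t) (ht : t ≤ 2) (hc : 0 < c) (hc1 : c ≤ 1) {f : Vec d → ℝ}
    (hf : Measurable f) (hf0 : ∀ w, 0 ≤ f w) (hf1 : ∀ w, f w ≤ 1) :
    |∫ w, f w * shiftDensity v w ∂stdGaussian (Vec d) - ∫ w, f w ∂stdGaussian (Vec d)| ≤
      1 / A * ∫ w, entr c (f w) ∂stdGaussian (Vec d) + 33 / 8 * c * A * a ^ 2 * shiftConst t +
        4 * tailBound a := by
  have hAv : 1011 / 1000 * A * ‖v‖ ≤ 2 := le_trans (by gcongr) (hAt.trans ht)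
  have hfi : Integrable f (stdGaussian (Vec d)) := integrable_of_mem_Icc hf hf0 hf1
  have hei : Integrable (fun w => entr c (f w)) (stdGaussian (Vec d)) :=
    integrable_of_mem_Icc (by fun_prop) (fun w => entr_nonneg hc (hf0 w))
      (fun w => entr_le hc hc1 (hf0 w) (hf1 w))
  have hLi := integrable_shiftDensity v
  have hfLi : Integrable (fun w => f w * shiftDensity v w) (stdGaussian (Vec d)) :=
    hLi.bdd_mul hf.aestronglyMeasurable
      (Filter.Eventually.of_forall fun w => by rw [Real.norm_of_nonneg (hf0 w)]; exact hf1 w)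
  have hXi : Integrable (fun w => f w * (shiftDensity v w - 1)) (stdGaussian (Vec d)) := by
    refine (hfLi.sub hfi).congr (Filter.Eventually.of_forall fun w => ?_)
    simp only [Pi.sub_apply]; ring
  have hX : ∫ w, f w * (shiftDensity v w - 1) ∂stdGaussian (Vec d) =
      ∫ w, f w * shiftDensity v w ∂stdGaussian (Vec d) - ∫ w, f w ∂stdGaussian (Vec d) := by
    rw [← integral_sub hfLi hfi]
    exact integral_congr_ae (Filter.Eventually.of_forall fun w => by ring)
  -- The likelihood ratio has mean one. Hence the first-order term c (shiftDensity - 1) integrates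
  -- to zero, and the remaining part proportional to c is quadratic in a.
  have hX0 : ∫ w, (shiftDensity v w - 1) ∂stdGaussian (Vec d) = 0 := by
    rw [integral_sub hLi (integrable_const 1), integral_shiftDensity]; simp
  have hRi : Integrable (fun w => 10225 / 10000 * ((inner ℝ v w) ^ 2 * twoExp (1011 / 1000 * A) v w +
      3 / 10000 * ‖v‖ ^ 2 * twoExp (1011 / 1000 * A) v w)) (stdGaussian (Vec d)) :=
    ((integrable_inner_sq_mul_twoExp _ v).add ((integrable_twoExp _ v).const_mul _)).const_mul _
  have hIi : Integrable (fun w => (atypical v).indicator (shiftDensity v) w +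
      (atypical v).indicator (fun _ => (1 : ℝ)) w) (stdGaussian (Vec d)) :=
    (integrable_indicator_atypical_shiftDensity v).add (integrable_indicator_atypical v)
  have key : ∀ s : ℝ, s = 1 ∨ s = -1 →
      s * ∫ w, f w * (shiftDensity v w - 1) ∂stdGaussian (Vec d) ≤
        1 / A * ∫ w, entr c (f w) ∂stdGaussian (Vec d) + 33 / 8 * c * A * a ^ 2 * shiftConst t +
          4 * tailBound a := by
    intro s hs
    have h1 := (hei.const_mul (1 / A))
    have h2 := ((hLi.sub (integrable_const 1)).const_mul s).const_mul c
    have h3 := hRi.const_mul (c * A / 2)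
    have h4 := hIi.const_mul 2
    rw [← integral_const_mul]
    refine (integral_mono (hXi.const_mul s) (((h1.add h2).add h3).add h4) fun w =>
      signed_mul_shift_le (hv.trans ha1) hA hAv hc hc1 (hf0 w) (hf1 w) hs w).trans ?_
    rw [integral_add' ((h1.add h2).add h3) h4, integral_add' (h1.add h2) h3, integral_add' h1 h2,
      integral_const_mul, integral_const_mul, integral_const_mul, integral_const_mul,
      integral_const_mul, integral_const_mul]
    simp only [Pi.sub_apply]
    rw [hX0, integral_add (integrable_indicator_atypical_shiftDensity v)
      (integrable_indicator_atypical v)]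
    have e1 := integral_indicator_atypical_le ha hv
    have e2 := integral_indicator_atypical_shiftDensity_le ha hv
    have e3 := mul_le_mul_of_nonneg_left (integral_second_order_le hv hA hAt)
      (by positivity : 0 ≤ c * A / 2)
    rw [integral_const_mul] at e3
    have e4 : c * A / 2 * (33 / 4 * a ^ 2 * shiftConst t) =
      33 / 8 * c * A * a ^ 2 * shiftConst t := by ring
    linarith
  rw [← hX, abs_le]
  have k1 := key 1 (Or.inl rfl)
  have k2 := key (-1) (Or.inr rfl)
  constructor <;> linarith

end Shift

/-! ### Smoothing by Gaussian noise -/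

/-- The average of `f` over the Gaussian noise around `m`. -/
def smooth {d : ℕ} (σ : ℝ) (f : Vec d → ℝ) (m : Vec d) : ℝ := ∫ ζ, f (m + ζ) ∂gaussianNoise d σ

section Smooth

variable {d : ℕ} {σ : ℝ} {f : Vec d → ℝ} {m m' : Vec d} {a A c t : ℝ}

instance (d : ℕ) (σ : ℝ) : IsProbabilityMeasure (gaussianNoise d σ) :=
  Measure.isProbabilityMeasure_map (by fun_prop)

lemma smooth_eq (hf : Measurable f) (m : Vec d) :
    smooth σ f m = ∫ w, f (m + σ • w) ∂stdGaussian (Vec d) :=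
  integral_map (by fun_prop)
    (hf.comp (measurable_const_add m)).aestronglyMeasurable

lemma smooth_eq_shift (hσ : σ ≠ 0) (hf : Measurable f) (m m' : Vec d) :
    smooth σ f m' = ∫ w, f (m + σ • w) * shiftDensity (σ⁻¹ • (m' - m)) w ∂stdGaussian (Vec d) := by
  rw [smooth_eq hf, ← integral_stdGaussian_add (σ⁻¹ • (m' - m)) fun w => f (m + σ • w)]
  refine integral_congr_ae (Filter.Eventually.of_forall fun w => ?_)
  simp only [smul_add, smul_smul, mul_inv_cancel₀ hσ, one_smul]
  congr 1
  abel

lemma norm_shift_le (hσ : 0 < σ) (h : ‖m' - m‖ ≤ a * σ) : ‖σ⁻¹ • (m' - m)‖ ≤ a := by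
  rw [norm_smul, Real.norm_of_nonneg (by positivity), inv_mul_le_iff₀ hσ, mul_comm]
  exact h

lemma smooth_nonneg (hf0 : ∀ w, 0 ≤ f w) (m : Vec d) : 0 ≤ smooth σ f m :=
  integral_nonneg fun _ => hf0 _

lemma smooth_le_exp_mul (hσ : 0 < σ) (ha : 0 < a) (h : ‖m' - m‖ ≤ a * σ) {B : ℝ} (hf : Measurable f)
    (hf0 : ∀ w, 0 ≤ f w) (hfB : ∀ w, f w ≤ B) :
    smooth σ f m' ≤ Real.exp (1 / 100) * smooth σ f m + B * tailBound a := by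
  rw [smooth_eq_shift hσ.ne' hf m m', smooth_eq hf m]
  exact integral_mul_shiftDensity_le ha (norm_shift_le hσ h) (by fun_prop) (fun _ => hf0 _)
    fun _ => hfB _

lemma abs_smooth_sub_le (hσ : 0 < σ) (ha : 0 < a) (ha1 : a ≤ 1 / 1000) (h : ‖m' - m‖ ≤ a * σ)
    (hA : 0 < A) (hAt : 1011 / 1000 * A * a ≤ t) (ht : t ≤ 2) (hc : 0 < c) (hc1 : c ≤ 1)
    (hf : Measurable f) (hf0 : ∀ w, 0 ≤ f w) (hf1 : ∀ w, f w ≤ 1) :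
    |smooth σ f m' - smooth σ f m| ≤
      1 / A * smooth σ (fun w => entr c (f w)) m + 33 / 8 * c * A * a ^ 2 * shiftConst t +
        4 * tailBound a := by
  rw [smooth_eq_shift hσ.ne' hf m m', smooth_eq hf m, smooth_eq (by fun_prop) m]
  exact abs_integral_shift_sub_le ha ha1 (norm_shift_le hσ h) hA hAt ht hc hc1 (by fun_prop)
    (fun _ => hf0 _) fun _ => hf1 _

end Smooth

/-! ### The Laplace distribution -/

/-- The upper tail of the Laplace distribution of scale `1 / κ`. -/
def lapTail (κ x : ℝ) : ℝ :=
  if 0 ≤ x then 1 / 2 * Real.exp (-(κ * x)) else 1 - 1 / 2 * Real.exp (κ * x)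

lemma lapTail_of_nonneg {κ x : ℝ} (hx : 0 ≤ x) : lapTail κ x = 1 / 2 * Real.exp (-(κ * x)) :=
  if_pos hx

lemma lapTail_of_nonpos {κ x : ℝ} (hx : x ≤ 0) : lapTail κ x = 1 - 1 / 2 * Real.exp (κ * x) := by
  rcases hx.eq_or_lt with rfl | hx
  · rw [lapTail_of_nonneg le_rfl]; norm_num
  · exact if_neg (not_le.2 hx)

lemma laplace_Ici {b x : ℝ} (hb : 0 < b) (hx : 0 ≤ x) :
    laplace b (Set.Ici x) = ENNReal.ofReal (1 / 2 * Real.exp (-(1 / b * x))) := by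
  have hneg : -(1 / b) < 0 := by simpa using hb
  rw [laplace, withDensity_apply _ measurableSet_Ici]
  have h1 : ∫⁻ y in Set.Ici x, ENNReal.ofReal (1 / (2 * b) * Real.exp (-|y| / b)) =
      ∫⁻ y in Set.Ioi x, ENNReal.ofReal (1 / (2 * b) * Real.exp (-(1 / b) * y)) := by
    rw [setLIntegral_congr Ioi_ae_eq_Ici.symm]
    refine setLIntegral_congr_fun measurableSet_Ioi fun y hy => ?_
    have : 0 ≤ y := hx.trans (le_of_lt hy)
    simp only [abs_of_nonneg this]
    congr 3; ring
  have hi : IntegrableOn (fun y => 1 / (2 * b) * Real.exp (-(1 / b) * y)) (Set.Ioi x) :=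
    (integrableOn_exp_mul_Ioi hneg x).const_mul _
  rw [h1, ← ofReal_integral_eq_lintegral_ofReal hi
    (Filter.Eventually.of_forall fun y => by positivity), integral_const_mul,
    integral_exp_mul_Ioi hneg]
  congr 1
  field_simp

lemma laplace_Iio {b x : ℝ} (hb : 0 < b) (hx : x ≤ 0) :
    laplace b (Set.Iio x) = ENNReal.ofReal (1 / 2 * Real.exp (1 / b * x)) := by
  have hpos : 0 < 1 / b := by positivity
  rw [laplace, withDensity_apply _ measurableSet_Iio]
  have h1 : ∫⁻ y in Set.Iio x, ENNReal.ofReal (1 / (2 * b) * Real.exp (-|y| / b)) =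
      ∫⁻ y in Set.Iic x, ENNReal.ofReal (1 / (2 * b) * Real.exp (1 / b * y)) := by
    rw [setLIntegral_congr Iio_ae_eq_Iic]
    refine setLIntegral_congr_fun measurableSet_Iic fun y hy => ?_
    have : y ≤ 0 := le_trans hy hx
    simp only [abs_of_nonpos this]
    congr 3; ring
  have hi : IntegrableOn (fun y => 1 / (2 * b) * Real.exp (1 / b * y)) (Set.Iic x) :=
    (integrableOn_exp_mul_Iic hpos x).const_mul _
  rw [h1, ← ofReal_integral_eq_lintegral_ofReal hi
    (Filter.Eventually.of_forall fun y => by positivity), integral_const_mul,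
    integral_exp_mul_Iic hpos]
  congr 1
  field_simp

lemma isProbabilityMeasure_laplace {b : ℝ} (hb : 0 < b) : IsProbabilityMeasure (laplace b) := by
  constructor
  have h : (Set.univ : Set ℝ) = Set.Iio 0 ∪ Set.Ici 0 := Set.Iio_union_Ici.symm
  rw [h, measure_union (by
      rw [Set.disjoint_left]; intro x hx hy; exact absurd (Set.mem_Iio.1 hx) (not_lt.2 hy))
    measurableSet_Ici, laplace_Iio hb le_rfl, laplace_Ici hb le_rfl,
    ← ENNReal.ofReal_add (by positivity) (by positivity)]
  norm_num

lemma lapTail_le_one {κ : ℝ} (hκ : 0 ≤ κ) (x : ℝ) : lapTail κ x ≤ 1 := by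
  unfold lapTail
  split_ifs with h
  · have : Real.exp (-(κ * x)) ≤ 1 := Real.exp_le_one_iff.2 (by nlinarith)
    linarith
  · have := Real.exp_pos (κ * x); linarith

lemma lapTail_pos {κ : ℝ} (hκ : 0 ≤ κ) (x : ℝ) : 0 < lapTail κ x := by
  unfold lapTail
  split_ifs with h
  · positivity
  · have : Real.exp (κ * x) ≤ 1 := Real.exp_le_one_iff.2 (by nlinarith)
    linarith

lemma laplace_real_ge {b : ℝ} (hb : 0 < b) (x : ℝ) :
    (laplace b).real {v | x ≤ v} = lapTail (1 / b) x := by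
  have := isProbabilityMeasure_laplace hb
  change (laplace b).real (Set.Ici x) = _
  rcases le_total 0 x with hx | hx
  · rw [lapTail_of_nonneg hx, Measure.real, laplace_Ici hb hx, ENNReal.toReal_ofReal (by positivity)]
  · rw [lapTail_of_nonpos hx, ← Set.compl_Iio, probReal_compl_eq_one_sub measurableSet_Iio,
      Measure.real, laplace_Iio hb hx, ENNReal.toReal_ofReal (by positivity)]

/-- Shifting a Laplace variable changes expectations by a bounded factor. -/
lemma lintegral_laplace_add_le {b : ℝ} (hb : 0 < b) (s : ℝ) {h : ℝ → ℝ≥0∞} (hh : Measurable h) :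
    ∫⁻ x, h (x + s) ∂laplace b ≤
      ENNReal.ofReal (Real.exp (|s| / b)) * ∫⁻ x, h x ∂laplace b := by
  have hm : Measurable fun x : ℝ => ENNReal.ofReal ((1 / (2 * b)) * Real.exp (-|x| / b)) := by
    fun_prop
  rw [laplace, lintegral_withDensity_eq_lintegral_mul _ hm (by fun_prop),
    lintegral_withDensity_eq_lintegral_mul _ hm hh]
  simp only [Pi.mul_apply]
  rw [← lintegral_const_mul _ (by fun_prop),
    ← lintegral_add_right_eq_self (μ := volume) (fun x => ENNReal.ofReal (Real.exp (|s| / b)) *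
      (ENNReal.ofReal ((1 / (2 * b)) * Real.exp (-|x| / b)) * h x)) s]
  refine lintegral_mono fun x => ?_
  rw [← mul_assoc, ← ENNReal.ofReal_mul (Real.exp_pos _).le]
  rw [mul_left_comm (Real.exp _), ← Real.exp_add, ← add_div]
  gcongr
  have h3 : |x + s| ≤ |x| + |s| := abs_add_le x s
  linarith

lemma lapTail_neg (κ x : ℝ) : lapTail κ (-x) = 1 - lapTail κ x := by
  rcases le_total 0 x with hx | hx
  · rw [lapTail_of_nonneg hx, lapTail_of_nonpos (by linarith), mul_neg]
  · rw [lapTail_of_nonpos hx, lapTail_of_nonneg (by linarith), mul_neg]; ring_nf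

/-- An increment of the tail next to x is bounded in terms of exp(-κ|x|), the Laplace density at x
up to a constant. Bounds from above and below with this same factor make increments of different
lengths comparable. -/
lemma lapTail_sub_le (κ x : ℝ) {e : ℝ} (he : 0 ≤ e) :
    lapTail κ (x - e) - lapTail κ x ≤ 1 / 2 * Real.exp (-(κ * |x|)) * (Real.exp (κ * e) - 1) := by
  rcases le_total 0 x with hx | hx
  · rw [abs_of_nonneg hx, lapTail_of_nonneg hx]
    rcases le_total 0 (x - e) with hxe | hxe
    · rw [lapTail_of_nonneg hxe, mul_sub, neg_sub, sub_eq_add_neg (κ * e), Real.exp_add]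
      linarith
    · rw [lapTail_of_nonpos hxe]
      have h := two_le_exp_add_exp_neg (κ * (x - e))
      have h2 : Real.exp (-(κ * (x - e))) = Real.exp (-(κ * x)) * Real.exp (κ * e) := by
        rw [← Real.exp_add]; ring_nf
      nlinarith [sq_nonneg (κ * (x - e))]
  · rw [abs_of_nonpos hx, lapTail_of_nonpos hx, lapTail_of_nonpos (by linarith)]
    have h1 : Real.exp (κ * (x - e)) = Real.exp (κ * x) * Real.exp (-(κ * e)) := by
      rw [← Real.exp_add]; ring_nf
    have h2 := two_le_exp_add_exp_neg (κ * e)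
    rw [h1, mul_neg, neg_neg]
    nlinarith [Real.exp_pos (κ * x), sq_nonneg (κ * e)]

lemma lapTail_sub_add_le (κ x : ℝ) {e : ℝ} (he : 0 ≤ e) :
    lapTail κ x - lapTail κ (x + e) ≤ 1 / 2 * Real.exp (-(κ * |x|)) * (Real.exp (κ * e) - 1) := by
  have h := lapTail_sub_le κ (-x) he
  rw [show -x - e = -(x + e) by ring, lapTail_neg, lapTail_neg, abs_neg] at h
  linarith

/-- The lower counterpart: along an interval of length e the density falls below its value at x by
at most the factor e^(-κe). -/
lemma le_lapTail_sub {κ : ℝ} (hκ : 0 ≤ κ) (x : ℝ) {e : ℝ} (he : 0 ≤ e) :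
    1 / 2 * Real.exp (-(κ * |x|)) * (1 - Real.exp (-(κ * e))) ≤ lapTail κ (x - e) - lapTail κ x := by
  have hr : Real.exp (-(κ * e)) ≤ 1 := Real.exp_le_one_iff.2 (by nlinarith)
  rcases le_total 0 x with hx | hx
  · rw [abs_of_nonneg hx, lapTail_of_nonneg hx]
    have hp : Real.exp (-(κ * x)) ≤ 1 := Real.exp_le_one_iff.2 (by nlinarith)
    rcases le_total 0 (x - e) with hxe | hxe
    · have h2 := two_le_exp_add_exp_neg (κ * e)
      have h3 : Real.exp (-(κ * (x - e))) = Real.exp (-(κ * x)) * Real.exp (κ * e) := by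
        rw [← Real.exp_add]; ring_nf
      rw [lapTail_of_nonneg hxe, h3]
      nlinarith [Real.exp_pos (-(κ * x)), sq_nonneg (κ * e)]
    · rw [lapTail_of_nonpos hxe]
      have hrp : Real.exp (-(κ * e)) ≤ Real.exp (-(κ * x)) :=
        Real.exp_le_exp.2 (by nlinarith)
      have h2 : Real.exp (κ * (x - e)) * Real.exp (-(κ * x)) = Real.exp (-(κ * e)) := by
        rw [← Real.exp_add]; ring_nf
      have hq1 : Real.exp (κ * (x - e)) ≤ 1 := Real.exp_le_one_iff.2 (by nlinarith)
      have hp0 := Real.exp_pos (-(κ * x))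
      generalize Real.exp (κ * (x - e)) = Q at *
      generalize Real.exp (-(κ * x)) = p at *
      rw [← h2]
      nlinarith [mul_nonneg (sub_nonneg.2 hp) (sub_nonneg.2 hq1),
        mul_nonneg (mul_nonneg (sub_nonneg.2 hp) (sub_nonneg.2 hq1)) hp0.le]
  · rw [abs_of_nonpos hx, lapTail_of_nonpos hx, lapTail_of_nonpos (by linarith)]
    have h1 : Real.exp (κ * (x - e)) = Real.exp (κ * x) * Real.exp (-(κ * e)) := by
      rw [← Real.exp_add]; ring_nf
    rw [h1, mul_neg, neg_neg]
    linarith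

lemma lapTail_antitone {κ : ℝ} (hκ : 0 ≤ κ) : Antitone (lapTail κ) := by
  intro x y hxy
  have h := le_lapTail_sub hκ y (sub_nonneg.2 hxy)
  rw [sub_sub_cancel] at h
  have hr : Real.exp (-(κ * (y - x))) ≤ 1 := Real.exp_le_one_iff.2 (by nlinarith)
  have : 0 ≤ 1 / 2 * Real.exp (-(κ * |y|)) * (1 - Real.exp (-(κ * (y - x)))) :=
    mul_nonneg (by positivity) (by linarith)
  linarith

/-- The Laplace density at y is at most κ times the tail there, so the logarithm of the tail is
κ-Lipschitz. -/
lemma lapTail_le_exp_mul {κ : ℝ} (hκ : 0 ≤ κ) {x y e : ℝ} (he : 0 ≤ e) (h : y ≤ x + e) :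
    lapTail κ x ≤ Real.exp (κ * e) * lapTail κ y := by
  have hmono : lapTail κ (y - e) ≤ Real.exp (κ * e) * lapTail κ y := by
    have h1 := lapTail_sub_le κ y he
    have h2 : 1 / 2 * Real.exp (-(κ * |y|)) ≤ lapTail κ y := by
      rcases le_total 0 y with hy | hy
      · rw [abs_of_nonneg hy, lapTail_of_nonneg hy]
      · rw [abs_of_nonpos hy, lapTail_of_nonpos hy, mul_neg, neg_neg]
        have : Real.exp (κ * y) ≤ 1 := Real.exp_le_one_iff.2 (by nlinarith)
        linarith
    have h3 : 0 ≤ Real.exp (κ * e) - 1 := sub_nonneg.2 (Real.one_le_exp (by positivity))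
    nlinarith
  exact (lapTail_antitone hκ (by linarith)).trans hmono

lemma half_le_one_sub_lapTail {κ x : ℝ} (hκ : 0 ≤ κ) (hx : 0 ≤ x) : 1 / 2 ≤ 1 - lapTail κ x := by
  have := lapTail_antitone hκ hx
  rw [lapTail_of_nonneg le_rfl] at this
  norm_num at this
  linarith

/-- The loss of pass probability on one user out of `M + 1` is compensated on the other ones by
shifting the threshold. -/
lemma lapTail_transport {κ M s x y z : ℝ} (hκ : 0 ≤ κ) (hs : 0 ≤ s)
    (hM : Real.exp (κ * 2) - 1 ≤ M * (1 - Real.exp (-(κ * s)))) (hM0 : 0 ≤ M)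
    (hxy : |x - y| ≤ 2) (hxz : |x - z| ≤ 2) (hyz : |y - z| ≤ 2) :
    lapTail κ x - lapTail κ (y - s) ≤ M * (lapTail κ (z - s) - lapTail κ z) := by
  have hy := lapTail_antitone hκ (by linarith : y - s ≤ y)
  have hz := lapTail_antitone hκ (by linarith : z - s ≤ z)
  have hlow := le_lapTail_sub hκ z hs
  have hmain : lapTail κ x - lapTail κ y ≤
      1 / 2 * Real.exp (-(κ * |z|)) * (Real.exp (κ * 2) - 1) ∨ y ≤ x := by
    by_cases hyx : y ≤ x
    · exact Or.inr hyx
    left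
    push Not at hyx
    have h1 := abs_le.1 hxy
    have h2 := abs_le.1 hxz
    have h3 := abs_le.1 hyz
    -- The increment from x to y is compared with the density at z. If z is beyond one end, the
    -- interval lies within distance 2 on one side of z. If z is inside, the two pieces add up
    -- through (e^p - 1) + (e^q - 1) ≤ e^(p+q) - 1 for p, q ≥ 0.
    rcases le_total y z with hyz' | hyz'
    · have := lapTail_sub_le κ z (e := 2) (by norm_num)
      have := lapTail_antitone hκ (by linarith : z - 2 ≤ x)
      have := lapTail_antitone hκ hyz'
      linarith
    · rcases le_total z x with hzx | hzx
      · have := lapTail_sub_add_le κ z (e := 2) (by norm_num)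
        have := lapTail_antitone hκ (by linarith : y ≤ z + 2)
        have := lapTail_antitone hκ hzx
        linarith
      · have e1 := lapTail_sub_le κ z (sub_nonneg.2 hzx)
        have e2 := lapTail_sub_add_le κ z (sub_nonneg.2 hyz')
        rw [sub_sub_cancel] at e1
        rw [add_sub_cancel] at e2
        have e3 : Real.exp (κ * (z - x)) * Real.exp (κ * (y - z)) ≤ Real.exp (κ * 2) := by
          rw [← Real.exp_add]
          exact Real.exp_le_exp.2 (by nlinarith)
        have e4 : 1 ≤ Real.exp (κ * (z - x)) := Real.one_le_exp (mul_nonneg hκ (sub_nonneg.2 hzx))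
        have e5 : 1 ≤ Real.exp (κ * (y - z)) := Real.one_le_exp (mul_nonneg hκ (sub_nonneg.2 hyz'))
        have e6 : Real.exp (κ * (z - x)) - 1 + (Real.exp (κ * (y - z)) - 1) ≤ Real.exp (κ * 2) - 1 := by
          nlinarith
        have e7 := mul_le_mul_of_nonneg_left e6
          (by positivity : 0 ≤ 1 / 2 * Real.exp (-(κ * |z|)))
        linarith
  rcases hmain with h | h
  · have h5 : 1 / 2 * Real.exp (-(κ * |z|)) * (Real.exp (κ * 2) - 1) ≤
        M * (1 / 2 * Real.exp (-(κ * |z|)) * (1 - Real.exp (-(κ * s)))) := by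
      have := mul_le_mul_of_nonneg_left hM (by positivity : 0 ≤ 1 / 2 * Real.exp (-(κ * |z|)))
      linarith
    have h6 := mul_le_mul_of_nonneg_left hlow hM0
    linarith
  · have := lapTail_antitone hκ h
    have := mul_nonneg hM0 (sub_nonneg.2 hz)
    linarith

/-! ### Expectations over independent Bernoulli choices -/

section Bern

variable {ι : Type*} [Fintype ι] [DecidableEq ι]

/-- The expectation of `Φ` at the random set that contains each `i` independently with probability
`π i`. -/
def bern (π : ι → ℝ) (Φ : Finset ι → ℝ) : ℝ :=
  ∑ A : Finset ι, (∏ i, if i ∈ A then π i else 1 - π i) * Φ A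

/-- The weight of `A` on the coordinates other than `j`. -/
def bernWeight (π : ι → ℝ) (j : ι) (A : Finset ι) : ℝ :=
  ∏ i ∈ Finset.univ.erase j, if i ∈ A then π i else 1 - π i

lemma bern_eq_sum_erase (π : ι → ℝ) (j : ι) (Φ : Finset ι → ℝ) :
    bern π Φ = ∑ A ∈ (Finset.univ.erase j).powerset,
      bernWeight π j A * ((1 - π j) * Φ A + π j * Φ (insert j A)) := by
  have hu : (Finset.univ : Finset (Finset ι)) = (insert j (Finset.univ.erase j)).powerset := by
    rw [Finset.insert_erase (Finset.mem_univ j), Finset.powerset_univ]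
  rw [bern, hu, Finset.sum_powerset_insert (Finset.notMem_erase j _), ← Finset.sum_add_distrib]
  refine Finset.sum_congr rfl fun A hA => ?_
  have hj : j ∉ A := fun h => Finset.notMem_erase j _ (Finset.mem_powerset.1 hA h)
  have h1 : (∏ i, if i ∈ A then π i else 1 - π i) = (1 - π j) * bernWeight π j A := by
    rw [← Finset.mul_prod_erase _ _ (Finset.mem_univ j), if_neg hj, bernWeight]
  have h2 : (∏ i, if i ∈ insert j A then π i else 1 - π i) = π j * bernWeight π j A := by
    rw [← Finset.mul_prod_erase _ _ (Finset.mem_univ j), if_pos (Finset.mem_insert_self _ _),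
      bernWeight]
    congr 1
    refine Finset.prod_congr rfl fun i hi => ?_
    simp [Finset.mem_insert, Finset.ne_of_mem_erase hi]
  rw [h1, h2]
  ring

lemma bernWeight_update (π : ι → ℝ) (j : ι) (p : ℝ) (A : Finset ι) :
    bernWeight (Function.update π j p) j A = bernWeight π j A :=
  Finset.prod_congr rfl fun i hi => by
    simp [Function.update_of_ne (Finset.ne_of_mem_erase hi)]

lemma bernWeight_nonneg {π : ι → ℝ} (h0 : ∀ i, 0 ≤ π i) (h1 : ∀ i, π i ≤ 1) (j : ι)
    (A : Finset ι) : 0 ≤ bernWeight π j A :=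
  Finset.prod_nonneg fun i _ => by
    split_ifs
    · exact h0 i
    · linarith [h1 i]

lemma bern_nonneg {π : ι → ℝ} (h0 : ∀ i, 0 ≤ π i) (h1 : ∀ i, π i ≤ 1) {Φ : Finset ι → ℝ}
    (hΦ : ∀ A, 0 ≤ Φ A) : 0 ≤ bern π Φ :=
  Finset.sum_nonneg fun A _ => mul_nonneg (Finset.prod_nonneg fun i _ => by
    split_ifs
    · exact h0 i
    · linarith [h1 i]) (hΦ A)

lemma bern_add (π : ι → ℝ) (Φ Ψ : Finset ι → ℝ) :
    bern π (fun A => Φ A + Ψ A) = bern π Φ + bern π Ψ := by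
  simp only [bern, mul_add, Finset.sum_add_distrib]

lemma bern_const_mul (π : ι → ℝ) (c : ℝ) (Φ : Finset ι → ℝ) :
    bern π (fun A => c * Φ A) = c * bern π Φ := by
  simp only [bern, Finset.mul_sum]
  exact Finset.sum_congr rfl fun A _ => by ring

lemma bern_const (π : ι → ℝ) (c : ℝ) : bern π (fun _ => c) = c := by
  have h : ∑ A : Finset ι, (∏ i, if i ∈ A then π i else 1 - π i) = 1 := by
    have := Finset.prod_add π (fun i => 1 - π i) Finset.univ
    simp only [add_sub_cancel, Finset.prod_const_one, Finset.powerset_univ] at this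
    refine (this.trans (Finset.sum_congr rfl fun A _ => ?_)).symm
    rw [Finset.prod_ite]
    congr 1
    · exact Finset.prod_congr (by ext; simp) fun _ _ => rfl
    · exact Finset.prod_congr (by ext; simp) fun _ _ => rfl
  rw [bern, ← Finset.sum_mul, h, one_mul]

lemma bern_mono {π : ι → ℝ} (h0 : ∀ i, 0 ≤ π i) (h1 : ∀ i, π i ≤ 1) {Φ Ψ : Finset ι → ℝ}
    (h : ∀ A, Φ A ≤ Ψ A) : bern π Φ ≤ bern π Ψ :=
  Finset.sum_le_sum fun A _ => mul_le_mul_of_nonneg_left (h A) (Finset.prod_nonneg fun i _ => by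
    split_ifs
    · exact h0 i
    · linarith [h1 i])

/-- Only the sets avoiding `k` matter if `k` is never chosen. -/
lemma bern_congr_of_eq_zero {π : ι → ℝ} {k : ι} (hk : π k = 0) {Φ Ψ : Finset ι → ℝ}
    (h : ∀ A, k ∉ A → Φ A = Ψ A) : bern π Φ = bern π Ψ := by
  refine Finset.sum_congr rfl fun A _ => ?_
  by_cases hA : k ∈ A
  · rw [Finset.prod_eq_zero (Finset.mem_univ k) (by rw [if_pos hA, hk]), zero_mul, zero_mul]
  · rw [h A hA]

/-- `Ξ` controls the change of `Φ` along the insertion of an element of `S \ C` into a set between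
`C` and `S`, and itself changes by a factor of at most `r`. -/
structure FlipBound (C S : Finset ι) (r : ℝ) (Φ Ξ : Finset ι → ℝ) : Prop where
  nonneg : ∀ A, 0 ≤ Ξ A
  abs_sub_le : ∀ A, C ⊆ A → A ⊆ S → ∀ j ∈ S, j ∉ A → |Φ (insert j A) - Φ A| ≤ Ξ A
  abs_sub_le' : ∀ A, C ⊆ A → A ⊆ S → ∀ j ∈ S, j ∉ A → |Φ (insert j A) - Φ A| ≤ Ξ (insert j A)
  le_mul : ∀ A, C ⊆ A → A ⊆ S → ∀ j ∈ S, j ∉ A → Ξ (insert j A) ≤ r * Ξ A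
  le_mul' : ∀ A, C ⊆ A → A ⊆ S → ∀ j ∈ S, j ∉ A → Ξ A ≤ r * Ξ (insert j A)

variable {C S : Finset ι} {r : ℝ} {Φ Ξ : Finset ι → ℝ} {π π' : ι → ℝ}

lemma subset_of_bernWeight_ne_zero {j : ι} (hC : ∀ i ∈ C, π i = 1) (hS : ∀ i, i ∉ S → π i = 0)
    (hjC : j ∉ C) {A : Finset ι} (hA : j ∉ A) (hw : bernWeight π j A ≠ 0) : C ⊆ A ∧ A ⊆ S := by
  rw [bernWeight, Finset.prod_ne_zero_iff] at hw
  constructor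
  · intro i hi
    have hij : i ≠ j := fun h => hjC (h ▸ hi)
    have := hw i (Finset.mem_erase.2 ⟨hij, Finset.mem_univ i⟩)
    by_contra hiA
    rw [if_neg hiA, hC i hi] at this
    simp at this
  · intro i hi
    have hij : i ≠ j := fun h => hA (h ▸ hi)
    have := hw i (Finset.mem_erase.2 ⟨hij, Finset.mem_univ i⟩)
    by_contra hiS
    rw [if_pos hi, hS i hiS] at this
    exact this rfl

/-- The expectation is affine in each single probability, with slope the mean effect of inserting j.
-/
lemma bern_update_sub (π : ι → ℝ) (j : ι) (p : ℝ) (Φ : Finset ι → ℝ) :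
    bern (Function.update π j p) Φ - bern π Φ =
      (p - π j) * ∑ A ∈ (Finset.univ.erase j).powerset,
        bernWeight π j A * (Φ (insert j A) - Φ A) := by
  rw [bern_eq_sum_erase _ j, bern_eq_sum_erase π j, ← Finset.sum_sub_distrib, Finset.mul_sum]
  refine Finset.sum_congr rfl fun A _ => ?_
  rw [bernWeight_update, Function.update_self]
  ring

/-- The effect of inserting j is bounded by `Ξ` both before and after the insertion, hence by the
average of the two with weights 1 - π j and π j, which is what the expectation of `Ξ` contains. Sets
of weight zero need no bound. -/
lemma abs_bern_update_sub_le (h0 : ∀ i, 0 ≤ π i) (h1 : ∀ i, π i ≤ 1) {j : ι} {p s : ℝ}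
    {Ψ : Finset ι → ℝ}
    (h : p ≠ π j → ∀ A, j ∉ A → bernWeight π j A ≠ 0 →
      |Ψ (insert j A) - Ψ A| ≤ s * Ξ A ∧ |Ψ (insert j A) - Ψ A| ≤ s * Ξ (insert j A)) :
    |bern (Function.update π j p) Ψ - bern π Ψ| ≤ |p - π j| * (s * bern π Ξ) := by
  rw [bern_update_sub, abs_mul]
  by_cases hp : p = π j
  · simp [hp]
  refine mul_le_mul_of_nonneg_left ?_ (abs_nonneg _)
  rw [bern_eq_sum_erase π j, Finset.mul_sum]
  refine (Finset.abs_sum_le_sum_abs _ _).trans (Finset.sum_le_sum fun A hA => ?_)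
  have hj : j ∉ A := fun h => Finset.notMem_erase j _ (Finset.mem_powerset.1 hA h)
  have hw := bernWeight_nonneg h0 h1 j A
  rw [abs_mul, abs_of_nonneg hw]
  by_cases hw0 : bernWeight π j A = 0
  · simp [hw0]
  obtain ⟨ha, hb⟩ := h hp A hj hw0
  rw [mul_left_comm]
  refine mul_le_mul_of_nonneg_left ?_ hw
  nlinarith [h0 j, h1 j, mul_le_mul_of_nonneg_left hb (h0 j),
    mul_le_mul_of_nonneg_left ha (sub_nonneg.2 (h1 j))]

/-- Changing the probabilities from `π` to `π'`. -/
lemma FlipBound.bern_sub_le (hF : FlipBound C S r Φ Ξ) (hr : 1 ≤ r)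
    (h0 : ∀ i, 0 ≤ π i) (h1 : ∀ i, π i ≤ 1) (h0' : ∀ i, 0 ≤ π' i) (h1' : ∀ i, π' i ≤ 1)
    (hC : ∀ i ∈ C, π i = 1) (hC' : ∀ i ∈ C, π' i = 1)
    (hS : ∀ i, i ∉ S → π i = 0) (hS' : ∀ i, i ∉ S → π' i = 0) :
    |bern π' Φ - bern π Φ| ≤
        (∑ i, |π' i - π i|) * Real.exp ((r - 1) * ∑ i, |π' i - π i|) * bern π Ξ ∧
      bern π' Ξ ≤ Real.exp ((r - 1) * ∑ i, |π' i - π i|) * bern π Ξ := by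
  have hΞ : 0 ≤ bern π Ξ := bern_nonneg h0 h1 hF.nonneg
  -- The probabilities are switched one coordinate at a time. Each switch costs |π' j - π j| times
  -- the current mean of `Ξ`, and this mean grows by a factor of at most 1 + (r - 1)|π' j - π j|,
  -- whence the exponential.
  suffices H : ∀ s : Finset ι, |bern (s.piecewise π' π) Φ - bern π Φ| ≤
        (∑ i ∈ s, |π' i - π i|) * Real.exp ((r - 1) * ∑ i ∈ s, |π' i - π i|) * bern π Ξ ∧
      bern (s.piecewise π' π) Ξ ≤
        Real.exp ((r - 1) * ∑ i ∈ s, |π' i - π i|) * bern π Ξ by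
    simpa using H Finset.univ
  intro s
  induction s using Finset.induction_on with
  | empty => simp
  | insert j s hj ih =>
    obtain ⟨ih1, ih2⟩ := ih
    set ρ := s.piecewise π' π with hρ
    have hρP : ∀ {q : ℝ → Prop} (i : ι), q (π i) → q (π' i) → q (ρ i) := by
      intro q i a b
      by_cases hi : i ∈ s
      · rwa [hρ, Finset.piecewise_eq_of_mem _ _ _ hi]
      · rwa [hρ, Finset.piecewise_eq_of_notMem _ _ _ hi]
    have g0 : ∀ i, 0 ≤ ρ i := fun i => hρP (q := (0 ≤ ·)) i (h0 i) (h0' i)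
    have g1 : ∀ i, ρ i ≤ 1 := fun i => hρP (q := (· ≤ 1)) i (h1 i) (h1' i)
    have gC : ∀ i ∈ C, ρ i = 1 := fun i hi => hρP (q := (· = 1)) i (hC i hi) (hC' i hi)
    have gS : ∀ i, i ∉ S → ρ i = 0 := fun i hi => hρP (q := (· = 0)) i (hS i hi) (hS' i hi)
    have hρj : ρ j = π j := Finset.piecewise_eq_of_notMem _ _ _ hj
    have hcond : π' j ≠ ρ j → j ∈ S ∧ j ∉ C := by
      rw [hρj]
      intro hne
      refine ⟨?_, ?_⟩
      · by_contra h; exact hne (by rw [hS j h, hS' j h])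
      · intro h; exact hne (by rw [hC j h, hC' j h])
    have kΦ := abs_bern_update_sub_le (Ξ := Ξ) (Ψ := Φ) (p := π' j) g0 g1 (s := 1) (j := j)
      (fun hne A hA hw => by
        obtain ⟨hjS, hjC⟩ := hcond hne
        obtain ⟨a, b⟩ := subset_of_bernWeight_ne_zero gC gS hjC hA hw
        rw [one_mul, one_mul]
        exact ⟨hF.abs_sub_le A a b j hjS hA, hF.abs_sub_le' A a b j hjS hA⟩)
    have kΞ := abs_bern_update_sub_le (Ξ := Ξ) (Ψ := Ξ) (p := π' j) g0 g1 (j := j) (s := r - 1)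
      (fun hne A hA hw => by
        obtain ⟨hjS, hjC⟩ := hcond hne
        obtain ⟨a, b⟩ := subset_of_bernWeight_ne_zero gC gS hjC hA hw
        have e1 := hF.le_mul A a b j hjS hA
        have e2 := hF.le_mul' A a b j hjS hA
        have n1 := hF.nonneg A
        have n2 := hF.nonneg (insert j A)
        constructor <;> rw [abs_le] <;> constructor <;> nlinarith)
    rw [Finset.piecewise_insert, ← hρ, Finset.sum_insert hj]
    rw [hρj] at kΦ kΞ
    set x := |π' j - π j| with hx
    set w := ∑ i ∈ s, |π' i - π i| with hw
    have hx0 : 0 ≤ x := abs_nonneg _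
    have hw0 : 0 ≤ w := Finset.sum_nonneg fun _ _ => abs_nonneg _
    have hb : 0 ≤ bern ρ Ξ := bern_nonneg g0 g1 hF.nonneg
    have hE : Real.exp ((r - 1) * (x + w)) = Real.exp ((r - 1) * x) * Real.exp ((r - 1) * w) := by
      rw [← Real.exp_add]; ring_nf
    have hE1 := Real.add_one_le_exp ((r - 1) * x)
    have hE2 : 1 ≤ Real.exp ((r - 1) * x) := Real.one_le_exp (mul_nonneg (by linarith) hx0)
    set E := Real.exp ((r - 1) * w) with hEdef
    have hEp : 0 < E := Real.exp_pos _
    rw [one_mul] at kΦ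
    constructor
    · calc |bern (Function.update ρ j (π' j)) Φ - bern π Φ|
          ≤ |bern (Function.update ρ j (π' j)) Φ - bern ρ Φ| + |bern ρ Φ - bern π Φ| :=
            _root_.abs_sub_le _ _ _
        _ ≤ x * (E * bern π Ξ) + w * E * bern π Ξ :=
            add_le_add (kΦ.trans (mul_le_mul_of_nonneg_left ih2 hx0)) ih1
        _ = (x + w) * E * bern π Ξ := by ring
        _ ≤ _ := by
            rw [hE]
            refine mul_le_mul_of_nonneg_right ?_ hΞ
            refine mul_le_mul_of_nonneg_left ?_ (by positivity)
            nlinarith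
    · have := (abs_le.1 kΞ).2
      calc bern (Function.update ρ j (π' j)) Ξ ≤ ((r - 1) * x + 1) * bern ρ Ξ := by linarith
        _ ≤ Real.exp ((r - 1) * x) * (E * bern π Ξ) :=
            mul_le_mul hE1 ih2 hb (Real.exp_pos _).le
        _ = _ := by rw [hE]; ring

end Bern

/-! ### Minibatches that differ in one entry -/

section Batch

variable {d K : ℕ} {g g' : Fin K → Vec d} {τ : ℝ} {k : Fin K}

open Classical in
lemma closeCount_eq (g : Fin K → Vec d) (τ : ℝ) (j : Fin K) :
    closeCount g τ j = (Finset.univ.filter fun j' => ‖g j - g j'‖ ≤ 2 * τ).card := by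
  rw [closeCount, Nat.card_eq_fintype_card, Fintype.card_subtype]

lemma closeCount_le (g : Fin K → Vec d) (τ : ℝ) (j : Fin K) : closeCount g τ j ≤ K := by
  classical
  rw [closeCount_eq]
  exact (Finset.card_filter_le _ _).trans (by simp)

lemma closeCount_le_add_one (h : ∀ j, j ≠ k → g j = g' j) {j : Fin K} (hj : j ≠ k) :
    closeCount g τ j ≤ closeCount g' τ j + 1 := by
  classical
  rw [closeCount_eq, closeCount_eq]
  refine le_trans (Finset.card_le_card (t := insert k _) ?_) (Finset.card_insert_le _ _)
  intro i hi
  by_cases hik : i = k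
  · exact Finset.mem_insert.2 (Or.inl hik)
  · refine Finset.mem_insert_of_mem ?_
    simpa [← h i hik, ← h j hj] using hi

lemma abs_closeCount_sub_le (h : ∀ j, j ≠ k → g j = g' j) {j : Fin K} (hj : j ≠ k) :
    |(closeCount g τ j : ℝ) - closeCount g' τ j| ≤ 1 := by
  have h1 : (closeCount g τ j : ℝ) ≤ closeCount g' τ j + 1 :=
    mod_cast closeCount_le_add_one h hj
  have h2 : (closeCount g' τ j : ℝ) ≤ closeCount g τ j + 1 :=
    mod_cast closeCount_le_add_one (fun i hi => (h i hi).symm) hj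
  rw [abs_le]
  constructor <;> linarith

/-- The count at k changes by at most K and each other count by at most one. The sum changes by at
most 2K, and the score is the sum divided by K. -/
lemma abs_score_sub_le (h : ∀ j, j ≠ k → g j = g' j) : |score g τ - score g' τ| ≤ 2 := by
  have hK : (0 : ℝ) < K := by exact_mod_cast k.pos
  rw [score, score, ← mul_sub, ← Finset.sum_sub_distrib, abs_mul, abs_of_pos (by positivity),
    one_div, inv_mul_le_iff₀ hK]
  refine (Finset.abs_sum_le_sum_abs _ _).trans ?_
  rw [← Finset.add_sum_erase _ _ (Finset.mem_univ k)]
  have h1 : |(closeCount g τ k : ℝ) - closeCount g' τ k| ≤ K := by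
    have a : (closeCount g τ k : ℝ) ≤ K := mod_cast closeCount_le g τ k
    have b : (closeCount g' τ k : ℝ) ≤ K := mod_cast closeCount_le g' τ k
    rw [abs_le]
    constructor <;> linarith [(closeCount g τ k).cast_nonneg (α := ℝ),
      (closeCount g' τ k).cast_nonneg (α := ℝ)]
  have h2 : ∑ j ∈ Finset.univ.erase k, |(closeCount g τ j : ℝ) - closeCount g' τ j| ≤ K := by
    refine (Finset.sum_le_card_nsmul _ _ 1 fun j hj =>
      abs_closeCount_sub_le h (Finset.ne_of_mem_erase hj)).trans ?_
    rw [nsmul_eq_mul, mul_one]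
    exact_mod_cast (Finset.card_erase_le).trans (by simp)
  linarith

lemma keepProb_nonneg (K : ℕ) (h : ℝ) : 0 ≤ keepProb K h := by
  unfold keepProb
  split_ifs with h1 h2
  · exact le_rfl
  · exact zero_le_one
  · exact div_nonneg (by linarith) (by positivity)

lemma keepProb_le_one (K : ℕ) (h : ℝ) : keepProb K h ≤ 1 := by
  unfold keepProb
  split_ifs with h1 h2
  · exact zero_le_one
  · exact le_rfl
  · refine div_le_one_of_le₀ (by linarith) (by positivity)

lemma keepProb_of_ge {h : ℝ} (hh : 2 * (K : ℝ) / 3 ≤ h) : keepProb K h = 1 := by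
  unfold keepProb
  have : (0 : ℝ) ≤ K := K.cast_nonneg
  rw [if_neg (by linarith), if_pos hh]

lemma half_lt_of_keepProb_ne_zero {h : ℝ} (hh : keepProb K h ≠ 0) :
    (K : ℝ) / 2 < h ∨ (K : ℝ) = 0 := by
  by_contra hc
  push Not at hc
  apply hh
  have hK : (0 : ℝ) < K := lt_of_le_of_ne K.cast_nonneg (Ne.symm hc.2)
  unfold keepProb
  split_ifs with h1 h2
  · rfl
  · linarith
  · rw [le_antisymm hc.1 (not_lt.1 h1)]; simp

lemma keepProb_eq (hK : 0 < K) (h : ℝ) :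
    keepProb K h = max 0 (min 1 ((h - (K : ℝ) / 2) / ((K : ℝ) / 6))) := by
  have hK : (0 : ℝ) < K := by exact_mod_cast hK
  unfold keepProb
  split_ifs with h1 h2
  · have : (h - (K : ℝ) / 2) / ((K : ℝ) / 6) ≤ 0 :=
      div_nonpos_of_nonpos_of_nonneg (by linarith) (by positivity)
    rw [min_eq_right (by linarith), max_eq_left this]
  · have : 1 ≤ (h - (K : ℝ) / 2) / ((K : ℝ) / 6) := by
      rw [le_div_iff₀ (by positivity)]; linarith
    rw [min_eq_left this, max_eq_right zero_le_one]
  · have a : (h - (K : ℝ) / 2) / ((K : ℝ) / 6) ≤ 1 := by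
      rw [div_le_iff₀ (by positivity)]; linarith
    have b : 0 ≤ (h - (K : ℝ) / 2) / ((K : ℝ) / 6) := div_nonneg (by linarith) (by positivity)
    rw [min_eq_right a, max_eq_right b]

lemma abs_keepProb_sub_le (hK : 0 < K) {h h' : ℝ} (hh : |h - h'| ≤ 1) :
    |keepProb K h - keepProb K h'| ≤ 6 / K := by
  have hK' : (0 : ℝ) < K := by exact_mod_cast hK
  rw [keepProb_eq hK, keepProb_eq hK]
  refine (abs_max_sub_max_le_max _ _ _ _).trans ?_
  rw [sub_self, abs_zero, max_eq_right (abs_nonneg _)]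
  refine (abs_min_sub_min_le_max _ _ _ _).trans ?_
  rw [sub_self, abs_zero, max_eq_right (abs_nonneg _), ← sub_div, abs_div,
    abs_of_pos (by positivity : (0 : ℝ) < K / 6), sub_sub_sub_cancel_right,
    div_le_div_iff₀ (by positivity) hK']
  nlinarith

/-- The keeping probabilities of a minibatch. -/
def keepProbs (g : Fin K → Vec d) (τ : ℝ) (j : Fin K) : ℝ := keepProb K (closeCount g τ j)

lemma keepProbs_nonneg (g : Fin K → Vec d) (τ : ℝ) (j : Fin K) : 0 ≤ keepProbs g τ j :=
  keepProb_nonneg _ _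

lemma keepProbs_le_one (g : Fin K → Vec d) (τ : ℝ) (j : Fin K) : keepProbs g τ j ≤ 1 :=
  keepProb_le_one _ _

/-- Two members that may be kept have a common neighbour. -/
lemma norm_sub_le_of_keepProbs_ne_zero {i j : Fin K} (hi : keepProbs g τ i ≠ 0)
    (hj : keepProbs g τ j ≠ 0) : ‖g i - g j‖ ≤ 4 * τ := by
  classical
  have hK : (0 : ℝ) < K := by exact_mod_cast i.pos
  have h1 := (half_lt_of_keepProb_ne_zero hi).resolve_right hK.ne'
  have h2 := (half_lt_of_keepProb_ne_zero hj).resolve_right hK.ne'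
  rw [closeCount_eq] at h1 h2
  set A := Finset.univ.filter fun j' => ‖g i - g j'‖ ≤ 2 * τ
  set B := Finset.univ.filter fun j' => ‖g j - g j'‖ ≤ 2 * τ
  have h3 : K < A.card + B.card := by
    have : (K : ℝ) < A.card + B.card := by linarith
    exact_mod_cast this
  -- Two sets of more than K/2 positions out of K must meet.
  have h4 : (A ∩ B).Nonempty := by
    rw [← Finset.card_pos]
    have := Finset.card_union_add_card_inter A B
    have h5 : (A ∪ B).card ≤ K := (Finset.card_le_univ _).trans (by simp)
    omega
  obtain ⟨x, hx⟩ := h4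
  rw [Finset.mem_inter, Finset.mem_filter, Finset.mem_filter] at hx
  have : g i - g j = (g i - g x) - (g j - g x) := by abel
  rw [this]
  refine (norm_sub_le _ _).trans ?_
  linarith [hx.1.2, hx.2.2]

open Classical in
/-- The members other than `k` that are surely kept in both minibatches. -/
def core (g g' : Fin K → Vec d) (τ : ℝ) (k : Fin K) : Finset (Fin K) :=
  Finset.univ.filter fun j => j ≠ k ∧ keepProbs g τ j = 1 ∧ keepProbs g' τ j = 1

/-- Counts are at most K, so a mean count of 37K/50 forces at least 11K/50 - 3 members with count at
least 2K/3 + 1. The extra 1 keeps them above 2K/3 after the change of one entry. Without k there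
remain 11K/50 - 4 ≥ K/5, as K ≥ 200. -/
lemma div_five_le_card_core (h : ∀ j, j ≠ k → g j = g' j) (hK : 200 ≤ K)
    (hs : 37 / 50 * (K : ℝ) ≤ score g τ) : (K : ℝ) / 5 ≤ (core g g' τ k).card := by
  classical
  have hK' : (200 : ℝ) ≤ K := by exact_mod_cast hK
  set W := Finset.univ.filter fun j => 2 * (K : ℝ) / 3 + 1 ≤ closeCount g τ j with hW
  have hsub : W.erase k ⊆ core g g' τ k := by
    intro j hj
    obtain ⟨hjk, hj⟩ := Finset.mem_erase.1 hj
    have hj : 2 * (K : ℝ) / 3 + 1 ≤ closeCount g τ j := (Finset.mem_filter.1 hj).2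
    have := (abs_le.1 (abs_closeCount_sub_le (τ := τ) h hjk)).2
    exact Finset.mem_filter.2 ⟨Finset.mem_univ _, hjk, keepProb_of_ge (by linarith),
      keepProb_of_ge (by linarith)⟩
  have hcard : (W.card : ℝ) - 1 ≤ (core g g' τ k).card := by
    have h1 := Finset.card_le_card hsub
    have h2 := Finset.pred_card_le_card_erase (s := W) (a := k)
    have : W.card ≤ (core g g' τ k).card + 1 := by omega
    have : (W.card : ℝ) ≤ (core g g' τ k).card + 1 := by exact_mod_cast this
    linarith
  have hsum : ∑ j, (closeCount g τ j : ℝ) ≤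
      ∑ j : Fin K, ((2 * (K : ℝ) / 3 + 1) + if j ∈ W then (K : ℝ) / 3 else 0) := by
    refine Finset.sum_le_sum fun j _ => ?_
    split_ifs with hj
    · have : (closeCount g τ j : ℝ) ≤ K := mod_cast closeCount_le g τ j
      linarith
    · have : ¬ (2 * (K : ℝ) / 3 + 1 ≤ closeCount g τ j) := fun hh => hj (by simp [hW, hh])
      linarith
  rw [Finset.sum_add_distrib, Finset.sum_const, Finset.card_univ, Fintype.card_fin, nsmul_eq_mul,
    Finset.sum_ite_mem, Finset.univ_inter, Finset.sum_const, nsmul_eq_mul] at hsum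
  rw [score, one_div, ← div_eq_inv_mul, le_div_iff₀ (by linarith)] at hs
  have : (K : ℝ) * (11 / 50 * K - 3) ≤ K * W.card := by nlinarith
  have := le_of_mul_le_mul_left this (by linarith)
  linarith

/-- The average of the members in `A`. -/
def setMean (g : Fin K → Vec d) (A : Finset (Fin K)) : Vec d := (1 / (A.card : ℝ)) • ∑ j ∈ A, g j

lemma setMean_congr (h : ∀ j, j ≠ k → g j = g' j) {A : Finset (Fin K)} (hA : k ∉ A) :
    setMean g A = setMean g' A := by
  rw [setMean, setMean, Finset.sum_congr rfl fun j hj => h j fun hjk => hA (hjk ▸ hj)]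

lemma norm_setMean_insert_sub_le {A : Finset (Fin K)} (hA : A.Nonempty) {j : Fin K} (hj : j ∉ A)
    {D : ℝ} (hD : ∀ i ∈ A, ‖g j - g i‖ ≤ D) :
    ‖setMean g (insert j A) - setMean g A‖ ≤ D / (A.card + 1) := by
  have hc : (0 : ℝ) < A.card := by exact_mod_cast hA.card_pos
  have hkey : setMean g (insert j A) - setMean g A =
      (1 / ((A.card : ℝ) * (A.card + 1))) • ∑ i ∈ A, (g j - g i) := by
    rw [setMean, setMean, Finset.card_insert_of_notMem hj, Finset.sum_insert hj,
      Finset.sum_sub_distrib, Finset.sum_const, ← Nat.cast_smul_eq_nsmul ℝ]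
    push_cast
    rw [smul_add, smul_sub, smul_smul]
    have e1 : 1 / ((A.card : ℝ) * (A.card + 1)) * A.card = 1 / (A.card + 1) := by field_simp
    have e2 : (1 : ℝ) / (A.card + 1) - 1 / A.card = - (1 / (A.card * (A.card + 1))) := by
      field_simp; ring
    rw [e1, add_sub_assoc, ← sub_smul, e2, neg_smul, sub_eq_add_neg]
  rw [hkey, norm_smul, Real.norm_of_nonneg (by positivity)]
  have : ‖∑ i ∈ A, (g j - g i)‖ ≤ A.card * D := by
    refine (norm_sum_le_of_le _ hD).trans ?_
    rw [Finset.sum_const, nsmul_eq_mul]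
  calc 1 / ((A.card : ℝ) * (A.card + 1)) * ‖∑ i ∈ A, (g j - g i)‖
      ≤ 1 / ((A.card : ℝ) * (A.card + 1)) * (A.card * D) := by gcongr
    _ = D / (A.card + 1) := by field_simp

end Batch

/-! ### The effect of one entry on the noisy mean of the kept members -/

section Stability

variable {d K : ℕ} {g g' : Fin K → Vec d} {τ σ a A c t : ℝ} {k : Fin K} {f : Vec d → ℝ}

/-- The bound on the effect of one more kept member. -/
def flipCost (σ a A c t : ℝ) (f : Vec d → ℝ) (m : Vec d) : ℝ :=
  1 / A * (smooth σ (fun w => entr c (f w)) m +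
      (1 + Real.log (1 / c)) * tailBound a / (Real.exp (1 / 100) - 1)) +
    33 / 8 * c * A * a ^ 2 * shiftConst t + 4 * tailBound a


/-- The assumptions on the noise level under which one more kept member is negligible. -/
structure NoiseRegime (K : ℕ) (τ σ a A t : ℝ) : Prop where
  batch : 200 ≤ K
  radius_nonneg : 0 ≤ τ
  sigma_pos : 0 < σ
  shift_pos : 0 < a
  shift_le : a ≤ 1 / 1000
  radius_le : 20 * τ / K ≤ a * σ
  weight_pos : 0 < A
  weight_le : 1011 / 1000 * A * a ≤ t
  le_two : t ≤ 2

lemma flipCost_nonneg (hA : 0 < A) (hc : 0 < c) (hc1 : c ≤ 1) (hf0 : ∀ w, 0 ≤ f w) (m : Vec d) :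
    0 ≤ flipCost σ a A c t f m := by
  have h1 : 0 ≤ smooth σ (fun w => entr c (f w)) m := smooth_nonneg (fun w => entr_nonneg hc (hf0 w)) m
  have h2 : 0 ≤ Real.log (1 / c) := Real.log_nonneg (by rw [le_div_iff₀ hc]; linarith)
  have h3 : 0 < Real.exp (1 / 100) - 1 := by
    have := Real.add_one_le_exp (1 / 100 : ℝ); linarith
  have h4 := tailBound_pos a
  have h5 : 0 ≤ shiftConst t := le_trans (by positivity) (shiftConst_ge t)
  unfold flipCost
  positivity

/-- A set between `C` and `S` has at least K/5 members within 4τ of each other, so one more member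
of `S` moves its mean by at most 20τ/K ≤ aσ. This is a Gaussian shift to which the entropic estimate
applies. -/
lemma NoiseRegime.flipBound (hR : NoiseRegime K τ σ a A t) (hc : 0 < c) (hc1 : c ≤ 1)
    (hf : Measurable f) (hf0 : ∀ w, 0 ≤ f w) (hf1 : ∀ w, f w ≤ 1) {C S : Finset (Fin K)}
    (hC : (K : ℝ) / 5 ≤ C.card) (hS : ∀ i ∈ S, ∀ j ∈ S, ‖g i - g j‖ ≤ 4 * τ) :
    FlipBound C S (Real.exp (1 / 100)) (fun A => smooth σ f (setMean g A))
      (fun B => flipCost σ a A c t f (setMean g B)) := by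
  have hK : (200 : ℝ) ≤ K := by exact_mod_cast hR.batch
  have hmove : ∀ A, C ⊆ A → A ⊆ S → ∀ j ∈ S, j ∉ A →
      ‖setMean g (insert j A) - setMean g A‖ ≤ a * σ := by
    intro A hCA hAS j hj hjA
    have hcard : (K : ℝ) / 5 ≤ A.card := hC.trans (by exact_mod_cast Finset.card_le_card hCA)
    have hne : A.Nonempty := by
      rw [← Finset.card_pos]
      have : (0 : ℝ) < A.card := by linarith
      exact_mod_cast this
    refine (norm_setMean_insert_sub_le hne hjA fun i hi => hS j hj i (hAS hi)).trans
      (le_trans ?_ hR.radius_le)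
    rw [div_le_div_iff₀ (by positivity) (by linarith)]
    nlinarith [hR.radius_nonneg]
  have h2 : 0 ≤ Real.log (1 / c) := Real.log_nonneg (by rw [le_div_iff₀ hc]; linarith)
  have h3 : 0 < Real.exp (1 / 100) - 1 := by
    have := Real.add_one_le_exp (1 / 100 : ℝ); linarith
  have h4 := tailBound_pos a
  have h5 : 0 ≤ shiftConst t := le_trans (by positivity) (shiftConst_ge t)
  have hApos := hR.weight_pos
  have he0 : ∀ w, 0 ≤ entr c (f w) := fun w => entr_nonneg hc (hf0 w)
  have heB : ∀ w, entr c (f w) ≤ 1 + Real.log (1 / c) := fun w => entr_le hc hc1 (hf0 w) (hf1 w)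
  have hem : Measurable fun w => entr c (f w) := (measurable_entr c).comp hf
  have hsub : ∀ m m', ‖m' - m‖ ≤ a * σ →
      |smooth σ f m' - smooth σ f m| ≤ flipCost σ a A c t f m := by
    intro m m' h
    refine (abs_smooth_sub_le hR.sigma_pos hR.shift_pos hR.shift_le h hR.weight_pos hR.weight_le
      hR.le_two hc hc1 hf hf0 hf1).trans ?_
    have : 0 ≤ 1 / A * ((1 + Real.log (1 / c)) * tailBound a / (Real.exp (1 / 100) - 1)) := by
      positivity
    unfold flipCost
    linarith
  have hmul : ∀ m m', ‖m' - m‖ ≤ a * σ →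
      flipCost σ a A c t f m' ≤ Real.exp (1 / 100) * flipCost σ a A c t f m := by
    intro m m' h
    have k1 := smooth_le_exp_mul hR.sigma_pos hR.shift_pos h hem he0 heB
    -- The constant added to the entropy in `flipCost` solves e^(1/100) M = M + tail. It turns the
    -- bound "factor plus tail" for a shifted mean into a pure factor e^(1/100).
    have k2 : (1 + Real.log (1 / c)) * tailBound a = (Real.exp (1 / 100) - 1) *
        ((1 + Real.log (1 / c)) * tailBound a / (Real.exp (1 / 100) - 1)) := by
      field_simp
    unfold flipCost
    generalize (1 + Real.log (1 / c)) * tailBound a / (Real.exp (1 / 100) - 1) = M at *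
    rw [k2] at k1
    have k3 : 1 / A * (smooth σ (fun w => entr c (f w)) m' + M) ≤
        1 / A * (Real.exp (1 / 100) * (smooth σ (fun w => entr c (f w)) m + M)) := by
      refine mul_le_mul_of_nonneg_left ?_ (by positivity)
      linarith
    have k4 : 0 ≤ 33 / 8 * c * A * a ^ 2 * shiftConst t := by positivity
    nlinarith
  refine ⟨fun B => flipCost_nonneg hR.weight_pos hc hc1 hf0 _, ?_, ?_, ?_, ?_⟩
  · intro B h h' j hj hjB
    exact hsub _ _ (hmove B h h' j hj hjB)
  · intro B h h' j hj hjB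
    rw [abs_sub_comm]
    exact hsub _ _ (by rw [norm_sub_rev]; exact hmove B h h' j hj hjB)
  · intro B h h' j hj hjB
    exact hmul _ _ (hmove B h h' j hj hjB)
  · intro B h h' j hj hjB
    exact hmul _ _ (by rw [norm_sub_rev]; exact hmove B h h' j hj hjB)

/-- The expectation, over the outlier removal and the noise, of `f` at the private gradient
estimate. -/
def estMean (τ σ : ℝ) (f : Vec d → ℝ) (g : Fin K → Vec d) : ℝ :=
  bern (keepProbs g τ) fun A => smooth σ f (setMean g A)

/-- The effect of one entry of the minibatch. -/
lemma NoiseRegime.abs_estMean_sub_le (hR : NoiseRegime K τ σ a A t) (hc : 0 < c) (hc1 : c ≤ 1)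
    (hf : Measurable f) (hf0 : ∀ w, 0 ≤ f w) (hf1 : ∀ w, f w ≤ 1)
    (h : ∀ j, j ≠ k → g j = g' j) (hs : 37 / 50 * (K : ℝ) ≤ score g τ) :
    |estMean τ σ f g' - estMean τ σ f g| ≤
      44 / 5 * bern (keepProbs g τ) fun B => flipCost σ a A c t f (setMean g B) := by
  classical
  have hK : (200 : ℝ) ≤ K := by exact_mod_cast hR.batch
  have hK0 : 0 < K := by have := hR.batch; omega
  set π := keepProbs g τ with hπ
  set π' := keepProbs g' τ with hπ'
  -- Intermediate law that never selects k. Under it the two minibatches have the same means of kept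
  -- members, so the change of entry is free there. Being below both laws, it is supported in both
  -- sets of possible members.
  set π₀ : Fin K → ℝ := fun j => if j = k then 0 else min (π j) (π' j) with hπ₀
  set C := core g g' τ k
  have h0 : ∀ i, 0 ≤ π i := keepProbs_nonneg g τ
  have h1 : ∀ i, π i ≤ 1 := keepProbs_le_one g τ
  have h0' : ∀ i, 0 ≤ π' i := keepProbs_nonneg g' τ
  have h1' : ∀ i, π' i ≤ 1 := keepProbs_le_one g' τ
  have h00 : ∀ i, 0 ≤ π₀ i := fun i => by
    simp only [hπ₀]; split_ifs
    · exact le_rfl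
    · exact le_min (h0 i) (h0' i)
  have h01 : ∀ i, π₀ i ≤ 1 := fun i => by
    simp only [hπ₀]; split_ifs
    · exact zero_le_one
    · exact (min_le_left _ _).trans (h1 i)
  have hCm : ∀ i ∈ C, i ≠ k ∧ π i = 1 ∧ π' i = 1 := fun i hi => (Finset.mem_filter.1 hi).2
  have hC0 : ∀ i ∈ C, π₀ i = 1 := fun i hi => by
    obtain ⟨a1, a2, a3⟩ := hCm i hi
    simp [hπ₀, a1, a2, a3]
  have hCc : (K : ℝ) / 5 ≤ C.card := div_five_le_card_core h hR.batch hs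
  set S := Finset.univ.filter fun j => π j ≠ 0 with hS
  set S' := Finset.univ.filter fun j => π' j ≠ 0 with hS'
  have hSz : ∀ i, i ∉ S → π i = 0 := fun i hi => by simpa [hS] using hi
  have hSz' : ∀ i, i ∉ S' → π' i = 0 := fun i hi => by simpa [hS'] using hi
  have hS0 : ∀ i, i ∉ S → π₀ i = 0 := fun i hi => by
    simp only [hπ₀]; split_ifs
    · rfl
    · rw [hSz i hi, min_eq_left (h0' i)]
  have hS0' : ∀ i, i ∉ S' → π₀ i = 0 := fun i hi => by
    simp only [hπ₀]; split_ifs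
    · rfl
    · rw [hSz' i hi, min_eq_right (h0 i)]
  have F := hR.flipBound (C := C) (S := S) (g := g) hc hc1 hf hf0 hf1 hCc fun i hi j hj =>
    norm_sub_le_of_keepProbs_ne_zero (Finset.mem_filter.1 hi).2 (Finset.mem_filter.1 hj).2
  have F' := hR.flipBound (C := C) (S := S') (g := g') hc hc1 hf hf0 hf1 hCc fun i hi j hj =>
    norm_sub_le_of_keepProbs_ne_zero (Finset.mem_filter.1 hi).2 (Finset.mem_filter.1 hj).2
  have hr : (1 : ℝ) ≤ Real.exp (1 / 100) := Real.one_le_exp (by norm_num)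
  obtain ⟨a1, a2⟩ := F.bern_sub_le hr h0 h1 h00 h01 (fun i hi => (hCm i hi).2.1) hC0 hSz hS0
  obtain ⟨b1, b2⟩ := F'.bern_sub_le hr h00 h01 h0' h1' hC0 (fun i hi => (hCm i hi).2.2) hS0' hSz'
  have hk0 : π₀ k = 0 := by simp [hπ₀]
  have q1 : (bern π₀ fun B => smooth σ f (setMean g' B)) = bern π₀ fun B => smooth σ f (setMean g B) :=
    bern_congr_of_eq_zero hk0 fun B hB => by rw [setMean_congr h hB]
  have q2 : (bern π₀ fun B => flipCost σ a A c t f (setMean g' B)) =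
      bern π₀ fun B => flipCost σ a A c t f (setMean g B) :=
    bern_congr_of_eq_zero hk0 fun B hB => by rw [setMean_congr h hB]
  rw [q1, q2] at b1
  set Ξ := bern π fun B => flipCost σ a A c t f (setMean g B) with hΞ
  have hΞ0 : 0 ≤ Ξ := bern_nonneg h0 h1 F.nonneg
  set x := ∑ i, |π₀ i - π i| with hx
  set y := ∑ i, |π' i - π₀ i| with hy
  have hx0 : 0 ≤ x := Finset.sum_nonneg fun _ _ => abs_nonneg _
  have hy0 : 0 ≤ y := Finset.sum_nonneg fun _ _ => abs_nonneg _
  -- At k the two moves to and from 0 cost at most 2. Every other count changes by at most one and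
  -- the keeping ramp has slope 6/K, which gives at most 6 in total.
  have hxy : x + y ≤ 8 := by
    rw [hx, hy, ← Finset.sum_add_distrib, ← Finset.add_sum_erase _ _ (Finset.mem_univ k)]
    have e1 : |π₀ k - π k| + |π' k - π₀ k| ≤ 2 := by
      rw [hk0, zero_sub, abs_neg, sub_zero, abs_of_nonneg (h0 k), abs_of_nonneg (h0' k)]
      linarith [h1 k, h1' k]
    have e2 : ∑ i ∈ Finset.univ.erase k, (|π₀ i - π i| + |π' i - π₀ i|) ≤ K * (6 / K) := by
      refine (Finset.sum_le_card_nsmul _ _ (6 / (K : ℝ)) fun j hj => ?_).trans ?_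
      · have hjk := Finset.ne_of_mem_erase hj
        have := abs_keepProb_sub_le hK0 (abs_closeCount_sub_le (τ := τ) h hjk)
        change |π j - π' j| ≤ _ at this
        simp only [hπ₀, if_neg hjk]
        rcases le_total (π j) (π' j) with hh | hh
        · rw [min_eq_left hh, sub_self, abs_zero, zero_add, abs_sub_comm]
          exact this
        · rw [min_eq_right hh, sub_self, abs_zero, add_zero, abs_sub_comm]
          exact this
      · rw [nsmul_eq_mul]
        gcongr
        exact (Finset.card_erase_le).trans (by simp)
    have e3 : (K : ℝ) * (6 / K) = 6 := by field_simp
    linarith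
  have hrr : Real.exp (1 / 100) - 1 ≤ 101 / 10000 := by
    have := Real.exp_bound' (x := 1 / 100) (by norm_num) (by norm_num) (n := 2) (by norm_num)
    norm_num [Finset.sum_range_succ, Nat.factorial] at this ⊢
    linarith
  have hexp : Real.exp ((Real.exp (1 / 100) - 1) * (x + y)) ≤ 11 / 10 := by
    refine (Real.exp_le_exp.2 (by nlinarith : _ ≤ (808 / 10000 : ℝ))).trans ?_
    have := Real.exp_bound' (x := 808 / 10000) (by norm_num) (by norm_num) (n := 2) (by norm_num)
    norm_num [Finset.sum_range_succ, Nat.factorial] at this ⊢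
    linarith
  have hEE : Real.exp ((Real.exp (1 / 100) - 1) * (x + y)) =
      Real.exp ((Real.exp (1 / 100) - 1) * x) * Real.exp ((Real.exp (1 / 100) - 1) * y) := by
    rw [← Real.exp_add]; ring_nf
  have hEx : 1 ≤ Real.exp ((Real.exp (1 / 100) - 1) * x) :=
    Real.one_le_exp (mul_nonneg (by linarith) hx0)
  have hEy : 1 ≤ Real.exp ((Real.exp (1 / 100) - 1) * y) :=
    Real.one_le_exp (mul_nonneg (by linarith) hy0)
  generalize Real.exp ((Real.exp (1 / 100) - 1) * x) = Ex at *
  generalize Real.exp ((Real.exp (1 / 100) - 1) * y) = Ey at *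
  rw [hEE] at hexp
  have c2 : y * Ey * bern π₀ (fun B => flipCost σ a A c t f (setMean g B)) ≤ y * Ey * (Ex * Ξ) :=
    mul_le_mul_of_nonneg_left a2 (by positivity)
  have c1 : x * Ex * Ξ ≤ x * (Ex * Ey) * Ξ := by
    refine mul_le_mul_of_nonneg_right ?_ hΞ0
    refine mul_le_mul_of_nonneg_left ?_ hx0
    nlinarith
  -- This is 8 · 11/10.
  have c3 : (x + y) * (Ex * Ey) ≤ 44 / 5 := by nlinarith
  have c4 := mul_le_mul_of_nonneg_right c3 hΞ0
  refine (_root_.abs_sub_le _ _ _).trans ((add_le_add b1 a1).trans ?_)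
  linarith

end Stability

/-! ### One step: the effect of one user at one position of the minibatch -/

section Transport

variable {K N : ℕ}

/-- Resampling one coordinate does not change a uniform average. -/
lemma sum_sum_update (k : Fin K) (X : (Fin K → Fin N) → ℝ) :
    ∑ J : Fin K → Fin N, ∑ v : Fin N, X (Function.update J k v) = N * ∑ J, X J := by
  let e : (Fin K → Fin N) × Fin N ≃ (Fin K → Fin N) × Fin N :=
    Function.Involutive.toPerm (fun p => (Function.update p.1 k p.2, p.1 k)) fun p => by simp
  have h : ∑ p : (Fin K → Fin N) × Fin N, X (e p).1 = ∑ p : (Fin K → Fin N) × Fin N, X p.1 :=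
    Equiv.sum_comp e fun p => X p.1
  rw [Fintype.sum_prod_type, Fintype.sum_prod_type] at h
  refine h.trans ?_
  rw [Finset.mul_sum]
  exact Finset.sum_congr rfl fun J _ => by simp

/-- Weighted averages of two functions of the sampled users that only differ where user `u` is
sampled at position `k`. -/
lemma sum_mul_le_of_transport (hN : 2 ≤ N) (k : Fin K) (u : Fin N)
    {w w' Φ Φ' E Fl : (Fin K → Fin N) → ℝ} {good : (Fin K → Fin N) → Prop} {e η : ℝ}
    (hw0 : ∀ J, 0 ≤ w J) (hw0' : ∀ J, 0 ≤ w' J) (hΦ0 : ∀ J, 0 ≤ Φ J) (hΦ1 : ∀ J, Φ J ≤ 1)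
    (hΦ0' : ∀ J, 0 ≤ Φ' J) (hE0 : ∀ J, 0 ≤ E J) (hF0 : ∀ J, 0 ≤ Fl J) (he : 0 ≤ e) (hη : 0 ≤ η)
    (heq : ∀ J, J k ≠ u → Φ J = Φ' J) (hle : ∀ J, J k ≠ u → w J ≤ w' J)
    (hmul : ∀ J, J k ≠ u → w (Function.update J k u) ≤ e * w J)
    (htr : ∀ J, J k ≠ u → w (Function.update J k u) - w' (Function.update J k u) ≤
      ((N : ℝ) - 1) * (w' J - w J))
    (hgood : ∀ J, J k ≠ u → good J → |Φ (Function.update J k u) - Φ J| ≤ E J)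
    (hgood' : ∀ J, J k ≠ u → good J → |Φ' (Function.update J k u) - Φ' J| ≤ E J)
    (hbad : ∀ J, J k ≠ u → ¬ good J → w J ≤ η ∧ 1 / 2 ≤ Fl J) :
    ∑ J, w J * Φ J ≤ ∑ J, w' J * Φ' J +
      ∑ J, (if J k = u then 0 else
        2 * e / ((N : ℝ) - 1) * (w J * E J) + 2 * e * η / ((N : ℝ) - 1) * Fl J) := by
  classical
  have hN' : (2 : ℝ) ≤ N := by exact_mod_cast hN
  have hN1 : (0 : ℝ) < (N : ℝ) - 1 := by linarith
  rw [← Finset.sum_add_distrib]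
  have hNpos : (0 : ℝ) < N := by linarith
  refine le_of_mul_le_mul_left ?_ hNpos
  rw [← sum_sum_update k, ← sum_sum_update k]
  refine Finset.sum_le_sum fun J _ => ?_
  have hcard : ((Finset.univ.erase u).card : ℝ) = (N : ℝ) - 1 := by
    rw [Finset.card_erase_of_mem (Finset.mem_univ u), Finset.card_univ, Fintype.card_fin,
      Nat.cast_sub (by omega), Nat.cast_one]
  -- The term where u is drawn at position k is spread evenly over the N - 1 other users. Each of
  -- these then pays for a share 1/(N - 1) of the change at u.
  have hsplit : ∀ Y : Fin N → ℝ,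
      ∑ v, Y v = ∑ v ∈ Finset.univ.erase u, (1 / ((N : ℝ) - 1) * Y u + Y v) := by
    intro Y
    rw [Finset.sum_add_distrib, Finset.sum_const, nsmul_eq_mul, hcard, ← mul_assoc,
      mul_one_div_cancel hN1.ne', one_mul, Finset.add_sum_erase _ _ (Finset.mem_univ u)]
  rw [hsplit, hsplit]
  refine Finset.sum_le_sum fun v hv => ?_
  have hvu : v ≠ u := Finset.ne_of_mem_erase hv
  set V := Function.update J k v with hV
  have hVk : V k ≠ u := by simpa [hV] using hvu
  have hU : Function.update J k u = Function.update V k u := by simp [hV]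
  rw [hU]
  set U := Function.update V k u with hUdef
  have hUk : U k = u := by simp [hUdef]
  simp only [if_pos hUk, if_neg hVk, add_zero]
  have h1 := heq V hVk
  have h2 := hle V hVk
  have h3 := hmul V hVk
  have h4 := htr V hVk
  rw [← h1]
  by_cases hg : good V
  · have g1 := abs_le.1 (hgood V hVk hg)
    have g2 := abs_le.1 (hgood' V hVk hg)
    rw [← h1] at g2
    -- Both values at u are within `E V` of the common value `Φ V`. The difference of weights times
    -- `Φ V` is compensated by the gain w' - w at V, and the deviations cost at most 2 w(U) E(V).
    have key : w U * Φ U - w' U * Φ' U ≤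
        ((N : ℝ) - 1) * (w' V - w V) * Φ V + 2 * (w U * E V) := by
      have a1 : w U * Φ U ≤ w U * (Φ V + E V) := mul_le_mul_of_nonneg_left (by linarith) (hw0 U)
      rcases le_total (w U) (w' U) with hh | hh
      · have a2 : w U * (Φ V - E V) ≤ w' U * Φ' U :=
          (mul_le_mul_of_nonneg_left (by linarith) (hw0 U)).trans
            (mul_le_mul_of_nonneg_right hh (hΦ0' U))
        have a3 : 0 ≤ ((N : ℝ) - 1) * (w' V - w V) * Φ V :=
          mul_nonneg (mul_nonneg hN1.le (by linarith)) (hΦ0 V)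
        nlinarith
      · have a2 : w' U * (Φ V - E V) ≤ w' U * Φ' U :=
          mul_le_mul_of_nonneg_left (by linarith) (hw0' U)
        have a3 : w' U * E V ≤ w U * E V := mul_le_mul_of_nonneg_right hh (hE0 V)
        have a4 := mul_le_mul_of_nonneg_right h4 (hΦ0 V)
        nlinarith
    have key2 : w U * E V ≤ e * w V * E V := mul_le_mul_of_nonneg_right h3 (hE0 V)
    have hc : 0 ≤ 2 * e * η / ((N : ℝ) - 1) * Fl V := mul_nonneg (by positivity) (hF0 V)
    have key3 : 1 / ((N : ℝ) - 1) * (w U * Φ U - w' U * Φ' U) ≤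
        1 / ((N : ℝ) - 1) * (((N : ℝ) - 1) * (w' V - w V) * Φ V + 2 * (e * w V * E V)) :=
      mul_le_mul_of_nonneg_left (by linarith) (by positivity)
    have e1 : 1 / ((N : ℝ) - 1) * (((N : ℝ) - 1) * (w' V - w V) * Φ V + 2 * (e * w V * E V)) =
        (w' V - w V) * Φ V + 2 * e / ((N : ℝ) - 1) * (w V * E V) := by
      field_simp
    rw [e1] at key3
    linarith
  · obtain ⟨b1, b2⟩ := hbad V hVk hg
    -- In a bad minibatch nothing is known about Φ, but its weight is at most `e * η`. The loss is
    -- charged to `Fl`, which is at least 1/2 there.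
    have c1 : w U * Φ U ≤ e * η := by
      calc w U * Φ U ≤ w U * 1 := mul_le_mul_of_nonneg_left (hΦ1 U) (hw0 U)
        _ ≤ e * w V := by linarith
        _ ≤ _ := mul_le_mul_of_nonneg_left b1 he
    have c2 : 1 / ((N : ℝ) - 1) * (w U * Φ U) ≤ 2 * e * η / ((N : ℝ) - 1) * Fl V := by
      have : 1 / ((N : ℝ) - 1) * (w U * Φ U) ≤ 1 / ((N : ℝ) - 1) * (e * η) :=
        mul_le_mul_of_nonneg_left c1 (by positivity)
      have h5 : 2 * e * η / ((N : ℝ) - 1) * (1 / 2) ≤ 2 * e * η / ((N : ℝ) - 1) * Fl V :=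
        mul_le_mul_of_nonneg_left b2 (by positivity)
      have e2 : 1 / ((N : ℝ) - 1) * (e * η) = 2 * e * η / ((N : ℝ) - 1) * (1 / 2) := by ring
      linarith
    have c3 : w V * Φ V ≤ w' V * Φ V := mul_le_mul_of_nonneg_right h2 (hΦ0 V)
    have c4 : 0 ≤ 1 / ((N : ℝ) - 1) * (w' U * Φ' U) :=
      mul_nonneg (by positivity) (mul_nonneg (hw0' U) (hΦ0' U))
    have c5 : 0 ≤ 2 * e / ((N : ℝ) - 1) * (w V * E V) :=
      mul_nonneg (by positivity) (mul_nonneg (hw0 V) (hE0 V))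
    linarith

end Transport

/-- The pointwise form of the change from a mean to a power mean. -/
lemma add_mul_entr_le {b c y : ℝ} (hb : 1 ≤ b) (hc : 0 < c) (hy : 0 ≤ y) :
    y + (1 - 1 / b) * entr c y ≤ c ^ (1 - b) / b * y ^ b + c * (1 - 1 / b) := by
  have hb0 : 0 < b := by linarith
  rcases hy.eq_or_lt with rfl | hy
  · rw [Real.zero_rpow hb0.ne', entr]
    simp
    linarith
  · set t := y / c with ht
    have ht0 : 0 < t := by positivity
    have hyt : y = c * t := by rw [ht]; field_simp
    -- The tangent inequality 1 + x ≤ e^x at x = (b - 1) log t. Multiplied by y/b it becomes the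
    -- claim.
    have h1 : 1 + (b - 1) * Real.log t ≤ t ^ (b - 1) := by
      rw [Real.rpow_def_of_pos ht0, mul_comm (b - 1)]
      have := Real.add_one_le_exp (Real.log t * (b - 1))
      linarith
    have h2 : c ^ (1 - b) * y ^ b = y * t ^ (b - 1) := by
      rw [ht, Real.div_rpow hy.le hc.le, Real.rpow_sub_one hy.ne', show 1 - b = -(b - 1) by ring,
        Real.rpow_neg hc.le]
      field_simp
    rw [div_mul_eq_mul_div, h2, entr, ← ht]
    have h3 : y / b * (1 + (b - 1) * Real.log t) ≤ y / b * t ^ (b - 1) :=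
      mul_le_mul_of_nonneg_left h1 (by positivity)
    have h4 : y / b * (1 + (b - 1) * Real.log t) =
        y + (1 - 1 / b) * (y * Real.log t - y) := by field_simp; ring
    have h5 : y * t ^ (b - 1) / b = y / b * t ^ (b - 1) := by ring
    rw [h5]
    linarith

/-! ### One step as an averaging operator on test functions -/

section StepMean

variable {d K N : ℕ}

/-- The members of the minibatch of the users `J`, from a table of gradients indexed by the
position and the user. -/
def batch (q : Fin K → Fin N → Vec d) (J : Fin K → Fin N) : Fin K → Vec d := fun j => q j (J j)

/-- The probability that a minibatch passes the threshold test. -/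
def passProb (κ τ ξ : ℝ) (g : Fin K → Vec d) : ℝ := lapTail κ (4 * (K : ℝ) / 5 + ξ - score g τ)

/-- The expected value after one step: `f` at the gradient estimate if the test is passed, and
`h` otherwise. -/
def stepMean (κ τ σ : ℝ) (q : Fin K → Fin N → Vec d) (ξ : ℝ) (f : Vec d → ℝ) (h : ℝ) : ℝ :=
  1 / (N : ℝ) ^ K * ∑ J : Fin K → Fin N, (passProb κ τ ξ (batch q J) * estMean τ σ f (batch q J) +
    (1 - passProb κ τ ξ (batch q J)) * h)

variable {κ τ σ ξ a A c t : ℝ} {q q' : Fin K → Fin N → Vec d} {f f' : Vec d → ℝ} {h h' : ℝ}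

lemma passProb_pos (hκ : 0 ≤ κ) (τ ξ : ℝ) (g : Fin K → Vec d) : 0 < passProb κ τ ξ g :=
  lapTail_pos hκ _

lemma passProb_le_one (hκ : 0 ≤ κ) (τ ξ : ℝ) (g : Fin K → Vec d) : passProb κ τ ξ g ≤ 1 :=
  lapTail_le_one hκ _

lemma smooth_mono (hf : Measurable f) (hf' : Measurable f') (h0 : ∀ w, 0 ≤ f w)
    (hff : ∀ w, f w ≤ f' w) {B : ℝ} (hB : ∀ w, f' w ≤ B) (m : Vec d) :
    smooth σ f m ≤ smooth σ f' m :=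
  integral_mono
    (integrable_of_mem_Icc (B := B) (hf.comp (measurable_const_add m)) (fun _ => h0 _) fun _ =>
      (hff _).trans (hB _))
    (integrable_of_mem_Icc (B := B) (hf'.comp (measurable_const_add m)) (fun _ => (h0 _).trans (hff _))
      fun _ => hB _) fun _ => hff _

lemma smooth_add_mul (hf : Measurable f) (hf' : Measurable f') (h0 : ∀ w, 0 ≤ f w)
    (h0' : ∀ w, 0 ≤ f' w) {B : ℝ} (hB : ∀ w, f w ≤ B) (hB' : ∀ w, f' w ≤ B) (x y : ℝ) (m : Vec d) :
    smooth σ (fun w => x * f w + y * f' w) m = x * smooth σ f m + y * smooth σ f' m := by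
  unfold smooth
  rw [integral_add, integral_const_mul, integral_const_mul]
  · exact (integrable_of_mem_Icc (B := B) (hf.comp (measurable_const_add m)) (fun _ => h0 _)
      fun _ => hB _).const_mul _
  · exact (integrable_of_mem_Icc (B := B) (hf'.comp (measurable_const_add m)) (fun _ => h0' _)
      fun _ => hB' _).const_mul _

lemma smooth_const (x : ℝ) (m : Vec d) : smooth σ (fun _ => x) m = x := by simp [smooth]

lemma estMean_nonneg (h0 : ∀ w, 0 ≤ f w) (g : Fin K → Vec d) : 0 ≤ estMean τ σ f g :=
  bern_nonneg (keepProbs_nonneg g τ) (keepProbs_le_one g τ) fun _ => smooth_nonneg h0 _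

lemma estMean_mono (hf : Measurable f) (hf' : Measurable f') (h0 : ∀ w, 0 ≤ f w)
    (hff : ∀ w, f w ≤ f' w) {B : ℝ} (hB : ∀ w, f' w ≤ B) (g : Fin K → Vec d) :
    estMean τ σ f g ≤ estMean τ σ f' g :=
  bern_mono (keepProbs_nonneg g τ) (keepProbs_le_one g τ) fun _ => smooth_mono hf hf' h0 hff hB _

lemma estMean_add_mul (hf : Measurable f) (hf' : Measurable f') (h0 : ∀ w, 0 ≤ f w)
    (h0' : ∀ w, 0 ≤ f' w) {B : ℝ} (hB : ∀ w, f w ≤ B) (hB' : ∀ w, f' w ≤ B) (x y : ℝ)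
    (g : Fin K → Vec d) :
    estMean τ σ (fun w => x * f w + y * f' w) g = x * estMean τ σ f g + y * estMean τ σ f' g := by
  unfold estMean
  simp only [smooth_add_mul hf hf' h0 h0' hB hB', bern_add, bern_const_mul]

lemma estMean_const (x : ℝ) (g : Fin K → Vec d) : estMean τ σ (fun _ => x) g = x := by
  simp only [estMean, smooth_const, bern_const]

lemma estMean_le_one (hf : Measurable f) (h0 : ∀ w, 0 ≤ f w) (h1 : ∀ w, f w ≤ 1)
    (g : Fin K → Vec d) : estMean τ σ f g ≤ 1 :=
  (estMean_mono hf measurable_const h0 h1 (fun _ => le_rfl) g).trans_eq (estMean_const 1 g)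

lemma stepMean_mono (hκ : 0 ≤ κ) (hf : Measurable f) (hf' : Measurable f') (h0 : ∀ w, 0 ≤ f w)
    (hff : ∀ w, f w ≤ f' w) {B : ℝ} (hB : ∀ w, f' w ≤ B) (hh : h ≤ h') :
    stepMean κ τ σ q ξ f h ≤ stepMean κ τ σ q ξ f' h' := by
  refine mul_le_mul_of_nonneg_left (Finset.sum_le_sum fun J _ => ?_) (by positivity)
  have := passProb_le_one hκ τ ξ (batch q J)
  exact add_le_add
    (mul_le_mul_of_nonneg_left (estMean_mono hf hf' h0 hff hB _) (passProb_pos hκ _ _ _).le)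
    (mul_le_mul_of_nonneg_left hh (by linarith))

lemma stepMean_add_mul (hf : Measurable f) (hf' : Measurable f') (h0 : ∀ w, 0 ≤ f w)
    (h0' : ∀ w, 0 ≤ f' w) {B : ℝ} (hB : ∀ w, f w ≤ B) (hB' : ∀ w, f' w ≤ B) (x y : ℝ) :
    stepMean κ τ σ q ξ (fun w => x * f w + y * f' w) (x * h + y * h') =
      x * stepMean κ τ σ q ξ f h + y * stepMean κ τ σ q ξ f' h' := by
  simp only [stepMean, estMean_add_mul hf hf' h0 h0' hB hB']
  rw [mul_left_comm x, mul_left_comm y, ← mul_add]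
  congr 1
  rw [Finset.mul_sum, Finset.mul_sum, ← Finset.sum_add_distrib]
  exact Finset.sum_congr rfl fun J _ => by ring

lemma stepMean_const (hN : 0 < N) (x : ℝ) : stepMean κ τ σ q ξ (fun _ => x) x = x := by
  have hN : (N : ℝ) ≠ 0 := by positivity
  simp only [stepMean, estMean_const]
  have : ∀ J : Fin K → Fin N, passProb κ τ ξ (batch q J) * x + (1 - passProb κ τ ξ (batch q J)) * x
      = x := fun J => by ring
  simp only [this, Finset.sum_const, Finset.card_univ, Fintype.card_fun, Fintype.card_fin,
    nsmul_eq_mul, Nat.cast_pow]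
  field_simp

/-- The average cost of one more kept member in one step. -/
def costMean (κ τ σ a A c t : ℝ) (q : Fin K → Fin N → Vec d) (ξ : ℝ) (f : Vec d → ℝ) : ℝ :=
  1 / (N : ℝ) ^ K * ∑ J : Fin K → Fin N, passProb κ τ ξ (batch q J) *
    bern (keepProbs (batch q J) τ) fun B => flipCost σ a A c t f (setMean (batch q J) B)

/-- The assumptions under which one table entry is negligible in one step; `s` is the change of the
threshold, and `η` bounds the probability that a bad minibatch passes. -/
structure StepRegime (K N : ℕ) (κ τ σ a A t s η : ℝ) : Prop extends NoiseRegime K τ σ a A t where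
  users : 2 ≤ N
  rate_nonneg : 0 ≤ κ
  offset_nonneg : 0 ≤ s
  transport : Real.exp (κ * 2) - 1 ≤ ((N : ℝ) - 1) * (1 - Real.exp (-(κ * s)))
  bad_pass : 1 / 2 * Real.exp (-(κ * (7 / 200 * K))) ≤ η

variable {s η : ℝ} {k : Fin K} {u : Fin N}

lemma batch_congr (hq : ∀ j v, j ≠ k ∨ v ≠ u → q j v = q' j v) {J : Fin K → Fin N} (hJ : J k ≠ u) :
    batch q J = batch q' J := by
  funext j
  refine hq j (J j) ?_
  by_cases hj : j = k
  · exact Or.inr (hj ▸ hJ)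
  · exact Or.inl hj

lemma batch_update (q : Fin K → Fin N → Vec d) (J : Fin K → Fin N) (k : Fin K) (u : Fin N) (j : Fin K)
    (hj : j ≠ k) : batch q J j = batch q (Function.update J k u) j := by
  simp [batch, Function.update_of_ne hj]

lemma flipCost_bern_nonneg (hR : StepRegime K N κ τ σ a A t s η) (hc : 0 < c) (hc1 : c ≤ 1)
    (hf0 : ∀ w, 0 ≤ f w) (g : Fin K → Vec d) :
    0 ≤ bern (keepProbs g τ) fun B => flipCost σ a A c t f (setMean g B) :=
  bern_nonneg (keepProbs_nonneg g τ) (keepProbs_le_one g τ) fun _ =>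
    flipCost_nonneg hR.weight_pos hc hc1 hf0 _

/-- The common part of the two forms of the one-entry estimate. -/
lemma StepRegime.sum_pass_le (hR : StepRegime K N κ τ σ a A t s η) (hc : 0 < c) (hc1 : c ≤ 1)
    (hf : Measurable f) (hf0 : ∀ w, 0 ≤ f w) (hf1 : ∀ w, f w ≤ 1)
    (hq : ∀ j v, j ≠ k ∨ v ≠ u → q j v = q' j v) (hξ : -((K : ℝ) / 40) ≤ ξ - s)
    {φ : Vec d → ℝ} (hφ : Measurable φ) (hφ0 : ∀ w, 0 ≤ φ w) (hφ1 : ∀ w, φ w ≤ 1)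
    (hφf : ∀ g g' : Fin K → Vec d,
      |estMean τ σ φ g - estMean τ σ φ g'| = |estMean τ σ f g - estMean τ σ f g'|)
    {Fl : (Fin K → Fin N) → ℝ} (hFl0 : ∀ J, 0 ≤ Fl J)
    (hFl : ∀ J, J k ≠ u → score (batch q J) τ < 37 / 50 * K → 1 / 2 ≤ Fl J) :
    ∑ J, passProb κ τ ξ (batch q J) * estMean τ σ φ (batch q J) ≤
      ∑ J, passProb κ τ (ξ - s) (batch q' J) * estMean τ σ φ (batch q' J) +
      ∑ J : Fin K → Fin N, (if J k = u then 0 else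
        2 * Real.exp (κ * 2) / ((N : ℝ) - 1) * (passProb κ τ ξ (batch q J) *
          (44 / 5 * bern (keepProbs (batch q J) τ) fun B => flipCost σ a A c t f (setMean (batch q J) B)))
          + 2 * Real.exp (κ * 2) * η / ((N : ℝ) - 1) * Fl J) := by
  have hκ := hR.rate_nonneg
  have hs := hR.offset_nonneg
  have hN : (2 : ℝ) ≤ N := by exact_mod_cast hR.users
  have hη : 0 ≤ η := le_trans (by positivity) hR.bad_pass
  have hst : ∀ J : Fin K → Fin N, |score (batch q (Function.update J k u)) τ - score (batch q J) τ| ≤ 2 :=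
    fun J => by
      rw [abs_sub_comm]; exact abs_score_sub_le (batch_update q J k u)
  have hst' : ∀ J : Fin K → Fin N,
      |score (batch q' (Function.update J k u)) τ - score (batch q' J) τ| ≤ 2 :=
    fun J => by
      rw [abs_sub_comm]; exact abs_score_sub_le (batch_update q' J k u)
  have hst'' : ∀ J : Fin K → Fin N,
      |score (batch q (Function.update J k u)) τ - score (batch q' (Function.update J k u)) τ| ≤ 2 :=
    fun J => abs_score_sub_le (k := k) fun j hj => hq j _ (Or.inl hj)
  refine sum_mul_le_of_transport hR.users k u (good := fun J => 37 / 50 * (K : ℝ) ≤ score (batch q J) τ)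
    (w := fun J => passProb κ τ ξ (batch q J)) (w' := fun J => passProb κ τ (ξ - s) (batch q' J))
    (Φ := fun J => estMean τ σ φ (batch q J)) (Φ' := fun J => estMean τ σ φ (batch q' J))
    (E := fun J => 44 / 5 * bern (keepProbs (batch q J) τ) fun B =>
      flipCost σ a A c t f (setMean (batch q J) B))
    (fun J => (passProb_pos hκ _ _ _).le) (fun J => (passProb_pos hκ _ _ _).le)
    (fun J => estMean_nonneg hφ0 _) (fun J => estMean_le_one hφ hφ0 hφ1 _)
    (fun J => estMean_nonneg hφ0 _)
    (fun J => mul_nonneg (by norm_num) (flipCost_bern_nonneg hR hc hc1 hf0 _)) hFl0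
    (Real.exp_pos _).le hη ?_ ?_ ?_ ?_ ?_ ?_ ?_
  · intro J hJ
    simp only [batch_congr hq hJ]
  · intro J hJ
    simp only [batch_congr hq hJ]
    exact lapTail_antitone hκ (by linarith)
  · intro J hJ
    have := abs_le.1 (hst J)
    exact lapTail_le_exp_mul hκ (by norm_num) (by linarith)
  · intro J hJ
    -- Here x and y belong to user u at position k in the old and the new table, and z to another
    -- user at this position, where the tables agree. Pairwise the scores differ by at most 2.
    have h1 := lapTail_transport (κ := κ) (s := s) (M := (N : ℝ) - 1)
      (x := 4 * (K : ℝ) / 5 + ξ - score (batch q (Function.update J k u)) τ)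
      (y := 4 * (K : ℝ) / 5 + ξ - score (batch q' (Function.update J k u)) τ)
      (z := 4 * (K : ℝ) / 5 + ξ - score (batch q' J) τ) hκ hs hR.transport (by linarith)
      (by rw [sub_sub_sub_cancel_left, abs_sub_comm]; exact hst'' J)
      (by rw [sub_sub_sub_cancel_left, abs_sub_comm, ← batch_congr hq hJ]; exact hst J)
      (by rw [sub_sub_sub_cancel_left, abs_sub_comm]; exact hst' J)
    have e : ∀ g : Fin K → Vec d, 4 * (K : ℝ) / 5 + (ξ - s) - score g τ =
        4 * (K : ℝ) / 5 + ξ - score g τ - s := fun g => by ring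
    simp only [passProb, e]
    rw [batch_congr hq hJ]
    exact h1
  · intro J hJ hg
    rw [hφf]
    exact hR.abs_estMean_sub_le hc hc1 hf hf0 hf1 (batch_update q J k u) hg
  · intro J hJ hg
    rw [hφf]
    have h2 := hR.abs_estMean_sub_le (t := t) hc hc1 hf hf0 hf1 (batch_update q' J k u)
      (by rw [← batch_congr hq hJ]; exact hg)
    rw [← batch_congr hq hJ] at h2
    rwa [← batch_congr hq hJ]
  · intro J hJ hg
    have hg : score (batch q J) τ < 37 / 50 * K := not_le.1 hg
    refine ⟨?_, hFl J hJ hg⟩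
    refine le_trans ?_ hR.bad_pass
    -- The constant is 4/5 - 1/40 - 37/50.
    have hx : 7 / 200 * (K : ℝ) ≤ 4 * (K : ℝ) / 5 + ξ - score (batch q J) τ := by linarith
    refine (lapTail_antitone hκ hx).trans_eq ?_
    rw [lapTail_of_nonneg (by positivity)]

end StepMean

/-! ### The effect of one table entry on one step -/

section MicroStep

variable {d K N : ℕ} {κ τ σ ξ a A c t s η : ℝ} {q q' : Fin K → Fin N → Vec d} {f : Vec d → ℝ} {h : ℝ}
  {k : Fin K} {u : Fin N}

/-- The probability that a step halts. -/
def failMean (κ τ : ℝ) (q : Fin K → Fin N → Vec d) (ξ : ℝ) : ℝ :=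
  1 / (N : ℝ) ^ K * ∑ J : Fin K → Fin N, (1 - passProb κ τ ξ (batch q J))

lemma sum_ite_le_sum {ι : Type*} [Fintype ι] (p : ι → Prop) [DecidablePred p] {x y : ι → ℝ}
    (hy : ∀ i, 0 ≤ y i) (hxy : ∀ i, ¬ p i → x i ≤ y i) :
    ∑ i, (if p i then 0 else x i) ≤ ∑ i, y i :=
  Finset.sum_le_sum fun i _ => by
    split_ifs with h
    · exact hy i
    · exact hxy i h

/-- Only passing contributes, so the other table gets a lower threshold. Where u is not drawn at k
the minibatches agree and the lower threshold passes more often, which lets the cost be evaluated on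
the right-hand side. Bad minibatches are charged to the probability of halting. -/
lemma StepRegime.stepMean_le_zero (hR : StepRegime K N κ τ σ a A t s η) (hc : 0 < c) (hc1 : c ≤ 1)
    (hf : Measurable f) (hf0 : ∀ w, 0 ≤ f w) (hf1 : ∀ w, f w ≤ 1)
    (hq : ∀ j v, j ≠ k ∨ v ≠ u → q j v = q' j v) (hξ : -((K : ℝ) / 40) ≤ ξ - s) :
    stepMean κ τ σ q ξ f 0 ≤ stepMean κ τ σ q' (ξ - s) f 0 +
      88 / 5 * Real.exp (κ * 2) / ((N : ℝ) - 1) * costMean κ τ σ a A c t q' (ξ - s) f +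
      2 * Real.exp (κ * 2) * η / ((N : ℝ) - 1) * failMean κ τ q ξ := by
  have hκ := hR.rate_nonneg
  have hN : (2 : ℝ) ≤ N := by exact_mod_cast hR.users
  have hN1 : 0 < (N : ℝ) - 1 := by linarith
  have hη : 0 ≤ η := le_trans (by positivity) hR.bad_pass
  have hs := hR.offset_nonneg
  have hmain := hR.sum_pass_le hc hc1 hf hf0 hf1 hq hξ hf hf0 hf1 (fun _ _ => rfl)
    (Fl := fun J => 1 - passProb κ τ ξ (batch q J))
    (fun J => by linarith [passProb_le_one hκ τ ξ (batch q J)])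
    (fun J hJ hg => half_le_one_sub_lapTail hκ (by
      have : (0 : ℝ) ≤ K := K.cast_nonneg
      linarith))
  have herr := sum_ite_le_sum (fun J : Fin K → Fin N => J k = u)
    (x := fun J => 2 * Real.exp (κ * 2) / ((N : ℝ) - 1) * (passProb κ τ ξ (batch q J) *
          (44 / 5 * bern (keepProbs (batch q J) τ) fun B => flipCost σ a A c t f (setMean (batch q J) B)))
          + 2 * Real.exp (κ * 2) * η / ((N : ℝ) - 1) * (1 - passProb κ τ ξ (batch q J)))
    (y := fun J => 88 / 5 * Real.exp (κ * 2) / ((N : ℝ) - 1) * (passProb κ τ (ξ - s) (batch q' J) *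
        bern (keepProbs (batch q' J) τ) fun B => flipCost σ a A c t f (setMean (batch q' J) B))
          + 2 * Real.exp (κ * 2) * η / ((N : ℝ) - 1) * (1 - passProb κ τ ξ (batch q J)))
    (fun J => by
      have h1 := passProb_le_one hκ τ ξ (batch q J)
      have h2 := flipCost_bern_nonneg hR hc hc1 hf0 (batch q' J)
      have h3 := passProb_pos hκ τ (ξ - s) (batch q' J)
      have : 0 ≤ 1 - passProb κ τ ξ (batch q J) := by linarith
      positivity)
    (fun J hJ => by
      rw [batch_congr hq hJ]
      have h2 := flipCost_bern_nonneg hR hc hc1 hf0 (batch q' J)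
      have h3 : passProb κ τ ξ (batch q' J) ≤ passProb κ τ (ξ - s) (batch q' J) :=
        lapTail_antitone hκ (by linarith)
      have h4 := mul_le_mul_of_nonneg_left (mul_le_mul_of_nonneg_right h3 h2)
        (by positivity : 0 ≤ 88 / 5 * Real.exp (κ * 2) / ((N : ℝ) - 1))
      refine add_le_add_left (le_trans (le_of_eq ?_) h4) _
      ring)
  have := mul_le_mul_of_nonneg_left (hmain.trans (add_le_add_right herr _))
    (by positivity : 0 ≤ 1 / (N : ℝ) ^ K)
  rw [Finset.sum_add_distrib, ← Finset.mul_sum, ← Finset.mul_sum] at this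
  simp only [stepMean, costMean, failMean, mul_zero, add_zero]
  refine this.trans (le_of_eq ?_)
  ring

/-- A halt counts as 1, so the mean is 1 minus the passing part of 1 - f. An upper bound needs the
reverse comparison for 1 - f, with the tables exchanged and the threshold of the other table raised.
Since f and 1 - f have the same increments up to sign, the cost of f can be kept. -/
lemma StepRegime.stepMean_le_one (hR : StepRegime K N κ τ σ a A t s η) (hc : 0 < c) (hc1 : c ≤ 1)
    (hf : Measurable f) (hf0 : ∀ w, 0 ≤ f w) (hf1 : ∀ w, f w ≤ 1)
    (hq : ∀ j v, j ≠ k ∨ v ≠ u → q j v = q' j v) (hξ : -((K : ℝ) / 40) ≤ ξ) :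
    stepMean κ τ σ q ξ f 1 ≤ stepMean κ τ σ q' (ξ + s) f 1 +
      88 / 5 * Real.exp (κ * 2) / ((N : ℝ) - 1) * costMean κ τ σ a A c t q' (ξ + s) f +
      2 * Real.exp (κ * 2) * η / ((N : ℝ) - 1) * failMean κ τ q ξ := by
  have hκ := hR.rate_nonneg
  have hN : (2 : ℝ) ≤ N := by exact_mod_cast hR.users
  have hN1 : 0 < (N : ℝ) - 1 := by linarith
  have hη : 0 ≤ η := le_trans (by positivity) hR.bad_pass
  have hs := hR.offset_nonneg
  have hq' : ∀ j v, j ≠ k ∨ v ≠ u → q' j v = q j v := fun j v hh => (hq j v hh).symm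
  have hcompl : ∀ g : Fin K → Vec d, estMean τ σ (fun w => 1 - f w) g = 1 - estMean τ σ f g := by
    intro g
    have := estMean_add_mul (τ := τ) (σ := σ) (f := fun _ => 1) (f' := f) measurable_const hf
      (fun _ => zero_le_one) hf0 (fun _ => le_rfl) hf1 1 (-1) g
    rw [estMean_const] at this
    simpa [sub_eq_add_neg] using this
  have hmain := hR.sum_pass_le (ξ := ξ + s) hc hc1 hf hf0 hf1 hq' (by linarith)
    (φ := fun w => 1 - f w) (by fun_prop) (fun w => by linarith [hf1 w]) (fun w => by linarith [hf0 w])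
    (fun g g' => by rw [hcompl, hcompl, sub_sub_sub_cancel_left, abs_sub_comm])
    (Fl := fun J => 1 - passProb κ τ ξ (batch q J))
    (fun J => by linarith [passProb_le_one hκ τ ξ (batch q J)])
    (fun J hJ hg => half_le_one_sub_lapTail hκ (by
      rw [batch_congr hq hJ]
      have : (0 : ℝ) ≤ K := K.cast_nonneg
      linarith))
  rw [add_sub_cancel_right] at hmain
  have herr := sum_ite_le_sum (fun J : Fin K → Fin N => J k = u)
    (x := fun J => 2 * Real.exp (κ * 2) / ((N : ℝ) - 1) * (passProb κ τ (ξ + s) (batch q' J) *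
          (44 / 5 * bern (keepProbs (batch q' J) τ) fun B => flipCost σ a A c t f (setMean (batch q' J) B)))
          + 2 * Real.exp (κ * 2) * η / ((N : ℝ) - 1) * (1 - passProb κ τ ξ (batch q J)))
    (y := fun J => 88 / 5 * Real.exp (κ * 2) / ((N : ℝ) - 1) * (passProb κ τ (ξ + s) (batch q' J) *
        bern (keepProbs (batch q' J) τ) fun B => flipCost σ a A c t f (setMean (batch q' J) B))
          + 2 * Real.exp (κ * 2) * η / ((N : ℝ) - 1) * (1 - passProb κ τ ξ (batch q J)))
    (fun J => by
      have h1 := passProb_le_one hκ τ ξ (batch q J)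
      have h2 := flipCost_bern_nonneg hR hc hc1 hf0 (batch q' J)
      have h3 := passProb_pos hκ τ (ξ + s) (batch q' J)
      have : 0 ≤ 1 - passProb κ τ ξ (batch q J) := by linarith
      positivity)
    (fun J hJ => le_of_eq (by ring))
  have := mul_le_mul_of_nonneg_left (hmain.trans (add_le_add_right herr _))
    (by positivity : 0 ≤ 1 / (N : ℝ) ^ K)
  rw [Finset.sum_add_distrib, ← Finset.mul_sum, ← Finset.mul_sum] at this
  have hstep : ∀ (q : Fin K → Fin N → Vec d) (ξ : ℝ), stepMean κ τ σ q ξ f 1 =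
      1 - 1 / (N : ℝ) ^ K * ∑ J, passProb κ τ ξ (batch q J) * estMean τ σ (fun w => 1 - f w) (batch q J) := by
    intro q ξ
    have h1 := stepMean_const (κ := κ) (τ := τ) (σ := σ) (q := q) (ξ := ξ) (by linarith [hR.users]) 1
    refine eq_sub_of_add_eq (Eq.trans ?_ h1)
    rw [stepMean, stepMean, ← mul_add, ← Finset.sum_add_distrib]
    congr 1
    refine Finset.sum_congr rfl fun J _ => ?_
    rw [hcompl, estMean_const]
    ring
  rw [hstep, hstep]
  simp only [costMean, failMean]
  linarith

/-- The second-order loss of one step. -/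
def stepRate (N : ℕ) (κ a A t : ℝ) : ℝ :=
  88 / 5 * Real.exp (κ * 2) / ((N : ℝ) - 1) * (33 / 8 * A * a ^ 2 * shiftConst t)

/-- The exceptional loss of one step. -/
def stepSlack (N : ℕ) (κ a A c : ℝ) : ℝ :=
  88 / 5 * Real.exp (κ * 2) / ((N : ℝ) - 1) *
    (1 / A * ((1 + Real.log (1 / c)) * tailBound a / (Real.exp (1 / 100) - 1)) + 4 * tailBound a)

/-- The entropy over passing minibatches is completed to a full step mean by adding the nonnegative
value `entr c h` on the halting branch. Only then can it be combined with the mean of f. -/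
lemma StepRegime.costMean_le (hR : StepRegime K N κ τ σ a A t s η) (hc : 0 < c) (hc1 : c ≤ 1)
    (hh : 0 ≤ h) :
    costMean κ τ σ a A c t q ξ f ≤
      1 / A * stepMean κ τ σ q ξ (fun w => entr c (f w)) (entr c h) +
        (c * (33 / 8 * A * a ^ 2 * shiftConst t) +
        (1 / A * ((1 + Real.log (1 / c)) * tailBound a / (Real.exp (1 / 100) - 1)) +
          4 * tailBound a)) := by
  have hκ := hR.rate_nonneg
  have hN0 : (0 : ℝ) < N := by exact_mod_cast (by linarith [hR.users] : 0 < N)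
  have hA := hR.weight_pos
  have h2 : 0 ≤ Real.log (1 / c) := Real.log_nonneg (by rw [le_div_iff₀ hc]; linarith)
  have h3 : 0 < Real.exp (1 / 100) - 1 := by
    have := Real.add_one_le_exp (1 / 100 : ℝ); linarith
  have h4 := tailBound_pos a
  have h5 : 0 ≤ shiftConst t := le_trans (by positivity) (shiftConst_ge t)
  set X := c * (33 / 8 * A * a ^ 2 * shiftConst t) +
        (1 / A * ((1 + Real.log (1 / c)) * tailBound a / (Real.exp (1 / 100) - 1)) +
          4 * tailBound a) with hX
  have hX0 : 0 ≤ X := by positivity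
  have hb : ∀ g : Fin K → Vec d, (bern (keepProbs g τ) fun B => flipCost σ a A c t f (setMean g B)) =
      1 / A * estMean τ σ (fun w => entr c (f w)) g + X := by
    intro g
    rw [estMean, ← bern_const_mul, ← bern_const (keepProbs g τ) X, ← bern_add]
    congr 1
    funext B
    rw [flipCost, hX]
    ring
  have hXe : X = 1 / (N : ℝ) ^ K * ∑ _J : Fin K → Fin N, X := by
    simp only [Finset.sum_const, Finset.card_univ, Fintype.card_fun, Fintype.card_fin,
      nsmul_eq_mul, Nat.cast_pow]
    field_simp
  rw [costMean, stepMean, mul_left_comm, hXe, ← mul_add]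
  refine mul_le_mul_of_nonneg_left ?_ (by positivity)
  rw [Finset.mul_sum, ← Finset.sum_add_distrib]
  refine (Finset.sum_le_sum fun J _ => ?_)
  rw [hb]
  have p1 := passProb_le_one hκ τ ξ (batch q J)
  have p0 := passProb_pos hκ τ ξ (batch q J)
  have e0 := entr_nonneg hc hh
  have : 0 ≤ 1 / A * ((1 - passProb κ τ ξ (batch q J)) * entr c h) :=
    mul_nonneg (by positivity) (mul_nonneg (by linarith) e0)
  nlinarith

/-- The one-entry estimate in power-mean form. -/
lemma StepRegime.stepMean_le (hR : StepRegime K N κ τ σ a A t s η) {b : ℝ} (hb : 1 ≤ b)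
    (hbA : 88 / 5 * Real.exp (κ * 2) / ((N : ℝ) - 1) * (1 / A) = 1 - 1 / b)
    (hc : 0 < c) (hc1 : c ≤ 1) (hf : Measurable f) (hf0 : ∀ w, 0 ≤ f w) (hf1 : ∀ w, f w ≤ 1)
    (hq : ∀ j v, j ≠ k ∨ v ≠ u → q j v = q' j v) {ξ' : ℝ}
    (hcase : h = 0 ∧ ξ' = ξ - s ∧ -((K : ℝ) / 40) ≤ ξ' ∨ h = 1 ∧ ξ' = ξ + s ∧ -((K : ℝ) / 40) ≤ ξ)
    (hcb : stepMean κ τ σ q' ξ' (fun w => f w ^ b) h ≤ c ^ b) :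
    stepMean κ τ σ q ξ f h ≤ (1 + stepRate N κ a A t) * c + stepSlack N κ a A c +
      2 * Real.exp (κ * 2) * η / ((N : ℝ) - 1) * failMean κ τ q ξ := by
  have hN : (2 : ℝ) ≤ N := by exact_mod_cast hR.users
  have hN0 : 0 < N := by linarith [hR.users]
  have hN1 : 0 < (N : ℝ) - 1 := by linarith
  have hb0 : 0 < b := by linarith
  have hh0 : 0 ≤ h := by rcases hcase with hh | hh <;> rw [hh.1]; norm_num
  have hh1 : h ≤ 1 := by rcases hcase with hh | hh <;> rw [hh.1]; norm_num
  have hhb : h ^ b = h := by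
    rcases hcase with hh | hh <;> rw [hh.1]
    · exact Real.zero_rpow hb0.ne'
    · exact Real.one_rpow b
  have hkey : stepMean κ τ σ q ξ f h ≤ stepMean κ τ σ q' ξ' f h +
      88 / 5 * Real.exp (κ * 2) / ((N : ℝ) - 1) * costMean κ τ σ a A c t q' ξ' f +
      2 * Real.exp (κ * 2) * η / ((N : ℝ) - 1) * failMean κ τ q ξ := by
    rcases hcase with ⟨rfl, rfl, hx⟩ | ⟨rfl, rfl, hx⟩
    · exact hR.stepMean_le_zero hc hc1 hf hf0 hf1 hq hx
    · exact hR.stepMean_le_one hc hc1 hf hf0 hf1 hq hx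
  have hcost := mul_le_mul_of_nonneg_left (hR.costMean_le (q := q') (ξ := ξ') (f := f) hc hc1 hh0)
    (by positivity : 0 ≤ 88 / 5 * Real.exp (κ * 2) / ((N : ℝ) - 1))
  have hν : 0 ≤ 1 - 1 / b := by
    rw [sub_nonneg, div_le_one hb0]; exact hb
  have hL : 0 ≤ Real.log (1 / c) := Real.log_nonneg (by rw [le_div_iff₀ hc]; linarith)
  have hlin := stepMean_add_mul (κ := κ) (τ := τ) (σ := σ) (q := q') (ξ := ξ') (f := f)
    (f' := fun w => entr c (f w)) (h := h) (h' := entr c h) (B := 1 + Real.log (1 / c)) hf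
    ((measurable_entr c).comp hf) hf0 (fun w => entr_nonneg hc (hf0 w))
    (fun w => by linarith [hf1 w]) (fun w => entr_le hc hc1 (hf0 w) (hf1 w)) 1 (1 - 1 / b)
  have hfb0 : ∀ w, 0 ≤ f w ^ b := fun w => Real.rpow_nonneg (hf0 w) b
  have hfb1 : ∀ w, f w ^ b ≤ 1 := fun w => Real.rpow_le_one (hf0 w) (hf1 w) hb0.le
  have hlin2 := stepMean_add_mul (κ := κ) (τ := τ) (σ := σ) (q := q') (ξ := ξ')
    (f := fun w => f w ^ b)
    (f' := fun _ => 1) (h := h) (h' := 1) (B := 1) (hf.pow_const b)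
    measurable_const hfb0 (fun w => zero_le_one) hfb1 (fun _ => le_rfl) (c ^ (1 - b) / b)
    (c * (1 - 1 / b))
  rw [stepMean_const hN0] at hlin2
  have hcpos : 0 < c ^ (1 - b) / b := div_pos (Real.rpow_pos_of_pos hc _) hb0
  -- `add_mul_entr_le` under the averaging operator. By `hbA` the entropy has coefficient 1 - 1/b,
  -- exactly what the passage to the power mean absorbs. On the halting branch h is 0 or 1 and so
  -- equals h^b.
  have hmono := stepMean_mono (κ := κ) (τ := τ) (σ := σ) (q := q') (ξ := ξ')
    (f := fun w => 1 * f w + (1 - 1 / b) * entr c (f w))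
    (f' := fun w => c ^ (1 - b) / b * f w ^ b + c * (1 - 1 / b) * 1)
    (h := 1 * h + (1 - 1 / b) * entr c h) (h' := c ^ (1 - b) / b * h + c * (1 - 1 / b) * 1)
    (B := c ^ (1 - b) / b * 1 + c * (1 - 1 / b) * 1)
    hR.rate_nonneg (by have := measurable_entr c; fun_prop) (by have := hf.pow_const b; fun_prop)
    (fun w => by
      have := entr_nonneg hc (hf0 w)
      have := hf0 w
      positivity)
    (fun w => by
      have := add_mul_entr_le hb hc (hf0 w)
      linarith)
    (fun w => by
      have := mul_le_mul_of_nonneg_left (hfb1 w) hcpos.le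
      linarith)
    (by
      have := add_mul_entr_le hb hc hh0
      rw [hhb] at this
      linarith)
  rw [hlin, hlin2] at hmono
  have hfin : c ^ (1 - b) / b * stepMean κ τ σ q' ξ' (fun w => f w ^ b) h ≤ c / b := by
    calc _ ≤ c ^ (1 - b) / b * c ^ b := mul_le_mul_of_nonneg_left hcb hcpos.le
      _ = c / b := by
        rw [div_mul_eq_mul_div, ← Real.rpow_add hc, sub_add_cancel, Real.rpow_one]
  have hcc : c / b + c * (1 - 1 / b) = c := by ring
  rw [mul_add, mul_add, ← mul_assoc _ (1 / A), hbA] at hcost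
  unfold stepRate stepSlack
  linarith

end MicroStep

/-! ### Measurability -/

section Measurability

variable {S : Type*} [MeasurableSpace S] {d K N : ℕ} {κ τ σ h : ℝ}

lemma measurable_closeCount {g : S → Fin K → Vec d} (hg : ∀ j, Measurable fun s => g s j) (τ : ℝ)
    (j : Fin K) : Measurable fun s => (closeCount (g s) τ j : ℝ) := by
  classical
  have h : (fun s => (closeCount (g s) τ j : ℝ)) =
      fun s => ∑ j', if ‖g s j - g s j'‖ ≤ 2 * τ then (1 : ℝ) else 0 := by
    funext s
    rw [closeCount_eq]
    simp
  rw [h]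
  refine Finset.measurable_sum _ fun j' _ => Measurable.ite ?_ measurable_const measurable_const
  exact measurableSet_le ((hg j).sub (hg j')).norm measurable_const

lemma measurable_score {g : S → Fin K → Vec d} (hg : ∀ j, Measurable fun s => g s j) (τ : ℝ) :
    Measurable fun s => score (g s) τ :=
  (Finset.measurable_sum _ fun j _ => measurable_closeCount hg τ j).const_mul _

lemma measurable_keepProb (K : ℕ) : Measurable (keepProb K) := by
  unfold keepProb
  refine Measurable.ite (measurableSet_lt measurable_id measurable_const) measurable_const
    (Measurable.ite (measurableSet_le measurable_const measurable_id) measurable_const ?_)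
  fun_prop

lemma measurable_keepProbs {g : S → Fin K → Vec d} (hg : ∀ j, Measurable fun s => g s j) (τ : ℝ)
    (j : Fin K) : Measurable fun s => keepProbs (g s) τ j :=
  (measurable_keepProb K).comp (measurable_closeCount hg τ j)

lemma measurable_lapTail (κ : ℝ) : Measurable (lapTail κ) := by
  unfold lapTail
  refine Measurable.ite (measurableSet_le measurable_const measurable_id) ?_ ?_ <;> fun_prop

lemma measurable_setMean {g : S → Fin K → Vec d} (hg : ∀ j, Measurable fun s => g s j)
    (A : Finset (Fin K)) : Measurable fun s => setMean (g s) A := by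
  unfold setMean
  fun_prop

lemma measurable_smooth (σ : ℝ) {F : S → Vec d → ℝ} (hF : Measurable (Function.uncurry F))
    {m : S → Vec d} (hm : Measurable m) : Measurable fun s => smooth σ (F s) (m s) := by
  have h : Measurable fun p : S × Vec d => F p.1 (m p.1 + p.2) :=
    hF.comp (measurable_fst.prodMk ((hm.comp measurable_fst).add measurable_snd))
  exact (h.stronglyMeasurable.integral_prod_right' (ν := gaussianNoise d σ)).measurable

lemma measurable_estMean (τ σ : ℝ) {F : S → Vec d → ℝ} (hF : Measurable (Function.uncurry F))
    {g : S → Fin K → Vec d} (hg : ∀ j, Measurable fun s => g s j) :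
    Measurable fun s => estMean τ σ (F s) (g s) := by
  unfold estMean bern
  refine Finset.measurable_sum _ fun A _ => Measurable.mul ?_
    (measurable_smooth σ hF (measurable_setMean hg A))
  refine Finset.measurable_prod _ fun j _ => ?_
  split_ifs
  · exact measurable_keepProbs hg τ j
  · exact measurable_const.sub (measurable_keepProbs hg τ j)

lemma measurable_passProb (κ τ : ℝ) {ξ : S → ℝ} (hξ : Measurable ξ) {g : S → Fin K → Vec d}
    (hg : ∀ j, Measurable fun s => g s j) : Measurable fun s => passProb κ τ (ξ s) (g s) :=
  (measurable_lapTail κ).comp ((measurable_const.add hξ).sub (measurable_score hg τ))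

lemma measurable_stepMean (κ τ σ h : ℝ) {ξ : S → ℝ} (hξ : Measurable ξ) {F : S → Vec d → ℝ}
    (hF : Measurable (Function.uncurry F)) {q : S → Fin K → Fin N → Vec d}
    (hq : ∀ j v, Measurable fun s => q s j v) :
    Measurable fun s => stepMean κ τ σ (q s) (ξ s) (F s) h := by
  unfold stepMean
  refine (Finset.measurable_sum _ fun J _ => ?_).const_mul _
  have hb : ∀ j, Measurable fun s => batch (q s) J j := fun j => hq j (J j)
  exact ((measurable_passProb κ τ hξ hb).mul (measurable_estMean τ σ hF hb)).add
    ((measurable_const.sub (measurable_passProb κ τ hξ hb)).mul_const h)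

end Measurability

/-! ### Many steps -/

section Run

variable {St : Type*} {d K N : ℕ}

/-- The expected final value of `n` steps, numbered from `t` on, from the state `s`: `f` at the last
state, or `h` if some step halts. -/
def runMean (κ τ σ : ℝ) (q : ℕ → St → Fin K → Fin N → Vec d) (next : ℕ → St → Vec d → St) (ξ : ℝ)
    (f : St → ℝ) (h : ℝ) : ℕ → ℕ → St → ℝ
  | 0, _, s => f s
  | n + 1, t, s =>
    stepMean κ τ σ (q t s) ξ (fun w => runMean κ τ σ q next ξ f h n (t + 1) (next t s w)) h

variable [MeasurableSpace St] {κ τ σ ξ h : ℝ} {q q' : ℕ → St → Fin K → Fin N → Vec d}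
  {next : ℕ → St → Vec d → St} {f : St → ℝ}

lemma measurable_runMean_prod (κ τ σ h : ℝ) (hq : ∀ t j v, Measurable fun s => q t s j v)
    (hnext : ∀ t, Measurable (Function.uncurry (next t))) (hf : Measurable f) (n t : ℕ) :
    Measurable fun p : ℝ × St => runMean κ τ σ q next p.1 f h n t p.2 := by
  induction n generalizing t with
  | zero => exact hf.comp measurable_snd
  | succ n ih =>
    refine measurable_stepMean κ τ σ h measurable_fst ?_ fun j v => (hq t j v).comp measurable_snd
    have h1 : Measurable fun p : (ℝ × St) × Vec d => (p.1.1, next t p.1.2 p.2) :=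
      (measurable_fst.comp measurable_fst).prodMk
        ((hnext t).comp ((measurable_snd.comp measurable_fst).prodMk measurable_snd))
    exact (ih (t + 1)).comp h1

lemma measurable_runMean (κ τ σ ξ h : ℝ) (hq : ∀ t j v, Measurable fun s => q t s j v)
    (hnext : ∀ t, Measurable (Function.uncurry (next t))) (hf : Measurable f) (n t : ℕ) :
    Measurable (runMean κ τ σ q next ξ f h n t) :=
  (measurable_runMean_prod κ τ σ h hq hnext hf n t).comp (measurable_const.prodMk measurable_id)

lemma runMean_mem (hκ : 0 ≤ κ) (hN : 0 < N) (hq : ∀ t j v, Measurable fun s => q t s j v)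
    (hnext : ∀ t, Measurable (Function.uncurry (next t))) (hf : Measurable f)
    (hf0 : ∀ s, 0 ≤ f s) (hf1 : ∀ s, f s ≤ 1) (hh0 : 0 ≤ h) (hh1 : h ≤ 1) (n t : ℕ) (s : St) :
    0 ≤ runMean κ τ σ q next ξ f h n t s ∧ runMean κ τ σ q next ξ f h n t s ≤ 1 := by
  induction n generalizing t s with
  | zero => exact ⟨hf0 s, hf1 s⟩
  | succ n ih =>
    have hm : Measurable fun w => runMean κ τ σ q next ξ f h n (t + 1) (next t s w) :=
      (measurable_runMean κ τ σ ξ h hq hnext hf n (t + 1)).comp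
        ((hnext t).comp (measurable_const.prodMk measurable_id))
    constructor
    · refine (stepMean_const (κ := κ) (τ := τ) (σ := σ) (q := q t s) (ξ := ξ) hN 0).symm.le.trans ?_
      exact stepMean_mono hκ measurable_const hm (fun _ => le_rfl) (fun w => (ih _ _).1)
        (fun w => (ih _ _).2) hh0
    · refine le_trans ?_ (stepMean_const (κ := κ) (τ := τ) (σ := σ) (q := q t s) (ξ := ξ) hN 1).le
      exact stepMean_mono hκ hm measurable_const (fun w => (ih _ _).1) (fun w => (ih _ _).2)
        (fun w => le_rfl) hh1

lemma runMean_mono (hκ : 0 ≤ κ) (hN : 0 < N) (hq : ∀ t j v, Measurable fun s => q t s j v)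
    (hnext : ∀ t, Measurable (Function.uncurry (next t))) {f' : St → ℝ} (hf : Measurable f)
    (hf' : Measurable f') (hf0 : ∀ s, 0 ≤ f s) (hff : ∀ s, f s ≤ f' s) (hf1 : ∀ s, f' s ≤ 1)
    (hh0 : 0 ≤ h) (hh1 : h ≤ 1) (n t : ℕ) (s : St) :
    runMean κ τ σ q next ξ f h n t s ≤ runMean κ τ σ q next ξ f' h n t s := by
  induction n generalizing t s with
  | zero => exact hff s
  | succ n ih =>
    have hm : ∀ {f : St → ℝ}, Measurable f → Measurable fun w =>
        runMean κ τ σ q next ξ f h n (t + 1) (next t s w) := fun hf =>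
      (measurable_runMean κ τ σ ξ h hq hnext hf n (t + 1)).comp
        ((hnext t).comp (measurable_const.prodMk measurable_id))
    exact stepMean_mono hκ (hm hf) (hm hf')
      (fun w => (runMean_mem hκ hN hq hnext hf hf0 (fun s => (hff s).trans (hf1 s)) hh0 hh1 _ _ _).1)
      (fun w => ih _ _)
      (fun w => (runMean_mem hκ hN hq hnext hf' (fun s => (hf0 s).trans (hff s)) hf1 hh0 hh1 _ _ _).2)
      le_rfl

variable {a A t s η b c₀ : ℝ} {k : Fin K} {u : Fin N}

/-- Allows the slack to be taken at the floor c₀ while c follows the power mean. -/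
lemma stepSlack_anti (hN : 2 ≤ N) (hA : 0 < A) {c c' : ℝ} (hc : 0 < c) (hcc : c ≤ c') :
    stepSlack N κ a A c' ≤ stepSlack N κ a A c := by
  have hN : (2 : ℝ) ≤ N := by exact_mod_cast hN
  have hN1 : 0 < (N : ℝ) - 1 := by linarith
  have h3 : 0 < Real.exp (1 / 100) - 1 := by
    have := Real.add_one_le_exp (1 / 100 : ℝ); linarith
  have h4 := tailBound_pos a
  have h5 : 0 < 1 / c' := by have := hc.trans_le hcc; positivity
  unfold stepSlack
  gcongr

/-- The one-entry estimate in terms of the power mean. -/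
lemma StepRegime.stepMean_le_rpow (hR : StepRegime K N κ τ σ a A t s η) (hb : 1 ≤ b)
    (hbA : 88 / 5 * Real.exp (κ * 2) / ((N : ℝ) - 1) * (1 / A) = 1 - 1 / b)
    (hc : 0 < c₀) (hc1 : c₀ ≤ 1) {q q' : Fin K → Fin N → Vec d} {f : Vec d → ℝ}
    (hf : Measurable f) (hf0 : ∀ w, 0 ≤ f w) (hf1 : ∀ w, f w ≤ 1)
    (hq : ∀ j v, j ≠ k ∨ v ≠ u → q j v = q' j v) {ξ' : ℝ}
    (hcase : h = 0 ∧ ξ' = ξ - s ∧ -((K : ℝ) / 40) ≤ ξ' ∨ h = 1 ∧ ξ' = ξ + s ∧ -((K : ℝ) / 40) ≤ ξ) :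
    stepMean κ τ σ q ξ f h ≤
      (1 + stepRate N κ a A t) * stepMean κ τ σ q' ξ' (fun w => f w ^ b) h ^ (1 / b) +
      ((1 + stepRate N κ a A t) * c₀ + stepSlack N κ a A c₀) +
      2 * Real.exp (κ * 2) * η / ((N : ℝ) - 1) * failMean κ τ q ξ := by
  have hκ := hR.rate_nonneg
  have hN0 : 0 < N := by linarith [hR.users]
  have hN : (2 : ℝ) ≤ N := by exact_mod_cast hR.users
  have hN1 : 0 < (N : ℝ) - 1 := by linarith
  have hb0 : 0 < b := by linarith
  have hh0 : 0 ≤ h := by rcases hcase with hh | hh <;> rw [hh.1]; norm_num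
  have hh1 : h ≤ 1 := by rcases hcase with hh | hh <;> rw [hh.1]; norm_num
  set x := stepMean κ τ σ q' ξ' (fun w => f w ^ b) h with hx
  have hfb : Measurable fun w => f w ^ b := hf.pow_const b
  have hx0 : 0 ≤ x :=
    (stepMean_const (κ := κ) (τ := τ) (σ := σ) (q := q') (ξ := ξ') hN0 0).symm.le.trans
      (stepMean_mono hκ measurable_const hfb (fun _ => le_rfl) (fun w => Real.rpow_nonneg (hf0 w) b)
        (fun w => Real.rpow_le_one (hf0 w) (hf1 w) hb0.le) hh0)
  have hx1 : x ≤ 1 := le_trans (stepMean_mono hκ hfb measurable_const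
      (fun w => Real.rpow_nonneg (hf0 w) b) (fun w => Real.rpow_le_one (hf0 w) (hf1 w) hb0.le)
      (fun w => le_rfl) hh1) (stepMean_const (κ := κ) (τ := τ) (σ := σ) (q := q') (ξ := ξ') hN0 1).le
  have hy0 : 0 ≤ x ^ (1 / b) := Real.rpow_nonneg hx0 _
  have hy1 : x ^ (1 / b) ≤ 1 := Real.rpow_le_one hx0 hx1 (by positivity)
  have h5 : 0 ≤ shiftConst t := le_trans (by positivity) (shiftConst_ge t)
  have hA := hR.weight_pos
  have hρ : 0 ≤ stepRate N κ a A t := by unfold stepRate; positivity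
  -- The reference value c should be the power mean itself. The floor c₀ keeps log(1/c) bounded.
  set c := max (x ^ (1 / b)) c₀ with hcdef
  have hxc : x ≤ c ^ b := by
    calc x = (x ^ (1 / b)) ^ b := by
          rw [← Real.rpow_mul hx0, one_div_mul_cancel hb0.ne', Real.rpow_one]
      _ ≤ c ^ b := Real.rpow_le_rpow hy0 (le_max_left _ _) hb0.le
  have hmain := hR.stepMean_le hb hbA (lt_max_of_lt_right hc) (max_le hy1 hc1) hf hf0 hf1 hq hcase hxc
  have h6 : c ≤ x ^ (1 / b) + c₀ := max_le (by linarith) (by linarith)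
  have h7 := stepSlack_anti (κ := κ) (a := a) hR.users hA hc (le_max_right (x ^ (1 / b)) c₀)
  have h8 := mul_le_mul_of_nonneg_left h6 (by linarith : 0 ≤ 1 + stepRate N κ a A t)
  rw [← hcdef] at h7
  linarith

/-- With f the probability of halting later on, this is the recursion for the probability of halting
at all. -/
lemma stepMean_zero_add_fail (κ τ σ ξ : ℝ) (q : Fin K → Fin N → Vec d) (f : Vec d → ℝ) :
    stepMean κ τ σ q ξ f 1 = stepMean κ τ σ q ξ f 0 + failMean κ τ q ξ := by
  rw [stepMean, stepMean, failMean, ← mul_add, ← Finset.sum_add_distrib]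
  simp

lemma stepRate_nonneg (hN : 2 ≤ N) (hA : 0 < A) : 0 ≤ stepRate N κ a A t := by
  have hN : (2 : ℝ) ≤ N := by exact_mod_cast hN
  have hN1 : 0 < (N : ℝ) - 1 := by linarith
  have h5 : 0 ≤ shiftConst t := le_trans (by positivity) (shiftConst_ge t)
  unfold stepRate
  positivity

lemma stepSlack_nonneg (hN : 2 ≤ N) (hA : 0 < A) (hc : 0 < c₀) (hc1 : c₀ ≤ 1) :
    0 ≤ stepSlack N κ a A c₀ := by
  have hN : (2 : ℝ) ≤ N := by exact_mod_cast hN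
  have hN1 : 0 < (N : ℝ) - 1 := by linarith
  have h3 : 0 < Real.exp (1 / 100) - 1 := by
    have := Real.add_one_le_exp (1 / 100 : ℝ); linarith
  have h4 := tailBound_pos a
  have hL : 0 ≤ Real.log (1 / c₀) := Real.log_nonneg (by rw [le_div_iff₀ hc]; linarith)
  unfold stepSlack
  positivity

/-- Changing one entry of the tables of gradients in all steps. -/
lemma StepRegime.runMean_le (hR : StepRegime K N κ τ σ a A t s η) (hb : 1 ≤ b)
    (hbA : 88 / 5 * Real.exp (κ * 2) / ((N : ℝ) - 1) * (1 / A) = 1 - 1 / b)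
    (hc : 0 < c₀) (hc1 : c₀ ≤ 1)
    (hqm : ∀ t j v, Measurable fun s => q t s j v) (hqm' : ∀ t j v, Measurable fun s => q' t s j v)
    (hnext : ∀ t, Measurable (Function.uncurry (next t)))
    (hf : Measurable f) (hf0 : ∀ w, 0 ≤ f w) (hf1 : ∀ w, f w ≤ 1)
    (hq : ∀ t s j v, j ≠ k ∨ v ≠ u → q t s j v = q' t s j v) {ξ' : ℝ}
    (hcase : h = 0 ∧ ξ' = ξ - s ∧ -((K : ℝ) / 40) ≤ ξ' ∨ h = 1 ∧ ξ' = ξ + s ∧ -((K : ℝ) / 40) ≤ ξ)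
    (n t₀ : ℕ) (z : St) :
    runMean κ τ σ q next ξ f h n t₀ z ≤ (1 + stepRate N κ a A t) ^ n *
      (runMean κ τ σ q' next ξ' (fun z => f z ^ b) h n t₀ z ^ (1 / b) +
        n * ((1 + stepRate N κ a A t) * c₀ + stepSlack N κ a A c₀) +
        2 * Real.exp (κ * 2) * η / ((N : ℝ) - 1) *
          runMean κ τ σ q next ξ (fun _ => 0) 1 n t₀ z) := by
  have hκ := hR.rate_nonneg
  have hN0 : 0 < N := by linarith [hR.users]
  have hN : (2 : ℝ) ≤ N := by exact_mod_cast hR.users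
  have hN1 : 0 < (N : ℝ) - 1 := by linarith
  have hη : 0 ≤ η := le_trans (by positivity) hR.bad_pass
  have hb0 : 0 < b := by linarith
  have hh0 : 0 ≤ h := by rcases hcase with hh | hh <;> rw [hh.1]; norm_num
  have hh1 : h ≤ 1 := by rcases hcase with hh | hh <;> rw [hh.1]; norm_num
  have hρ : 0 ≤ stepRate N κ a A t := stepRate_nonneg hR.users hR.weight_pos
  have hsl : 0 ≤ stepSlack N κ a A c₀ := stepSlack_nonneg hR.users hR.weight_pos hc hc1
  set D := (1 + stepRate N κ a A t) * c₀ + stepSlack N κ a A c₀ with hD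
  have hD0 : 0 ≤ D := by positivity
  set χ := 2 * Real.exp (κ * 2) * η / ((N : ℝ) - 1) with hχ
  have hχ0 : 0 ≤ χ := by positivity
  set r := 1 + stepRate N κ a A t with hr
  have hr1 : 1 ≤ r := by linarith
  have hfbm : Measurable fun z => f z ^ b := hf.pow_const b
  have hfb0 : ∀ z, 0 ≤ f z ^ b := fun z => Real.rpow_nonneg (hf0 z) b
  have hfb1 : ∀ z, f z ^ b ≤ 1 := fun z => Real.rpow_le_one (hf0 z) (hf1 z) hb0.le
  induction n generalizing t₀ z with
  | zero =>
    have : (f z ^ b) ^ (1 / b) = f z := by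
      rw [← Real.rpow_mul (hf0 z), mul_one_div_cancel hb0.ne', Real.rpow_one]
    simp only [runMean, this]
    simp
  | succ n ih =>
    have hnz : Measurable (next t₀ z) := (hnext t₀).comp (measurable_const.prodMk measurable_id)
    have memP := runMean_mem (κ := κ) (τ := τ) (σ := σ) (ξ := ξ) hκ hN0 hqm hnext hf hf0 hf1 hh0 hh1 n (t₀ + 1)
    have memQ := runMean_mem (κ := κ) (τ := τ) (σ := σ) (ξ := ξ') hκ hN0 hqm' hnext hfbm hfb0 hfb1 hh0 hh1 n
      (t₀ + 1)
    have memH := runMean_mem (κ := κ) (τ := τ) (σ := σ) (ξ := ξ) (f := fun _ => 0) (h := 1) hκ hN0 hqm hnext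
      measurable_const (fun _ => le_rfl) (fun _ => zero_le_one) zero_le_one le_rfl n (t₀ + 1)
    have mP := (measurable_runMean κ τ σ ξ h hqm hnext hf n (t₀ + 1)).comp hnz
    have mQ := (measurable_runMean κ τ σ ξ' h hqm' hnext hfbm n (t₀ + 1)).comp hnz
    have mH := (measurable_runMean (f := fun _ => 0) κ τ σ ξ 1 hqm hnext measurable_const n
      (t₀ + 1)).comp hnz
    set VQ : Vec d → ℝ := fun w =>
      runMean κ τ σ q' next ξ' (fun z => f z ^ b) h n (t₀ + 1) (next t₀ z w) with hVQ
    set H : Vec d → ℝ := fun w =>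
      runMean κ τ σ q next ξ (fun _ => 0) 1 n (t₀ + 1) (next t₀ z w) with hH
    -- The inductive bound for the later steps serves as test function of the present one. Its b-th
    -- power is `VQ`, so power means of successive steps nest without loss of exponent.
    set φ : Vec d → ℝ := fun w => VQ w ^ (1 / b) with hφ
    have mφ : Measurable φ := mQ.pow_const _
    have φ0 : ∀ w, 0 ≤ φ w := fun w => Real.rpow_nonneg (memQ _).1 _
    have φ1 : ∀ w, φ w ≤ 1 := fun w => Real.rpow_le_one (memQ _).1 (memQ _).2 (by positivity)
    have hstep := hR.stepMean_le_rpow hb hbA hc hc1 mφ φ0 φ1 (hq t₀ z) hcase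
    have hφb : (fun w => φ w ^ b) = VQ := by
      funext w
      rw [hφ, ← Real.rpow_mul (memQ _).1, one_div_mul_cancel hb0.ne', Real.rpow_one]
    rw [hφb] at hstep
    have hlin1 := stepMean_add_mul (κ := κ) (τ := τ) (σ := σ) (q := q t₀ z) (ξ := ξ) (h := h) (h' := 0)
      (B := 1) mφ mH φ0 (fun w => (memH _).1) φ1 (fun w => (memH _).2) 1 χ
    have hlin2 := stepMean_add_mul (κ := κ) (τ := τ) (σ := σ) (q := q t₀ z) (ξ := ξ)
      (f := fun w => 1 * φ w + χ * H w) (f' := fun _ => 1) (h := 1 * h + χ * 0) (h' := 1)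
      (B := 1 + χ) (by fun_prop) measurable_const
      (fun w => by have := φ0 w; have : 0 ≤ H w := (memH _).1; positivity) (fun _ => zero_le_one)
      (fun w => by
        have h1 := φ1 w
        have h2 : H w ≤ 1 := (memH _).2
        have := mul_le_mul_of_nonneg_left h2 hχ0
        linarith) (fun w => by linarith) (r ^ n) (r ^ n * (n * D))
    have hrn : 1 ≤ r ^ n := one_le_pow₀ hr1
    have hmono := stepMean_mono (κ := κ) (τ := τ) (σ := σ) (q := q t₀ z) (ξ := ξ) (h := h)
      (h' := r ^ n * (1 * h + χ * 0) + r ^ n * (n * D) * 1) (B := r ^ n * (1 + χ) + r ^ n * (n * D))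
      (f' := fun w => r ^ n * (1 * φ w + χ * H w) + r ^ n * (n * D) * 1) hκ mP (by fun_prop)
      (fun w => (memP _).1)
      (fun w => by
        have := ih (t₀ + 1) (next t₀ z w)
        refine this.trans (le_of_eq ?_)
        simp only [hφ, hVQ, hH]
        ring)
      (fun w => by
        have h1 := φ1 w
        have h2 : H w ≤ 1 := (memH _).2
        have h3 := mul_le_mul_of_nonneg_left h2 hχ0
        have h4 := mul_le_mul_of_nonneg_left (by linarith : 1 * φ w + χ * H w ≤ 1 + χ)
          (by positivity : 0 ≤ r ^ n)
        linarith)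
      (by
        have h1 : 0 ≤ r ^ n * (n * D) := by positivity
        nlinarith)
    rw [hlin2, stepMean_const hN0] at hmono
    rw [show stepMean κ τ σ (q t₀ z) ξ (fun w => 1 * φ w + χ * H w) (1 * h + χ * 0) = _ from hlin1]
      at hmono
    change _ ≤ r ^ n * (1 * stepMean κ τ σ (q t₀ z) ξ φ h + χ * stepMean κ τ σ (q t₀ z) ξ H 0) + _ at hmono
    -- The charge for halting in this step and the mean of the later charges combine to the
    -- probability of halting in the whole run. The total charge thus stays bounded by χ times a
    -- probability.
    have hfail := stepMean_zero_add_fail κ τ σ ξ (q t₀ z) H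
    have hgoal : runMean κ τ σ q next ξ f h (n + 1) t₀ z ≤
        r ^ n * (r * stepMean κ τ σ (q' t₀ z) ξ' VQ h ^ (1 / b) + (n + 1) * D +
          χ * stepMean κ τ σ (q t₀ z) ξ H 1) := by
      refine hmono.trans ?_
      rw [hfail]
      have := mul_le_mul_of_nonneg_left hstep (by positivity : 0 ≤ r ^ n)
      linarith
    refine hgoal.trans ?_
    have e1 : 0 ≤ stepMean κ τ σ (q t₀ z) ξ H 1 :=
      (runMean_mem (κ := κ) (τ := τ) (σ := σ) (ξ := ξ) (f := fun _ => 0) (h := 1) hκ hN0 hqm hnext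
      measurable_const (fun _ => le_rfl) (fun _ => zero_le_one) zero_le_one le_rfl (n + 1) t₀ z).1
    change _ ≤ r ^ (n + 1) * (stepMean κ τ σ (q' t₀ z) ξ' VQ h ^ (1 / b) + ((n + 1 : ℕ) : ℝ) * D +
      χ * stepMean κ τ σ (q t₀ z) ξ H 1)
    rw [pow_succ, mul_assoc]
    refine mul_le_mul_of_nonneg_left ?_ (by positivity)
    push_cast
    have e2 : 0 ≤ ((n : ℝ) + 1) * D := by positivity
    have e3 : 0 ≤ χ * stepMean κ τ σ (q t₀ z) ξ H 1 := mul_nonneg hχ0 e1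
    nlinarith

end Run

/-! ### Changing one user -/

section Hybrid

variable {St : Type*} {d K N : ℕ}

/-- The table that takes the gradients from `q'` at the first `i` positions of the minibatch and from
`q` at the other ones. -/
def hybrid (q q' : ℕ → St → Fin N → Vec d) (i : ℕ) : ℕ → St → Fin K → Fin N → Vec d :=
  fun t z j v => if (j : ℕ) < i then q' t z v else q t z v

/-- A number m ≤ 1 satisfies m^(1/b) = m · exp((1 - 1/b) log(1/m)). Once m is at least y the
exponential is bounded, so small exponent deficits cost a bounded factor above the level y. -/
lemma rpow_le_exp_mul_max {x y b : ℝ} (hx : 0 ≤ x) (hy : 0 < y) (hb : 1 ≤ b) :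
    x ^ (1 / b) ≤ Real.exp ((1 - 1 / b) * Real.log (1 / y)) * max x y := by
  have hb0 : 0 < b := by linarith
  have hν : 0 ≤ 1 - 1 / b := by rw [sub_nonneg, div_le_one hb0]; exact hb
  have hm : 0 < max x y := lt_max_of_lt_right hy
  have h1 : x ^ (1 / b) ≤ (max x y) ^ (1 / b) :=
    Real.rpow_le_rpow hx (le_max_left _ _) (by positivity)
  refine h1.trans ?_
  have h2 : (max x y) ^ (1 / b) = Real.exp ((1 - 1 / b) * -Real.log (max x y)) * max x y := by
    conv_rhs => rw [← Real.exp_log hm, Real.log_exp, ← Real.exp_add]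
    rw [Real.rpow_def_of_pos hm]
    congr 1
    ring
  rw [h2]
  refine mul_le_mul_of_nonneg_right (Real.exp_le_exp.2 (mul_le_mul_of_nonneg_left ?_ hν)) hm.le
  rw [one_div, Real.log_inv]
  exact neg_le_neg (Real.log_le_log hy (le_max_right _ _))

variable [MeasurableSpace St] {κ τ σ ξ h : ℝ} {q q' : ℕ → St → Fin N → Vec d}
  {next : ℕ → St → Vec d → St} {f : St → ℝ} {a A t s η b c₀ δ₂ : ℝ} {u : Fin N}

lemma measurable_hybrid (hqm : ∀ t v, Measurable fun z => q t z v)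
    (hqm' : ∀ t v, Measurable fun z => q' t z v) (i t : ℕ) (j : Fin K) (v : Fin N) :
    Measurable fun z => hybrid q q' i t z j v := by
  unfold hybrid
  split_ifs
  · exact hqm' t v
  · exact hqm t v

/-- The additive loss of the change of one table entry over `n` steps. -/
def runSlack (N : ℕ) (κ a A t η c₀ : ℝ) (n : ℕ) : ℝ :=
  n * ((1 + stepRate N κ a A t) * c₀ + stepSlack N κ a A c₀) +
    2 * Real.exp (κ * 2) * η / ((N : ℝ) - 1)

lemma StepRegime.runSlack_nonneg (hR : StepRegime K N κ τ σ a A t s η) (hc : 0 < c₀) (hc1 : c₀ ≤ 1)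
    (n : ℕ) : 0 ≤ runSlack N κ a A t η c₀ n := by
  have hN : (2 : ℝ) ≤ N := by exact_mod_cast hR.users
  have hN1 : 0 < (N : ℝ) - 1 := by linarith
  have hη : 0 ≤ η := le_trans (by positivity) hR.bad_pass
  have hρ : 0 ≤ stepRate N κ a A t := stepRate_nonneg hR.users hR.weight_pos
  have hsl : 0 ≤ stepSlack N κ a A c₀ := stepSlack_nonneg hR.users hR.weight_pos hc hc1
  unfold runSlack
  positivity

/-- Changing the data of one user, at a fixed threshold noise. -/
lemma StepRegime.runMean_le_of_user (hR : StepRegime K N κ τ σ a A t s η) (hb : 1 ≤ b)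
    (hbA : 88 / 5 * Real.exp (κ * 2) / ((N : ℝ) - 1) * (1 / A) = 1 - 1 / b)
    (hc : 0 < c₀) (hc1 : c₀ ≤ 1) (hδ : 0 < δ₂) (hδ1 : δ₂ ≤ 1)
    (hqm : ∀ t v, Measurable fun z => q t z v) (hqm' : ∀ t v, Measurable fun z => q' t z v)
    (hnext : ∀ t, Measurable (Function.uncurry (next t)))
    (hf : Measurable f) (hf0 : ∀ w, 0 ≤ f w) (hf1 : ∀ w, f w ≤ 1)
    (hq : ∀ t z v, v ≠ u → q t z v = q' t z v) {sg : ℝ}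
    (hcase : h = 0 ∧ sg = -1 ∨ h = 1 ∧ sg = 1) (hξ : -((K : ℝ) / 40) ≤ ξ - K * s)
    (n : ℕ) (z : St) :
    runMean κ τ σ (fun t z (_ : Fin K) v => q t z v) next ξ f h n 0 z ≤
      ((1 + stepRate N κ a A t) ^ n * Real.exp ((1 - 1 / b) * Real.log (1 / δ₂))) ^ K *
      (runMean κ τ σ (fun t z (_ : Fin K) v => q' t z v) next (ξ + sg * (K * s)) f h n 0 z + δ₂ +
        K * runSlack N κ a A t η c₀ n) := by
  have hκ := hR.rate_nonneg
  have hs := hR.offset_nonneg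
  have hN0 : 0 < N := by linarith [hR.users]
  have hN : (2 : ℝ) ≤ N := by exact_mod_cast hR.users
  have hN1 : 0 < (N : ℝ) - 1 := by linarith
  have hη : 0 ≤ η := le_trans (by positivity) hR.bad_pass
  have hb0 : 0 < b := by linarith
  have hh0 : 0 ≤ h := by rcases hcase with hh | hh <;> rw [hh.1]; norm_num
  have hh1 : h ≤ 1 := by rcases hcase with hh | hh <;> rw [hh.1]; norm_num
  have hρ : 0 ≤ stepRate N κ a A t := stepRate_nonneg hR.users hR.weight_pos
  have hd0 := hR.runSlack_nonneg (t := t) hc hc1 n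
  have hν : 0 ≤ 1 - 1 / b := by rw [sub_nonneg, div_le_one hb0]; exact hb
  have hL : 0 ≤ Real.log (1 / δ₂) := Real.log_nonneg (by rw [le_div_iff₀ hδ]; linarith)
  set dd := runSlack N κ a A t η c₀ n with hdd
  set r := (1 + stepRate N κ a A t) ^ n with hr
  have hr1 : 1 ≤ r := one_le_pow₀ (by linarith)
  set E := Real.exp ((1 - 1 / b) * Real.log (1 / δ₂)) with hE
  have hE1 : 1 ≤ E := Real.one_le_exp (mul_nonneg hν hL)
  set y : ℕ → ℝ → ℝ := fun i ξ => runMean κ τ σ (hybrid (K := K) q q' i) next ξ f h n 0 z with hy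
  have hmem : ∀ i ξ, 0 ≤ y i ξ ∧ y i ξ ≤ 1 := fun i ξ =>
    runMean_mem hκ hN0 (measurable_hybrid hqm hqm' i) hnext hf hf0 hf1 hh0 hh1 n 0 z
  -- The maximum with δ₂ is carried along the chain of hybrids. The level then enters the final
  -- bound once and not once per hybrid. The threshold moves by another s with each hybrid.
  have hstep : ∀ i, i < K → max (y i (ξ + sg * (i * s))) δ₂ ≤
      r * E * (max (y (i + 1) (ξ + sg * ((i + 1 : ℕ) * s))) δ₂ + dd) := by
    intro i hi
    have hi' : (i : ℝ) + 1 ≤ K := by exact_mod_cast hi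
    have his : ((i : ℝ) + 1) * s ≤ K * s := mul_le_mul_of_nonneg_right hi' hs
    have his0 : 0 ≤ (i : ℝ) * s := by positivity
    have h1 := hR.runMean_le (k := ⟨i, hi⟩) (u := u) (q := hybrid q q' i) (q' := hybrid q q' (i + 1))
      (next := next) (f := f) (h := h) (ξ := ξ + sg * (i * s)) (ξ' := ξ + sg * ((i + 1 : ℕ) * s))
      hb hbA hc hc1 (measurable_hybrid hqm hqm' i) (measurable_hybrid hqm hqm' (i + 1)) hnext hf hf0
      hf1 (by
        intro t z j v hjv
        unfold hybrid
        by_cases hj : (j : ℕ) < i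
        · rw [if_pos hj, if_pos (by omega)]
        · rw [if_neg hj]
          by_cases hj' : (j : ℕ) < i + 1
          · rw [if_pos hj']
            have : j = ⟨i, hi⟩ := Fin.ext (by simp only; omega)
            exact hq t z v (hjv.resolve_left (not_not.2 this))
          · rw [if_neg hj']) (by
        push_cast
        rcases hcase with ⟨rfl, rfl⟩ | ⟨rfl, rfl⟩
        · left
          refine ⟨rfl, by ring, by linarith⟩
        · right
          refine ⟨rfl, by ring, by linarith⟩) n 0 z
    have hH := (runMean_mem (κ := κ) (τ := τ) (σ := σ) (ξ := ξ + sg * (i * s)) (f := fun _ => 0) (h := 1)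
      hκ hN0 (measurable_hybrid (K := K) hqm hqm' i) hnext
      measurable_const (fun _ => le_rfl) (fun _ => zero_le_one) zero_le_one le_rfl n 0 z).2
    -- On [0,1] the b-th power is at most the function itself, so the power can be dropped inside
    -- the mean. Only the outer exponent 1/b is paid for.
    have hpow := runMean_mono (κ := κ) (τ := τ) (σ := σ) (ξ := ξ + sg * ((i + 1 : ℕ) * s))
      (f := fun z => f z ^ b) (f' := f) (h := h) hκ hN0 (measurable_hybrid (K := K) hqm hqm' (i + 1)) hnext
      (hf.pow_const b) hf (fun z => Real.rpow_nonneg (hf0 z) b)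
      (fun z => Real.rpow_le_self_of_le_one (hf0 z) (hf1 z) hb) hf1 hh0 hh1 n 0 z
    have hpow0 := (runMean_mem (κ := κ) (τ := τ) (σ := σ) (ξ := ξ + sg * ((i + 1 : ℕ) * s))
      (f := fun z => f z ^ b) (h := h) hκ hN0 (measurable_hybrid (K := K) hqm hqm' (i + 1)) hnext
      (hf.pow_const b) (fun z => Real.rpow_nonneg (hf0 z) b)
      (fun z => Real.rpow_le_one (hf0 z) (hf1 z) hb0.le) hh0 hh1 n 0 z).1
    have h2 := (Real.rpow_le_rpow hpow0 hpow (by positivity : 0 ≤ 1 / b)).trans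
      (rpow_le_exp_mul_max (hmem (i + 1) (ξ + sg * ((i + 1 : ℕ) * s))).1 hδ hb)
    set M := max (y (i + 1) (ξ + sg * ((i + 1 : ℕ) * s))) δ₂ with hM
    have hM0 : δ₂ ≤ M := le_max_right _ _
    have hrE : 1 ≤ r * E := by nlinarith
    refine max_le ?_ ((by linarith : δ₂ ≤ M + dd).trans (le_mul_of_one_le_left (by linarith) hrE))
    refine h1.trans ?_
    rw [← hr, mul_assoc r E]
    refine mul_le_mul_of_nonneg_left ?_ (zero_le_one.trans hr1)
    have h3 : 2 * Real.exp (κ * 2) * η / ((N : ℝ) - 1) *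
        runMean κ τ σ (hybrid (K := K) q q' i) next (ξ + sg * (i * s)) (fun _ => 0) 1 n 0 z ≤
        2 * Real.exp (κ * 2) * η / ((N : ℝ) - 1) :=
      mul_le_of_le_one_right (by positivity) hH
    have h4 : dd ≤ E * dd := by nlinarith
    have h5 : dd = n * ((1 + stepRate N κ a A t) * c₀ + stepSlack N κ a A c₀) +
      2 * Real.exp (κ * 2) * η / ((N : ℝ) - 1) := rfl
    linarith
  have hchain : ∀ i, i ≤ K → max (y 0 ξ) δ₂ ≤
      (r * E) ^ i * (max (y i (ξ + sg * (i * s))) δ₂ + i * dd) := by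
    intro i
    induction i with
    | zero => intro _; simp
    | succ i ih =>
      intro hi
      have h1 := ih (by omega)
      have h2 := hstep i (by omega)
      have hrE : 1 ≤ r * E := by nlinarith
      refine h1.trans ?_
      rw [pow_succ, mul_assoc]
      refine mul_le_mul_of_nonneg_left ?_ (by positivity)
      have : (i : ℝ) * dd ≤ r * E * (i * dd) := le_mul_of_one_le_left (by positivity) hrE
      push_cast at h2 ⊢
      linarith
  have h0 := hchain K le_rfl
  have e0 : y 0 ξ = runMean κ τ σ (fun t z (_ : Fin K) v => q t z v) next ξ f h n 0 z := by
    simp only [hy]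
    congr 1
  have eK : y K (ξ + sg * (K * s)) =
      runMean κ τ σ (fun t z (_ : Fin K) v => q' t z v) next (ξ + sg * (K * s)) f h n 0 z := by
    simp only [hy]
    congr 1
    funext t z j v
    simp [hybrid]
  rw [← e0, ← eK]
  refine (le_max_left _ _).trans (h0.trans ?_)
  refine mul_le_mul_of_nonneg_left ?_ (by positivity)
  have := max_le (by linarith : y K (ξ + sg * (K * s)) ≤ y K (ξ + sg * (K * s)) + δ₂)
    (by linarith [(hmem K (ξ + sg * (K * s))).1] : δ₂ ≤ y K (ξ + sg * (K * s)) + δ₂)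
  linarith

lemma integral_laplace_add_le {β : ℝ} (hβ : 0 < β) (s : ℝ) {y : ℝ → ℝ} (hy : Measurable y)
    (h0 : ∀ x, 0 ≤ y x) (h1 : ∀ x, y x ≤ 1) :
    ∫ x, y (x + s) ∂laplace β ≤ Real.exp (|s| / β) * ∫ x, y x ∂laplace β := by
  have := isProbabilityMeasure_laplace hβ
  have hm : Measurable fun x => y (x + s) := hy.comp (measurable_id.add_const s)
  have hi : Integrable y (laplace β) := integrable_of_mem_Icc hy h0 h1
  have hi' : Integrable (fun x => y (x + s)) (laplace β) :=
    integrable_of_mem_Icc hm (fun _ => h0 _) fun _ => h1 _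
  have key := lintegral_laplace_add_le hβ s (h := fun x => ENNReal.ofReal (y x)) (by fun_prop)
  rw [← ofReal_integral_eq_lintegral_ofReal hi (Filter.Eventually.of_forall h0),
    ← ofReal_integral_eq_lintegral_ofReal hi' (Filter.Eventually.of_forall fun _ => h0 _),
    ← ENNReal.ofReal_mul (Real.exp_pos _).le] at key
  exact (ENNReal.ofReal_le_ofReal_iff
    (mul_nonneg (Real.exp_pos _).le (integral_nonneg fun _ => h0 _))).1 key

/-- Changing the data of one user in a whole phase. -/
lemma StepRegime.integral_runMean_le (hR : StepRegime K N κ τ σ a A t s η) (hb : 1 ≤ b)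
    (hbA : 88 / 5 * Real.exp (κ * 2) / ((N : ℝ) - 1) * (1 / A) = 1 - 1 / b)
    (hc : 0 < c₀) (hc1 : c₀ ≤ 1) (hδ : 0 < δ₂) (hδ1 : δ₂ ≤ 1)
    (hqm : ∀ t v, Measurable fun z => q t z v) (hqm' : ∀ t v, Measurable fun z => q' t z v)
    (hnext : ∀ t, Measurable (Function.uncurry (next t)))
    (hf : Measurable f) (hf0 : ∀ w, 0 ≤ f w) (hf1 : ∀ w, f w ≤ 1)
    (hq : ∀ t z v, v ≠ u → q t z v = q' t z v) (hh : h = 0 ∨ h = 1) {β : ℝ} (hβ : 0 < β)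
    (hs1 : K * s - K / 40 ≤ -(K / 50)) (n : ℕ) (z : St) :
    ∫ ξ, runMean κ τ σ (fun t z (_ : Fin K) v => q t z v) next ξ f h n 0 z ∂laplace β ≤
      ((1 + stepRate N κ a A t) ^ n * Real.exp ((1 - 1 / b) * Real.log (1 / δ₂))) ^ K *
      (Real.exp (K * s / β) *
        ∫ ξ, runMean κ τ σ (fun t z (_ : Fin K) v => q' t z v) next ξ f h n 0 z ∂laplace β + δ₂ +
        K * runSlack N κ a A t η c₀ n) + 1 / 2 * Real.exp (-(1 / β * (K / 50))) := by
  have := isProbabilityMeasure_laplace hβ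
  have hκ := hR.rate_nonneg
  have hs := hR.offset_nonneg
  have hN0 : 0 < N := by linarith [hR.users]
  have hh0 : 0 ≤ h := by rcases hh with hh | hh <;> rw [hh]; norm_num
  have hh1 : h ≤ 1 := by rcases hh with hh | hh <;> rw [hh]; norm_num
  obtain ⟨sg, hsg, hsg1⟩ : ∃ sg : ℝ, (h = 0 ∧ sg = -1 ∨ h = 1 ∧ sg = 1) ∧ |sg| = 1 := by
    rcases hh with hh | hh
    · exact ⟨-1, Or.inl ⟨hh, rfl⟩, by norm_num⟩
    · exact ⟨1, Or.inr ⟨hh, rfl⟩, by norm_num⟩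
  have hρ : 0 ≤ stepRate N κ a A t := stepRate_nonneg hR.users hR.weight_pos
  have hd0 := hR.runSlack_nonneg (t := t) hc hc1 n
  set G := ((1 + stepRate N κ a A t) ^ n * Real.exp ((1 - 1 / b) * Real.log (1 / δ₂))) ^ K with hG
  have hG0 : 0 ≤ G := by positivity
  set y : ℝ → ℝ := fun ξ => runMean κ τ σ (fun t z (_ : Fin K) v => q t z v) next ξ f h n 0 z with hy
  set y' : ℝ → ℝ := fun ξ => runMean κ τ σ (fun t z (_ : Fin K) v => q' t z v) next ξ f h n 0 z with hy'
  have my : Measurable y := (measurable_runMean_prod κ τ σ h (fun t j v => hqm t v) hnext hf n 0).comp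
    (measurable_id.prodMk measurable_const)
  have my' : Measurable y' := (measurable_runMean_prod κ τ σ h (fun t j v => hqm' t v) hnext hf n 0).comp
    (measurable_id.prodMk measurable_const)
  have my0 : ∀ ξ, 0 ≤ y ξ ∧ y ξ ≤ 1 := fun ξ =>
    runMean_mem hκ hN0 (fun t j v => hqm t v) hnext hf hf0 hf1 hh0 hh1 n 0 z
  have my0' : ∀ ξ, 0 ≤ y' ξ ∧ y' ξ ≤ 1 := fun ξ =>
    runMean_mem hκ hN0 (fun t j v => hqm' t v) hnext hf hf0 hf1 hh0 hh1 n 0 z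
  -- For ξ ≥ -K/50 all the moved thresholds stay above -K/40, as `hs1` gives Ks ≤ K/200. The
  -- remaining values of ξ form a Laplace tail, on which the mean is bounded by 1.
  have hpt : ∀ ξ, y ξ ≤ G * (y' (ξ + sg * (K * s)) + δ₂ + K * runSlack N κ a A t η c₀ n) +
      (Set.Iio (-((K : ℝ) / 50))).indicator (fun _ => (1 : ℝ)) ξ := by
    intro ξ
    by_cases hξ : ξ < -((K : ℝ) / 50)
    · rw [Set.indicator_of_mem (Set.mem_Iio.2 hξ)]
      have := (my0' (ξ + sg * (K * s))).1
      have h2 : 0 ≤ G * (y' (ξ + sg * (K * s)) + δ₂ + K * runSlack N κ a A t η c₀ n) := by positivity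
      linarith [(my0 ξ).2]
    · rw [Set.indicator_of_notMem (by simpa using hξ), add_zero]
      exact hR.runMean_le_of_user hb hbA hc hc1 hδ hδ1 hqm hqm' hnext hf hf0 hf1 hq hsg
        (by linarith) n z
  have mshift : Measurable fun ξ => y' (ξ + sg * (K * s)) := my'.comp (measurable_id.add_const _)
  have ishift : Integrable (fun ξ => y' (ξ + sg * (K * s))) (laplace β) :=
    integrable_of_mem_Icc mshift (fun _ => (my0' _).1) fun _ => (my0' _).2
  have ishift' : Integrable (fun ξ => y' (ξ + sg * (K * s)) + δ₂) (laplace β) :=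
    ishift.add (integrable_const δ₂)
  have iind : Integrable ((Set.Iio (-((K : ℝ) / 50))).indicator fun _ => (1 : ℝ)) (laplace β) :=
    (integrable_const 1).indicator measurableSet_Iio
  have hintegral := integral_mono (μ := laplace β)
    (integrable_of_mem_Icc my (fun _ => (my0 _).1) fun _ => (my0 _).2)
    ((((ishift.add (integrable_const δ₂)).add
      (integrable_const (K * runSlack N κ a A t η c₀ n))).const_mul G).add iind) hpt
  have hsum : ∫ ξ, G * (y' (ξ + sg * (K * s)) + δ₂ + K * runSlack N κ a A t η c₀ n) +
      (Set.Iio (-((K : ℝ) / 50))).indicator (fun _ => (1 : ℝ)) ξ ∂laplace β =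
      G * (∫ ξ, y' (ξ + sg * (K * s)) ∂laplace β + δ₂ + K * runSlack N κ a A t η c₀ n) +
        1 / 2 * Real.exp (-(1 / β * (K / 50))) := by
    rw [integral_add _ iind, integral_const_mul, integral_add ishift' (integrable_const _), integral_add ishift (integrable_const _), integral_const, integral_const,
      integral_indicator_const _ measurableSet_Iio, measureReal_def (laplace β) (Set.Iio _),
      laplace_Iio hβ (neg_nonpos.2 (by positivity)), ENNReal.toReal_ofReal (by positivity)]
    · simp
    · exact (ishift'.add (integrable_const _)).const_mul G
  change _ ≤ ∫ ξ, G * (y' (ξ + sg * (K * s)) + δ₂ + K * runSlack N κ a A t η c₀ n) +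
      (Set.Iio (-((K : ℝ) / 50))).indicator (fun _ => (1 : ℝ)) ξ ∂laplace β at hintegral
  rw [hsum] at hintegral
  refine hintegral.trans (add_le_add_left (mul_le_mul_of_nonneg_left ?_ hG0) _)
  have hsh := integral_laplace_add_le hβ (sg * (K * s)) my' (fun x => (my0' x).1) fun x => (my0' x).2
  rw [abs_mul, hsg1, one_mul, abs_of_nonneg (by positivity)] at hsh
  linarith

end Hybrid

/-! ### The parameters of one phase -/

/-- What the choice of the minibatch size gives for a phase with `N` users, minibatches of size `K`
and `T` steps. -/
structure PhaseBounds (N K T : ℕ) (ε δ Λ Λ' : ℝ) : Prop where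
  eps_pos : 0 < ε
  eps_le : ε ≤ 10
  delta_pos : 0 < δ
  delta_lt : δ < 1
  users_pos : 0 < N
  steps_pos : 0 < T
  batch_le : K ≤ N
  log_le : 2 * Real.log N + ε + Real.log (1 / δ) ≤ Λ
  log_le' : Real.log N + ε + Real.log (1 / δ) ≤ Λ'
  le_batch : 500 * Λ / ε ≤ K
  le_batch' : 500 * Λ * N * ε ≤ K * √(T : ℝ) * √(Real.log (1 / δ))

/-- Reduces a numerical bound on e^(k/p) to a comparison of rational powers, from a decimal bound on
e. -/
lemma exp_le_of_pow_le {x y : ℝ} {p k : ℕ} (hp : p ≠ 0) (hy : 0 ≤ y) (hx : x * p = k)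
    (h : (2.7182818286 : ℝ) ^ k ≤ y ^ p) : Real.exp x ≤ y := by
  refine le_of_pow_le_pow_left₀ hp hy ?_
  rw [← Real.exp_nat_mul, mul_comm, hx, ← Real.exp_one_pow]
  exact (pow_le_pow_left₀ (Real.exp_pos 1).le Real.exp_one_lt_d9.le k).trans h

/-! ### Numerical consequences of the choice of the minibatch size -/

namespace PhaseBounds

variable {N K T : ℕ} {ε δ Λ Λ' : ℝ}

lemma log_pos (h : PhaseBounds N K T ε δ Λ Λ') : 0 < Real.log (1 / δ) :=
  Real.log_pos (by rw [lt_div_iff₀ h.delta_pos]; linarith [h.delta_lt])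

/-- Bootstrapping through K ≤ N. Since Λ ≥ ε, first K ≥ 500, hence N ≥ 500 and log N ≥ 31/5. Then Λ
≥ 62/5 + ε, and ε ≤ 10 yields K ≥ 620 + 500. -/
lemma batch_ge (h : PhaseBounds N K T ε δ Λ Λ') : (1120 : ℝ) ≤ K := by
  have hε := h.eps_pos
  have hε10 := h.eps_le
  have hl := h.log_pos
  have hΛ := h.log_le
  have hKN : (K : ℝ) ≤ N := by exact_mod_cast h.batch_le
  have hK := h.le_batch
  rw [div_le_iff₀ hε] at hK
  have hN : (1 : ℝ) ≤ N := by exact_mod_cast h.users_pos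
  have h0 : 0 ≤ Real.log N := Real.log_nonneg hN
  have h1 : (500 : ℝ) ≤ K := by nlinarith
  have h2 : (31 / 5 : ℝ) ≤ Real.log N := by
    rw [Real.le_log_iff_exp_le (by linarith)]
    refine (exp_le_of_pow_le (p := 5) (k := 31) (y := 500) (by norm_num) (by norm_num) (by norm_num)
      (by norm_num)).trans (by linarith)
  nlinarith

lemma log_ge (h : PhaseBounds N K T ε δ Λ Λ') : (7 : ℝ) ≤ Real.log N := by
  have hKN : (K : ℝ) ≤ N := by exact_mod_cast h.batch_le
  have hK := h.batch_ge
  rw [Real.le_log_iff_exp_le (by linarith)]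
  exact (exp_le_of_pow_le (p := 1) (k := 7) (y := 1120) (by norm_num) (by norm_num) (by norm_num)
    (by norm_num)).trans (by linarith)

/-- The shift of the mean of the kept members by one member, in units of the noise. -/
def shift (N K T : ℕ) (ε Λ' : ℝ) : ℝ := ε * N / (50 * K * √(T : ℝ) * Λ')

/-- The two lower bounds on K give two bounds on the shift. The one from `le_batch'` is uniform in
T. The one from `le_batch` decays in T and is what controls the union over a large number of steps.
-/
lemma shift_bounds (h : PhaseBounds N K T ε δ Λ Λ') :
    0 < shift N K T ε Λ' ∧
      shift N K T ε Λ' ^ 2 * (625000000 * (Λ * Λ') ^ 2) ≤ Real.log (1 / δ) ∧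
      shift N K T ε Λ' ^ 2 * (625000000 * (Λ * Λ') ^ 2 * T) ≤ ε ^ 4 * N ^ 2 := by
  have hε := h.eps_pos
  have hl := h.log_pos
  have hK := h.batch_ge
  have hL := h.log_ge
  have hΛ := h.log_le
  have hΛ' := h.log_le'
  have hKN : (K : ℝ) ≤ N := by exact_mod_cast h.batch_le
  have hT : (1 : ℝ) ≤ T := by exact_mod_cast h.steps_pos
  have hR : 0 < √(T : ℝ) := Real.sqrt_pos.2 (by linarith)
  have hR2 : √(T : ℝ) ^ 2 = T := Real.sq_sqrt (by linarith)
  have hℓ2 : √(Real.log (1 / δ)) ^ 2 = Real.log (1 / δ) := Real.sq_sqrt hl.le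
  have hℓ0 := Real.sqrt_nonneg (Real.log (1 / δ))
  have hb := h.le_batch'
  have hb' := h.le_batch
  rw [div_le_iff₀ hε] at hb'
  set R := √(T : ℝ) with hRdef
  set y := √(Real.log (1 / δ)) with hy
  have hΛ0 : 0 < Λ := by linarith
  have hΛ0' : 0 < Λ' := by linarith
  have hN0 : (0 : ℝ) < N := by linarith
  have hK0 : (0 : ℝ) < K := by linarith
  set a := shift N K T ε Λ' with ha
  have ha0 : 0 < a := by rw [ha, shift]; positivity
  have e : a * (50 * K * R * Λ') = ε * N := by rw [ha, shift]; field_simp; exact hRdef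
  have h1 : a * (25000 * (Λ * Λ')) ≤ y := by
    have : K * R * (a * (25000 * (Λ * Λ'))) ≤ K * R * y := by
      calc K * R * (a * (25000 * (Λ * Λ'))) = 500 * Λ * (a * (50 * K * R * Λ')) := by ring
        _ = 500 * Λ * N * ε := by rw [e]; ring
        _ ≤ _ := hb
    exact le_of_mul_le_mul_left this (by positivity)
  have h2 : a * (25000 * (Λ * Λ') * R) ≤ ε ^ 2 * N := by
    calc a * (25000 * (Λ * Λ') * R) = a * (50 * R * Λ') * (500 * Λ) := by ring
      _ ≤ a * (50 * R * Λ') * (K * ε) := by gcongr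
      _ = ε * (a * (50 * K * R * Λ')) := by ring
      _ = _ := by rw [e]; ring
  refine ⟨ha0, ?_, ?_⟩
  · rw [← hℓ2]
    have := pow_le_pow_left₀ (by positivity) h1 2
    nlinarith
  · have := pow_le_pow_left₀ (by positivity) h2 2
    rw [← hR2]
    nlinarith

/-- The probability level below which the power means are not tracked. -/
def level (ε δ : ℝ) : ℝ := δ * Real.exp (-(19 / 40 * ε)) / 8

/-- The exponent deficit of the power means. -/
def deficit (K : ℕ) (ε δ : ℝ) : ℝ := 3 / 10 * ε / (K * Real.log (1 / level ε δ))

lemma log_level (h : PhaseBounds N K T ε δ Λ Λ') :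
    Real.log (1 / level ε δ) = Real.log (1 / δ) + 19 / 40 * ε + Real.log 8 := by
  have hδ := h.delta_pos
  rw [level, one_div, one_div, Real.log_inv, Real.log_inv, Real.log_div (by positivity) (by norm_num),
    Real.log_mul hδ.ne' (Real.exp_pos _).ne', Real.log_exp]
  ring

lemma log_eight_le : Real.log 8 ≤ 21 / 10 ∧ 2 ≤ Real.log 8 := by
  have : Real.log 8 = 3 * Real.log 2 := by
    rw [show (8 : ℝ) = 2 ^ 3 by norm_num, Real.log_pow]; norm_num
  rw [this]
  constructor <;> linarith [Real.log_two_lt_d9, Real.log_two_gt_d9]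

/-- The constants of the one-entry estimate. -/
def rate (N : ℕ) (ε : ℝ) : ℝ := 88 / 5 * Real.exp (ε / 16 * 2) / ((N : ℝ) - 1)

/-- Chosen so that the entropy coefficient `rate / weight` equals the exponent deficit 1 - 1/b. -/
def weight (N K : ℕ) (ε δ : ℝ) : ℝ := rate N ε / deficit K ε δ

lemma shiftConst_of_small : shiftConst (1 / 100) ≤ 27 / 100 := by
  have h1 := Real.exp_bound' (x := 1 / 8) (by norm_num) (by norm_num) (n := 4) (by norm_num)
  have h2 := Real.exp_bound' (x := 1 / 200) (by norm_num) (by norm_num) (n := 3) (by norm_num)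
  have h3 := Real.exp_bound' (x := 1 / 20000) (by norm_num) (by norm_num) (n := 2) (by norm_num)
  have h4 : Real.exp (-(1 / 200)) ≤ 200 / 201 := by
    rw [Real.exp_neg, inv_le_comm₀ (Real.exp_pos _) (by norm_num)]
    have := Real.add_one_le_exp (1 / 200 : ℝ)
    norm_num at this ⊢
    linarith
  norm_num [Finset.sum_range_succ, Nat.factorial] at h1 h2 h3
  have e1 : ((1 : ℝ) / 100) ^ 2 / 2 = 1 / 20000 := by norm_num
  have e2 : (1 : ℝ) / 100 / 2 = 1 / 200 := by norm_num
  rw [shiftConst, e1, e2]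
  have p3 := Real.exp_pos (1 / 20000 : ℝ)
  have h5 : Real.exp (1 / 8) * (Real.exp (1 / 200) + Real.exp (-(1 / 200))) ≤
      (11332 / 10000) * (20001 / 10000) := by
    refine mul_le_mul ?_ ?_ (by positivity) (by norm_num)
    · norm_num at h1 ⊢; linarith
    · norm_num at h2 h4 ⊢; linarith
  calc Real.exp (1 / 20000) * (Real.exp (1 / 8) * (Real.exp (1 / 200) + Real.exp (-(1 / 200))) - 2)
      ≤ Real.exp (1 / 20000) * ((11332 / 10000) * (20001 / 10000) - 2) := by gcongr
    _ ≤ 1001 / 1000 * ((11332 / 10000) * (20001 / 10000) - 2) := by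
        gcongr
        norm_num at h3 ⊢; linarith
    _ ≤ _ := by norm_num

lemma shiftConst_of_large : shiftConst (123 / 100) ≤ 153 / 100 := by
  have h1 := Real.exp_bound' (x := 1 / 8) (by norm_num) (by norm_num) (n := 4) (by norm_num)
  have h2 := Real.exp_bound' (x := 123 / 200) (by norm_num) (by norm_num) (n := 6) (by norm_num)
  have h3 := Real.exp_bound' (x := 15129 / 20000) (by norm_num) (by norm_num) (n := 6) (by norm_num)
  have h4 : Real.exp (-(123 / 200)) ≤ 5427 / 10000 := by
    rw [Real.exp_neg, inv_le_comm₀ (Real.exp_pos _) (by norm_num)]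
    have := Real.sum_le_exp_of_nonneg (x := 123 / 200) (by norm_num) 4
    norm_num [Finset.sum_range_succ, Nat.factorial] at this ⊢
    linarith
  norm_num [Finset.sum_range_succ, Nat.factorial] at h1 h2 h3
  have e1 : ((123 : ℝ) / 100) ^ 2 / 2 = 15129 / 20000 := by norm_num
  have e2 : (123 : ℝ) / 100 / 2 = 123 / 200 := by norm_num
  rw [shiftConst, e1, e2]
  have h5 : Real.exp (1 / 8) * (Real.exp (123 / 200) + Real.exp (-(123 / 200))) ≤
      (11332 / 10000) * (23926 / 10000) := by
    refine mul_le_mul ?_ ?_ (by positivity) (by norm_num)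
    · norm_num at h1 ⊢; linarith
    · norm_num at h2 h4 ⊢; linarith
  calc Real.exp (15129 / 20000) *
        (Real.exp (1 / 8) * (Real.exp (123 / 200) + Real.exp (-(123 / 200))) - 2)
      ≤ Real.exp (15129 / 20000) * ((11332 / 10000) * (23926 / 10000) - 2) := by gcongr
    _ ≤ 2131 / 1000 * ((11332 / 10000) * (23926 / 10000) - 2) := by
        gcongr
        norm_num at h3 ⊢; linarith
    _ ≤ _ := by norm_num

lemma exp_le_chord {x y : ℝ} (hy : 0 < y) (hx : 0 ≤ x) (hxy : x ≤ y) :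
    Real.exp x ≤ 1 + x / y * (Real.exp y - 1) := by
  have h := convexOn_exp.2 (Set.mem_univ (0 : ℝ)) (Set.mem_univ y)
    (by rw [sub_nonneg, div_le_one hy]; exact hxy : 0 ≤ 1 - x / y) (by positivity : 0 ≤ x / y)
    (by ring)
  simp only [smul_eq_mul, mul_zero, zero_add, Real.exp_zero, div_mul_cancel₀ _ hy.ne'] at h
  linarith

lemma deficit_pos (h : PhaseBounds N K T ε δ Λ Λ') : 0 < deficit K ε δ := by
  have := h.eps_pos
  have := h.batch_ge
  have := h.log_pos
  have := log_eight_le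
  have h1 : 0 < Real.log (1 / level ε δ) := by rw [h.log_level]; linarith
  unfold deficit
  positivity

lemma deficit_le (h : PhaseBounds N K T ε δ Λ Λ') : deficit K ε δ * K ≤ 3 / 2 := by
  have h1 := h.eps_pos
  have h2 := h.batch_ge
  have h3 := h.log_pos
  have h4 := log_eight_le
  have h6 := h.eps_le
  have h5 : 2 ≤ Real.log (1 / level ε δ) := by rw [h.log_level]; linarith
  rw [deficit, div_mul_eq_mul_div, div_le_iff₀ (by positivity)]
  nlinarith

lemma rate_pos (h : PhaseBounds N K T ε δ Λ Λ') : 0 < rate N ε := by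
  have hKN : (K : ℝ) ≤ N := by exact_mod_cast h.batch_le
  have hK := h.batch_ge
  have : 0 < (N : ℝ) - 1 := by linarith
  unfold rate
  positivity

lemma exp_eighth_le (h : PhaseBounds N K T ε δ Λ Λ') : Real.exp (ε / 16 * 2) ≤ 1 + ε / 4 := by
  have h1 : Real.exp (5 / 4) ≤ 7 / 2 :=
    exp_le_of_pow_le (p := 4) (k := 5) (by norm_num) (by norm_num) (by norm_num) (by norm_num)
  have h2 := exp_le_chord (x := ε / 16 * 2) (y := 5 / 4) (by norm_num) (by linarith [h.eps_pos])
    (by linarith [h.eps_le])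
  have h3 : ε / 16 * 2 / (5 / 4) * (Real.exp (5 / 4) - 1) ≤ ε / 16 * 2 / (5 / 4) * (5 / 2) :=
    mul_le_mul_of_nonneg_left (by linarith) (by linarith [h.eps_pos])
  linarith

/-- The shift of the threshold for one table entry. -/
def offset (N : ℕ) : ℝ := 21 / 5 / N

/-- The left side is at most ε/4 by `exp_eighth_le`. The right side is close to N · (ε/16) · 21/(5N)
= 21ε/80, and N ≥ 1120 keeps the corrections below the difference. -/
lemma transport_bound (h : PhaseBounds N K T ε δ Λ Λ') :
    Real.exp (ε / 16 * 2) - 1 ≤ ((N : ℝ) - 1) * (1 - Real.exp (-(ε / 16 * offset N))) := by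
  have hε := h.eps_pos
  have hε10 := h.eps_le
  have hKN : (K : ℝ) ≤ N := by exact_mod_cast h.batch_le
  have hK := h.batch_ge
  have hN0 : (0 : ℝ) < N := by linarith
  have h1 := h.exp_eighth_le
  set x := ε / 16 * offset N with hx
  have hxN : x * N = 21 / 80 * ε := by rw [hx, offset]; field_simp; ring
  have hx0 : 0 < x := by rw [hx, offset]; positivity
  have hx1 : x ≤ 1 / 400 := by
    have : x * 1120 ≤ x * N := mul_le_mul_of_nonneg_left (by linarith) hx0.le
    linarith
  have h2 : Real.exp (-x) ≤ 1 / (1 + x) := by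
    rw [Real.exp_neg, ← one_div]
    exact one_div_le_one_div_of_le (by linarith) (by linarith [Real.add_one_le_exp x])
  have h3 : x * (399 / 400) ≤ 1 - Real.exp (-x) := by
    have : 1 / (1 + x) ≤ 1 - x * (399 / 400) := by
      rw [div_le_iff₀ (by linarith)]; nlinarith
    linarith
  have h4 : ((N : ℝ) - 1) * (x * (399 / 400)) ≤ ((N : ℝ) - 1) * (1 - Real.exp (-x)) :=
    mul_le_mul_of_nonneg_left h3 (by linarith)
  have h5 : ((N : ℝ) - 1) * (x * (399 / 400)) = 399 / 400 * (x * N) - 399 / 400 * x := by ring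
  have h6 : x * 1120 ≤ 21 / 80 * ε := by
    rw [← hxN]; exact mul_le_mul_of_nonneg_left (by linarith) hx0.le
  rw [h5, hxN] at h4
  linarith

lemma ratio_le (h : PhaseBounds N K T ε δ Λ Λ') : (N : ℝ) / (N - 1) ≤ 1001 / 1000 := by
  have hKN : (K : ℝ) ≤ N := by exact_mod_cast h.batch_le
  have hK := h.batch_ge
  rw [div_le_iff₀ (by linarith)]
  linarith

/-- The bound on the exponential tilt. -/
def tilt (ε : ℝ) : ℝ := if ε ≤ 1 / 4 then 123 / 100 else 1 / 100

/-- K and the prefactor ε cancel. What remains is of order 1/√T, so T times the square of this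
product, which governs the second-order loss, does not grow with T. -/
lemma weight_mul_shift (h : PhaseBounds N K T ε δ Λ Λ') :
    weight N K ε δ * shift N K T ε Λ' = 88 / 75 * Real.exp (ε / 16 * 2) * ((N : ℝ) / (N - 1)) *
      (Real.log (1 / level ε δ) / (√(T : ℝ) * Λ')) := by
  have hε := h.eps_pos
  have hKN : (K : ℝ) ≤ N := by exact_mod_cast h.batch_le
  have hK := h.batch_ge
  have hl := h.log_pos
  have hL := h.log_ge
  have hΛ' := h.log_le'
  have h8 := log_eight_le
  have hT : (1 : ℝ) ≤ T := by exact_mod_cast h.steps_pos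
  have hR : 0 < √(T : ℝ) := Real.sqrt_pos.2 (by linarith)
  have h1 : 0 < Real.log (1 / level ε δ) := by rw [h.log_level]; linarith
  have hN1 : (N : ℝ) - 1 ≠ 0 := by linarith
  have hΛ0' : 0 < Λ' := by linarith
  rw [weight, rate, deficit, shift]
  field_simp
  ring

lemma log_level_le (h : PhaseBounds N K T ε δ Λ Λ') :
    Real.log (1 / level ε δ) + (49 / 10 + 21 / 40 * ε) ≤ Λ' := by
  have := h.log_ge
  have := h.log_le'
  have := log_eight_le
  rw [h.log_level]
  linarith

/-- With y = √(log(1/δ)), `le_batch'` and K ≤ N give 500Λε ≤ √T · y. Moreover Λ ≥ 14 + y² ≥ 36y/5. A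
large ε with few steps would thus require a minibatch larger than the group. -/
lemma sqrt_steps_ge (h : PhaseBounds N K T ε δ Λ Λ') (hε : 1 / 4 ≤ ε) : 450 ≤ √(T : ℝ) := by
  have hb := h.le_batch'
  have hl := h.log_pos
  have hΛ := h.log_le
  have hL := h.log_ge
  have hK := h.batch_ge
  have hKN : (K : ℝ) ≤ N := by exact_mod_cast h.batch_le
  have hℓ2 : √(Real.log (1 / δ)) ^ 2 = Real.log (1 / δ) := Real.sq_sqrt hl.le
  have hℓ0 : 0 < √(Real.log (1 / δ)) := Real.sqrt_pos.2 hl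
  have hR0 := Real.sqrt_nonneg (T : ℝ)
  set R := √(T : ℝ)
  set y := √(Real.log (1 / δ))
  have h1 : 500 * Λ * ε ≤ R * y := by
    have : (K : ℝ) * R * y ≤ N * R * y := by gcongr
    have h2 : (N : ℝ) * (500 * Λ * ε) ≤ N * (R * y) := by linarith
    exact le_of_mul_le_mul_left h2 (by linarith)
  have h2 : 125 * Λ ≤ R * y := by nlinarith
  have h3 : 14 + y ^ 2 ≤ Λ := by linarith
  have h4 : (36 / 10 : ℝ) * y * 2 ≤ 14 + y ^ 2 := by nlinarith [sq_nonneg (y - 36 / 10)]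
  have h5 : 450 * y ≤ R * y := by linarith
  exact le_of_mul_le_mul_right h5 hℓ0

/-- For ε ≤ 1/4 the exponential prefactor is close to one and √T ≥ 1 suffices. For larger ε the
prefactor is at most 7/2, and √T ≥ 450 makes the tilt tiny. -/
lemma tilt_bound (h : PhaseBounds N K T ε δ Λ Λ') :
    1011 / 1000 * weight N K ε δ * shift N K T ε Λ' ≤ tilt ε := by
  have hε := h.eps_pos
  have hl := h.log_pos
  have h8 := log_eight_le
  have hL := h.log_level_le
  have hT : (1 : ℝ) ≤ T := by exact_mod_cast h.steps_pos
  have hR : 1 ≤ √(T : ℝ) := Real.one_le_sqrt.2 hT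
  have hr := h.ratio_le
  have h1 : 0 < Real.log (1 / level ε δ) := by rw [h.log_level]; linarith
  have hΛ0' : 0 < Λ' := by linarith
  have hKN : (K : ℝ) ≤ N := by exact_mod_cast h.batch_le
  have hK := h.batch_ge
  have hN1 : 0 < (N : ℝ) - 1 := by linarith
  have hN0 : (0 : ℝ) < N := by linarith
  rw [mul_assoc, h.weight_mul_shift]
  have hq : Real.log (1 / level ε δ) / (√(T : ℝ) * Λ') ≤ 1 / √(T : ℝ) := by
    rw [div_le_div_iff₀ (by positivity) (by positivity)]
    nlinarith
  have he := h.exp_eighth_le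
  unfold tilt
  split_ifs with hc
  · have e1 : Real.exp (ε / 16 * 2) ≤ 1032 / 1000 := by
      refine (Real.exp_le_exp.2 (by linarith : ε / 16 * 2 ≤ 1 / 32)).trans ?_
      have := Real.exp_bound' (x := 1 / 32) (by norm_num) (by norm_num) (n := 3) (by norm_num)
      norm_num [Finset.sum_range_succ, Nat.factorial] at this ⊢
      linarith
    have e2 : Real.log (1 / level ε δ) / (√(T : ℝ) * Λ') ≤ 1 :=
      hq.trans (by rw [div_le_one (by linarith)]; exact hR)
    calc 1011 / 1000 * (88 / 75 * Real.exp (ε / 16 * 2) * ((N : ℝ) / (N - 1)) *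
          (Real.log (1 / level ε δ) / (√(T : ℝ) * Λ')))
        ≤ 1011 / 1000 * (88 / 75 * (1032 / 1000) * (1001 / 1000) * 1) := by gcongr
      _ ≤ _ := by norm_num
  · have e1 : Real.exp (ε / 16 * 2) ≤ 7 / 2 := he.trans (by linarith [h.eps_le])
    have hR' := h.sqrt_steps_ge (by linarith)
    have e2 : Real.log (1 / level ε δ) / (√(T : ℝ) * Λ') ≤ 1 / 450 :=
      hq.trans (one_div_le_one_div_of_le (by norm_num) hR')
    calc 1011 / 1000 * (88 / 75 * Real.exp (ε / 16 * 2) * ((N : ℝ) / (N - 1)) *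
          (Real.log (1 / level ε δ) / (√(T : ℝ) * Λ')))
        ≤ 1011 / 1000 * (88 / 75 * (7 / 2) * (1001 / 1000) * (1 / 450)) := by gcongr
      _ ≤ _ := by norm_num

end PhaseBounds

/-! ### The privacy budget of one phase -/

namespace PhaseBounds

variable {N K T : ℕ} {ε δ Λ Λ' τ σ : ℝ}

lemma tilt_le_two (ε : ℝ) : tilt ε ≤ 2 := by unfold tilt; split_ifs <;> norm_num

lemma shift_le (h : PhaseBounds N K T ε δ Λ Λ') : shift N K T ε Λ' ≤ 1 / 1000 := by
  obtain ⟨h0, h1, -⟩ := h.shift_bounds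
  have hl := h.log_pos
  have hL := h.log_ge
  have hΛ := h.log_le
  have hΛ' := h.log_le'
  have hε := h.eps_pos
  have h2 : Real.log (1 / δ) ≤ (Λ * Λ') ^ 2 := by
    have h3 : Λ * 1 ≤ Λ * Λ' := mul_le_mul_of_nonneg_left (by linarith) (by linarith)
    nlinarith
  have h3 : (0 : ℝ) < (Λ * Λ') ^ 2 := by
    have : 0 < Λ := by linarith
    have : 0 < Λ' := by linarith
    positivity
  have h4 : shift N K T ε Λ' ^ 2 * 625000000 ≤ 1 := by
    refine le_of_mul_le_mul_right ?_ h3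
    linarith
  nlinarith

/-- The probability that a bad minibatch passes. -/
def badPass (K : ℕ) (ε : ℝ) : ℝ := 1 / 2 * Real.exp (-(ε / 16 * (7 / 200 * K)))

lemma stepRegime (h : PhaseBounds N K T ε δ Λ Λ') (hτ : 0 < τ)
    (hσ : σ = 1000 * τ * √(T : ℝ) * Λ' / (ε * N)) :
    StepRegime K N (ε / 16) τ σ (shift N K T ε Λ') (weight N K ε δ) (tilt ε) (offset N)
      (badPass K ε) := by
  have hε := h.eps_pos
  have hK := h.batch_ge
  have hl := h.log_pos
  have hL := h.log_ge
  have hΛ' := h.log_le'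
  have hKN : (K : ℝ) ≤ N := by exact_mod_cast h.batch_le
  have hN0 : (0 : ℝ) < N := by linarith
  have hK0 : (0 : ℝ) < K := by linarith
  have hΛ0' : 0 < Λ' := by linarith
  have hT : (1 : ℝ) ≤ T := by exact_mod_cast h.steps_pos
  have hR : 0 < √(T : ℝ) := Real.sqrt_pos.2 (by linarith)
  have hσ0 : 0 < σ := by rw [hσ]; positivity
  refine ⟨⟨?_, hτ.le, hσ0, h.shift_bounds.1, h.shift_le, le_of_eq ?_,
    div_pos h.rate_pos h.deficit_pos, h.tilt_bound, tilt_le_two ε⟩, ?_, by positivity,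
    by unfold offset; positivity, h.transport_bound, le_rfl⟩
  · have : (200 : ℝ) ≤ K := by linarith
    exact_mod_cast this
  -- The shift is defined so that 20τ/K = aσ holds with equality.
  · rw [hσ, shift]
    field_simp
    norm_num
  · have : (2 : ℝ) ≤ N := by linarith
    exact_mod_cast this

/-- In closed form K and T cancel and the factor ℓ/Λ'² remains, with ℓ = log(1/level). It is small
because Λ' exceeds ℓ by a fixed gap. -/
lemma total_rate_le (h : PhaseBounds N K T ε δ Λ Λ') :
    K * (T * stepRate N (ε / 16) (shift N K T ε Λ') (weight N K ε δ) (tilt ε)) ≤ 7 / 40 * ε := by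
  have hε := h.eps_pos
  have hε10 := h.eps_le
  have hK := h.batch_ge
  have hl := h.log_pos
  have h8 := log_eight_le
  have hKN : (K : ℝ) ≤ N := by exact_mod_cast h.batch_le
  have hN0 : (0 : ℝ) < N := by linarith
  have hN1 : (0 : ℝ) < (N : ℝ) - 1 := by linarith
  have hK0 : (0 : ℝ) < K := by linarith
  have hB := h.log_level_le
  have hr := h.ratio_le
  set ℓ := Real.log (1 / level ε δ) with hℓ
  have hℓ0 : 0 < ℓ := by rw [hℓ, h.log_level]; linarith
  have hΛ0' : 0 < Λ' := by linarith
  have hT : (1 : ℝ) ≤ T := by exact_mod_cast h.steps_pos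
  have hR : 0 < √(T : ℝ) := Real.sqrt_pos.2 (by linarith)
  have hR2 : √(T : ℝ) ^ 2 = T := Real.sq_sqrt (by linarith)
  have hν := h.deficit_pos
  have hθ := h.rate_pos
  have hE := Real.exp_pos (ε / 16 * 2)
  set E := Real.exp (ε / 16 * 2) with hEdef
  set C := shiftConst (tilt ε) with hC
  have hC0 : 0 ≤ C := le_trans (by positivity) (shiftConst_ge _)
  have key : K * (T * stepRate N (ε / 16) (shift N K T ε Λ') (weight N K ε δ) (tilt ε)) =
      33 / 8 * C * (3 / 10 * ε) * ((88 / 75) ^ 2 * E ^ 2 * ((N : ℝ) / (N - 1)) ^ 2) * (ℓ / Λ' ^ 2) := by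
    have e1 : stepRate N (ε / 16) (shift N K T ε Λ') (weight N K ε δ) (tilt ε) =
        33 / 8 * C * deficit K ε δ * (weight N K ε δ * shift N K T ε Λ') ^ 2 := by
      have : rate N ε = deficit K ε δ * weight N K ε δ := by rw [weight]; field_simp
      rw [stepRate]
      change rate N ε * _ = _
      rw [this]
      ring
    have e2 : deficit K ε δ = 3 / 10 * ε / (K * ℓ) := rfl
    rw [e1, h.weight_mul_shift, e2, ← hℓ, ← hEdef]
    generalize √(T : ℝ) = R at hR hR2
    rw [← hR2]
    clear_value E
    field_simp
  rw [key]
  -- Arithmetic–geometric mean: (ℓ + g)² ≥ 4ℓg for the gap g of `log_level_le`.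
  have hq : ℓ / Λ' ^ 2 ≤ 1 / (4 * (49 / 10 + 21 / 40 * ε)) := by
    rw [div_le_div_iff₀ (by positivity) (by positivity)]
    nlinarith [sq_nonneg (ℓ - (49 / 10 + 21 / 40 * ε))]
  have hr2 : ((N : ℝ) / (N - 1)) ^ 2 ≤ (1001 / 1000) ^ 2 := pow_le_pow_left₀ (by positivity) hr 2
  have hE2 : E ^ 2 = Real.exp (ε / 4) := by rw [hEdef, ← Real.exp_nat_mul]; congr 1; push_cast; ring
  -- For small ε the exponential is near one and the larger tilt constant is affordable. For large ε
  -- the small tilt constant pays for the growth of exp(ε/4). Both bounds are linear in ε by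
  -- convexity.
  have hmain : C * E ^ 2 ≤ 173 / 100 * (1 + 3 / 25 * ε) := by
    rw [hE2, hC]
    unfold tilt
    split_ifs with hc
    · have e1 : Real.exp (ε / 4) ≤ 1 + 3 / 10 * ε := by
        have h1 : Real.exp (1 / 16) ≤ 107 / 100 := by
          have := Real.exp_bound' (x := 1 / 16) (by norm_num) (by norm_num) (n := 3) (by norm_num)
          norm_num [Finset.sum_range_succ, Nat.factorial] at this ⊢
          linarith
        have h2 := exp_le_chord (x := ε / 4) (y := 1 / 16) (by norm_num) (by positivity) (by linarith)
        have h3 : ε / 4 / (1 / 16) * (Real.exp (1 / 16) - 1) ≤ ε / 4 / (1 / 16) * (7 / 100) :=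
          mul_le_mul_of_nonneg_left (by linarith) (by positivity)
        linarith
      calc _ ≤ 153 / 100 * (1 + 3 / 10 * ε) :=
            mul_le_mul shiftConst_of_large e1 (Real.exp_pos _).le (by norm_num)
        _ ≤ _ := by linarith
    · have e1 : Real.exp (ε / 4) ≤ 1 + 23 / 20 * ε := by
        have h1 : Real.exp (5 / 2) ≤ 25 / 2 :=
          exp_le_of_pow_le (p := 2) (k := 5) (by norm_num) (by norm_num) (by norm_num) (by norm_num)
        have h2 := exp_le_chord (x := ε / 4) (y := 5 / 2) (by norm_num) (by positivity) (by linarith)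
        have h3 : ε / 4 / (5 / 2) * (Real.exp (5 / 2) - 1) ≤ ε / 4 / (5 / 2) * (23 / 2) :=
          mul_le_mul_of_nonneg_left (by linarith) (by positivity)
        linarith
      calc _ ≤ 27 / 100 * (1 + 23 / 20 * ε) :=
            mul_le_mul shiftConst_of_small e1 (Real.exp_pos _).le (by norm_num)
        _ ≤ _ := by linarith
  calc 33 / 8 * C * (3 / 10 * ε) * ((88 / 75) ^ 2 * E ^ 2 * ((N : ℝ) / (N - 1)) ^ 2) * (ℓ / Λ' ^ 2)
      = 33 / 8 * (3 / 10 * ε) * (88 / 75) ^ 2 * (C * E ^ 2) * ((N : ℝ) / (N - 1)) ^ 2 * (ℓ / Λ' ^ 2) := by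
        ring
    _ ≤ 33 / 8 * (3 / 10 * ε) * (88 / 75) ^ 2 * (173 / 100 * (1 + 3 / 25 * ε)) * (1001 / 1000) ^ 2 *
          (1 / (4 * (49 / 10 + 21 / 40 * ε))) := by gcongr
    _ ≤ 7 / 40 * ε := by
        rw [mul_one_div, div_le_iff₀ (by positivity)]
        nlinarith

/-- The exponent of the power means. -/
def power (K : ℕ) (ε δ : ℝ) : ℝ := 1 / (1 - deficit K ε δ)

lemma deficit_lt_one (h : PhaseBounds N K T ε δ Λ Λ') : deficit K ε δ ≤ 1 / 100 := by
  have h1 := h.deficit_le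
  have h2 := h.batch_ge
  have h3 := h.deficit_pos
  nlinarith

lemma one_sub_one_div_power (K : ℕ) (ε δ : ℝ) :
    1 - 1 / power K ε δ = deficit K ε δ := by
  rw [power, one_div_one_div]
  ring

lemma one_le_power (h : PhaseBounds N K T ε δ Λ Λ') : 1 ≤ power K ε δ := by
  have h1 := h.deficit_lt_one
  have h3 := h.deficit_pos
  rw [power, le_div_iff₀ (by linarith)]
  linarith

lemma level_pos (h : PhaseBounds N K T ε δ Λ Λ') : 0 < level ε δ := by
  have := h.delta_pos
  unfold level
  positivity

lemma level_le_one (h : PhaseBounds N K T ε δ Λ Λ') : level ε δ ≤ 1 := by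
  have h1 := h.delta_pos
  have h2 := h.delta_lt
  have h3 : Real.exp (-(19 / 40 * ε)) ≤ 1 := Real.exp_le_one_iff.2 (by linarith [h.eps_pos])
  unfold level
  nlinarith [Real.exp_pos (-(19 / 40 * ε))]

/-- The total multiplicative loss of the hybrid argument. -/
def growth (N K T : ℕ) (ε δ Λ' : ℝ) : ℝ :=
  ((1 + stepRate N (ε / 16) (shift N K T ε Λ') (weight N K ε δ) (tilt ε)) ^ T *
    Real.exp ((1 - 1 / power K ε δ) * Real.log (1 / level ε δ))) ^ K

/-- Second-order losses contribute at most 7ε/40. The returns from power means contribute K ·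
deficit · log(1/level) = 3ε/10. -/
lemma growth_le (h : PhaseBounds N K T ε δ Λ Λ') : growth N K T ε δ Λ' ≤ Real.exp (19 / 40 * ε) := by
  have hρ := h.total_rate_le
  have hK := h.batch_ge
  have hl := h.log_pos
  have h8 := log_eight_le
  have hN : 2 ≤ N := by
    have : (2 : ℝ) ≤ N := by
      have hKN : (K : ℝ) ≤ N := by exact_mod_cast h.batch_le
      linarith
    exact_mod_cast this
  have hρ0 : 0 ≤ stepRate N (ε / 16) (shift N K T ε Λ') (weight N K ε δ) (tilt ε) :=
    stepRate_nonneg hN (div_pos h.rate_pos h.deficit_pos)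
  unfold growth
  set ρ := stepRate N (ε / 16) (shift N K T ε Λ') (weight N K ε δ) (tilt ε)
  have h1 : (1 + ρ) ^ T ≤ Real.exp (T * ρ) := by
    rw [Real.exp_nat_mul]
    exact pow_le_pow_left₀ (by linarith) (by linarith [Real.add_one_le_exp ρ]) T
  have hℓ0 : 0 < Real.log (1 / level ε δ) := by rw [h.log_level]; linarith [h.eps_pos]
  have h2 : K * (deficit K ε δ * Real.log (1 / level ε δ)) = 3 / 10 * ε := by
    rw [deficit]; field_simp
  rw [one_sub_one_div_power]
  calc _ ≤ (Real.exp (T * ρ) * Real.exp (deficit K ε δ * Real.log (1 / level ε δ))) ^ K := by gcongr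
    _ = Real.exp (K * (T * ρ) + K * (deficit K ε δ * Real.log (1 / level ε δ))) := by
        rw [← Real.exp_add, ← Real.exp_nat_mul, mul_add]
    _ ≤ _ := Real.exp_le_exp.2 (by rw [h2]; linarith)

lemma exp_neg_log_le (h : PhaseBounds N K T ε δ Λ Λ') {x : ℝ} (hx : Λ ≤ x) :
    Real.exp (-x) ≤ δ * Real.exp (-(14 + ε)) := by
  have hL := h.log_ge
  have hΛ := h.log_le
  have hδ := h.delta_pos
  have e : δ * Real.exp (-(14 + ε)) = Real.exp (-(14 + ε + Real.log (1 / δ))) := by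
    have e2 : -(14 + ε + Real.log (1 / δ)) = Real.log δ + -(14 + ε) := by
      rw [one_div, Real.log_inv]; ring
    rw [e2, Real.exp_add, Real.exp_log hδ]
  rw [e]
  exact Real.exp_le_exp.2 (by linarith)

/-- T is not bounded by the other parameters, but a large T makes the shift small and the Gaussian
tail exponent x large. The second part of `shift_bounds` gives 3T ≤ xN², so half of the available
decay e^(-x/2) pays for T and the rest for N³ ≥ K N². -/
lemma tail_le (h : PhaseBounds N K T ε δ Λ Λ') :
    K * T * Real.exp (-(1 / (20000 * shift N K T ε Λ' ^ 2) / 2)) ≤ Real.exp (-(20 * Λ)) := by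
  obtain ⟨h0, h1, h2⟩ := h.shift_bounds
  have hl := h.log_pos
  have hL := h.log_ge
  have hΛ := h.log_le
  have hΛ' := h.log_le'
  have hε := h.eps_pos
  have hε10 := h.eps_le
  have hK := h.batch_ge
  have hKN : (K : ℝ) ≤ N := by exact_mod_cast h.batch_le
  have hN0 : (0 : ℝ) < N := by linarith
  have hT : (1 : ℝ) ≤ T := by exact_mod_cast h.steps_pos
  set a := shift N K T ε Λ' with ha
  set x := 1 / (20000 * a ^ 2) with hx
  have ha2 : 0 < a ^ 2 := by positivity
  have hxa : x * a ^ 2 = 1 / 20000 := by rw [hx]; field_simp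
  have hx0 : 0 < x := by rw [hx]; positivity
  have hΛ14 : 14 ≤ Λ := by linarith
  have hΛ7 : 7 ≤ Λ' := by linarith
  set W := Λ * Λ' with hW
  have hWΛ : 7 * Λ ≤ W := by nlinarith
  have hlW : Real.log (1 / δ) ≤ W := by linarith
  -- From the bound on the shift that is uniform in T: x is 1/(20000a²), and 625000000/20000 =
  -- 31250.
  have k1 : 31250 * W ≤ x := by
    have e1 : x * (a ^ 2 * (625000000 * W ^ 2)) ≤ x * W :=
      mul_le_mul_of_nonneg_left (h1.trans hlW) hx0.le
    have e2 : x * (a ^ 2 * (625000000 * W ^ 2)) = 31250 * W * W := by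
      rw [← mul_assoc, hxa]; ring
    rw [e2] at e1
    exact le_of_mul_le_mul_right e1 (by linarith)
  have k2 : 3 * (T : ℝ) ≤ x * N ^ 2 := by
    have e0 : ε ^ 4 ≤ 10 ^ 4 := pow_le_pow_left₀ hε.le hε10 4
    have e1 : x * (a ^ 2 * (625000000 * W ^ 2 * T)) ≤ x * (10 ^ 4 * N ^ 2) :=
      mul_le_mul_of_nonneg_left (h2.trans (by gcongr)) hx0.le
    have e2 : x * (a ^ 2 * (625000000 * W ^ 2 * T)) = 31250 * W ^ 2 * T := by
      rw [← mul_assoc, hxa]; ring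
    rw [e2] at e1
    have e3 : 1 * (T : ℝ) ≤ W ^ 2 * T := mul_le_mul_of_nonneg_right (by nlinarith) (by linarith)
    nlinarith
  have k3 : (T : ℝ) ≤ N ^ 2 * Real.exp (x / 4) := by
    have e1 : (T : ℝ) / N ^ 2 ≤ x / 3 := by
      rw [div_le_iff₀ (by positivity)]; linarith
    have e2 : x / 4 + 1 ≤ Real.exp (x / 4) := Real.add_one_le_exp _
    have e3 : (T : ℝ) / N ^ 2 ≤ Real.exp (x / 4) + Real.exp (x / 4) / 3 := by linarith
    by_cases hc : (T : ℝ) ≤ N ^ 2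
    · have : (1 : ℝ) ≤ Real.exp (x / 4) := Real.one_le_exp (by positivity)
      nlinarith [sq_nonneg (N : ℝ)]
    · have e4 : x / 3 ≤ Real.exp (x / 4) := by
        have := Real.quadratic_le_exp_of_nonneg (x := x / 4) (by positivity)
        have h5 : 14 ≤ x := by linarith
        nlinarith
      have := (e1.trans e4)
      rw [div_le_iff₀ (by positivity)] at this
      linarith
  have hN3 : (N : ℝ) ^ 3 ≤ Real.exp (2 * Λ) := by
    have : (N : ℝ) = Real.exp (Real.log N) := (Real.exp_log hN0).symm
    rw [this, ← Real.exp_nat_mul]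
    exact Real.exp_le_exp.2 (by push_cast; linarith)
  calc K * T * Real.exp (-(x / 2)) ≤ N * (N ^ 2 * Real.exp (x / 4)) * Real.exp (-(x / 2)) := by gcongr
    _ = N ^ 3 * Real.exp (-(x / 4)) := by
        have : Real.exp (-(x / 2)) = Real.exp (-(x / 4)) * Real.exp (-(x / 4)) := by
          rw [← Real.exp_add]; congr 1; ring
        have e5 : Real.exp (x / 4) * Real.exp (-(x / 4)) = 1 := by
          rw [← Real.exp_add]; simp
        rw [this]
        linear_combination (N ^ 3 * Real.exp (-(x / 4))) * e5
    _ ≤ Real.exp (2 * Λ) * Real.exp (-(x / 4)) := by gcongr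
    _ = Real.exp (2 * Λ - x / 4) := by rw [← Real.exp_add]; congr 1
    _ ≤ _ := Real.exp_le_exp.2 (by linarith)

lemma tailBound_shift_le_one (h : PhaseBounds N K T ε δ Λ Λ') :
    tailBound (shift N K T ε Λ') ≤ 1 := by
  obtain ⟨h0, -, -⟩ := h.shift_bounds
  have h1 := h.shift_le
  have h2 : (2 : ℝ) ≤ 1 / (20000 * shift N K T ε Λ' ^ 2) := by
    rw [le_div_iff₀ (by positivity)]
    nlinarith
  have h3 : Real.exp (-(1 / (20000 * shift N K T ε Λ' ^ 2))) ≤ 1 / 3 := by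
    rw [Real.exp_neg, ← one_div]
    exact one_div_le_one_div_of_le (by norm_num) (by linarith [Real.add_one_le_exp (1 / (20000 * shift N K T ε Λ' ^ 2))])
  unfold tailBound
  linarith

lemma rate_le (h : PhaseBounds N K T ε δ Λ Λ') : rate N ε ≤ 6 / 100 := by
  have hKN : (K : ℝ) ≤ N := by exact_mod_cast h.batch_le
  have hK := h.batch_ge
  have he := h.exp_eighth_le
  have hε := h.eps_le
  rw [rate, div_le_iff₀ (by linarith)]
  linarith

lemma stepSlack_le (h : PhaseBounds N K T ε δ Λ Λ') {a x : ℝ} (ha : 0 < a)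
    (hx : x = 1 / (20000 * a ^ 2)) (hc1 : tailBound a ≤ 1) :
    stepSlack N (ε / 16) a (weight N K ε δ) (tailBound a) ≤ 2 / 5 * ((1 + x) * tailBound a) := by
  have hK := h.batch_ge
  have hνK := h.deficit_le
  have hν := h.deficit_pos
  have hθ := h.rate_le
  have hθ0 := h.rate_pos
  have hx0 : 0 < x := by rw [hx]; positivity
  have hc0 := tailBound_pos a
  have hcx : tailBound a = 3 * Real.exp (-x) := by rw [hx]; rfl
  have e0 : rate N ε * (1 / weight N K ε δ) = deficit K ε δ := by
    rw [weight]; field_simp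
  have e1 : Real.log (1 / tailBound a) ≤ x := by
    rw [one_div, Real.log_inv, hcx, Real.log_mul (by norm_num) (Real.exp_pos _).ne', Real.log_exp]
    have : 0 ≤ Real.log 3 := Real.log_nonneg (by norm_num)
    linarith
  have e2 : 1 / 100 ≤ Real.exp (1 / 100) - 1 := by
    have := Real.add_one_le_exp (1 / 100 : ℝ); linarith
  have e3 : (1 + Real.log (1 / tailBound a)) * tailBound a / (Real.exp (1 / 100) - 1) ≤
      100 * ((1 + x) * tailBound a) := by
    rw [div_le_iff₀ (by linarith)]
    have f1 : (1 + Real.log (1 / tailBound a)) * tailBound a ≤ (1 + x) * tailBound a := by gcongr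
    have f2 : 0 ≤ (1 + x) * tailBound a := by positivity
    nlinarith
  have e4 : deficit K ε δ ≤ 15 / 10000 := by nlinarith
  have e5 : stepSlack N (ε / 16) a (weight N K ε δ) (tailBound a) =
      deficit K ε δ * ((1 + Real.log (1 / tailBound a)) * tailBound a / (Real.exp (1 / 100) - 1)) +
        4 * rate N ε * tailBound a := by
    rw [← e0, stepSlack]
    change rate N ε * _ = _
    ring
  rw [e5]
  have e6 := mul_le_mul e4 e3 (by
    have : 0 ≤ Real.log (1 / tailBound a) :=
      Real.log_nonneg (by rw [le_div_iff₀ hc0]; linarith)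
    have : 0 < Real.exp (1 / 100) - 1 := by linarith
    positivity) (by norm_num)
  have e7 : 4 * rate N ε * tailBound a ≤ 24 / 100 * tailBound a := by gcongr; linarith
  have e8 : tailBound a ≤ (1 + x) * tailBound a := by nlinarith
  linarith

/-- The floor c₀ is the tail bound 3e^(-x) itself. Then log(1/c₀) ≤ x, and the polynomial factor 1 +
x costs only half of the exponent. -/
lemma per_step_le (h : PhaseBounds N K T ε δ Λ Λ') {a x ρ : ℝ} (ha : 0 < a)
    (hx : x = 1 / (20000 * a ^ 2)) (hc1 : tailBound a ≤ 1) (hρ1 : ρ ≤ 1) :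
    (1 + ρ) * tailBound a + stepSlack N (ε / 16) a (weight N K ε δ) (tailBound a) ≤
      15 * Real.exp (-(x / 2)) := by
  have hslack := h.stepSlack_le ha hx hc1
  have hx0 : 0 < x := by rw [hx]; positivity
  have hc0 := tailBound_pos a
  have hcx : tailBound a = 3 * Real.exp (-x) := by rw [hx]; rfl
  have e1 : (1 + ρ) * tailBound a ≤
      2 * ((1 + x) * tailBound a) := by
    have : tailBound a ≤ (1 + x) * tailBound a := by nlinarith
    calc _ ≤ 2 * tailBound a := by gcongr; linarith
      _ ≤ _ := by linarith
  have e2 : 1 + x ≤ 2 * Real.exp (x / 2) := by linarith [Real.add_one_le_exp (x / 2)]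
  have e3 : (1 + x) * tailBound a ≤ 6 * Real.exp (-(x / 2)) := by
    rw [hcx]
    have e4 : Real.exp (-(x / 2)) = Real.exp (x / 2) * Real.exp (-x) := by
      rw [← Real.exp_add]; congr 1; ring
    rw [e4]
    have := mul_le_mul_of_nonneg_right e2 (Real.exp_pos (-x)).le
    linarith
  have := Real.exp_pos (-(x / 2))
  linarith

/-- Four sources: the level (δ/8, since `level` contains the inverse of the growth), the Laplace
tail of the threshold, bad minibatches that pass, and atypical Gaussian directions. The last three
are exponentially small in Λ, which dominates log(1/δ). -/
lemma slack_le (h : PhaseBounds N K T ε δ Λ Λ') :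
    growth N K T ε δ Λ' * (level ε δ + K * runSlack N (ε / 16) (shift N K T ε Λ') (weight N K ε δ)
      (tilt ε) (badPass K ε) (tailBound (shift N K T ε Λ')) T) +
      1 / 2 * Real.exp (-(1 / (8 / ε) * (K / 50))) ≤ δ / 2 := by
  have hG := h.growth_le
  have hε := h.eps_pos
  have hε10 := h.eps_le
  have hδ := h.delta_pos
  have hK := h.batch_ge
  have hL := h.log_ge
  have hl := h.log_pos
  have hΛ := h.log_le
  have hKN : (K : ℝ) ≤ N := by exact_mod_cast h.batch_le
  have hN0 : (0 : ℝ) < N := by linarith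
  have hN1 : (0 : ℝ) < (N : ℝ) - 1 := by linarith
  have hT : (1 : ℝ) ≤ T := by exact_mod_cast h.steps_pos
  have hN2 : 2 ≤ N := by
    have : (2 : ℝ) ≤ N := by linarith
    exact_mod_cast this
  have hA : 0 < weight N K ε δ := div_pos h.rate_pos h.deficit_pos
  have htail := h.tail_le
  have hc1 := h.tailBound_shift_le_one
  have hνK := h.deficit_le
  have hν := h.deficit_pos
  have hθ := h.rate_le
  have hθ0 := h.rate_pos
  obtain ⟨ha0, -, -⟩ := h.shift_bounds
  have hρ0 : 0 ≤ stepRate N (ε / 16) (shift N K T ε Λ') (weight N K ε δ) (tilt ε) :=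
    stepRate_nonneg hN2 hA
  have hρ1 : stepRate N (ε / 16) (shift N K T ε Λ') (weight N K ε δ) (tilt ε) ≤ 1 := by
    have h1 := h.total_rate_le
    set ρ := stepRate N (ε / 16) (shift N K T ε Λ') (weight N K ε δ) (tilt ε)
    have h2 : 1120 * (1 * ρ) ≤ K * (T * ρ) := by gcongr
    linarith
  have hb : 500 * Λ ≤ K * ε := by
    have := h.le_batch
    rwa [div_le_iff₀ hε] at this
  set a := shift N K T ε Λ' with ha
  set x := 1 / (20000 * a ^ 2) with hx
  have hx0 : 0 < x := by rw [hx]; positivity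
  have hc0 := tailBound_pos a
  have hcx : tailBound a = 3 * Real.exp (-x) := rfl
  have hper := h.per_step_le ha0 hx hc1 hρ1
  have hδs : Real.exp (-Λ) ≤ δ * Real.exp (-(14 + ε)) := h.exp_neg_log_le le_rfl
  have h14 : ∀ y : ℝ, y ≤ 0 → Real.exp (-14 + y) ≤ 1 / 1000 := by
    intro y hy
    have e1 : Real.exp (-14 + y) ≤ Real.exp (-14) := Real.exp_le_exp.2 (by linarith)
    have e2 : Real.exp (-14) ≤ 1 / 1000 := by
      rw [Real.exp_neg, ← one_div]
      refine one_div_le_one_div_of_le (by norm_num) ?_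
      have := Real.quadratic_le_exp_of_nonneg (x := 7) (by norm_num)
      have e3 : Real.exp 14 = Real.exp 7 * Real.exp 7 := by rw [← Real.exp_add]; norm_num
      rw [e3]
      nlinarith
    linarith
  have hG0 : 0 ≤ growth N K T ε δ Λ' := by unfold growth; positivity
  have p1 : growth N K T ε δ Λ' * level ε δ ≤ δ / 8 := by
    calc _ ≤ Real.exp (19 / 40 * ε) * level ε δ :=
          mul_le_mul_of_nonneg_right hG h.level_pos.le
      _ = δ / 8 := by
          rw [level]
          have : Real.exp (19 / 40 * ε) * Real.exp (-(19 / 40 * ε)) = 1 := by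
            rw [← Real.exp_add]; simp
          linear_combination (δ / 8) * this
  have p2 : 1 / 2 * Real.exp (-(1 / (8 / ε) * (K / 50))) ≤ δ / 1000 := by
    have e1 : Real.exp (-(1 / (8 / ε) * (K / 50))) ≤ Real.exp (-Λ) := by
      refine Real.exp_le_exp.2 (neg_le_neg ?_)
      rw [one_div_div]
      have : ε / 8 * (K / 50) = K * ε / 400 := by ring
      rw [this]
      linarith
    have e2 := h14 (-ε) (by linarith)
    have e3 : Real.exp (-(14 + ε)) = Real.exp (-14 + -ε) := by congr 1; ring
    rw [e3] at hδs
    nlinarith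
  have p3 : growth N K T ε δ Λ' * (K * (2 * Real.exp (ε / 16 * 2) * badPass K ε / ((N : ℝ) - 1))) ≤
      δ / 100 := by
    have e1 : badPass K ε ≤ 1 / 2 * Real.exp (-Λ) := by
      unfold badPass
      have : Real.exp (-(ε / 16 * (7 / 200 * K))) ≤ Real.exp (-Λ) := by
        refine Real.exp_le_exp.2 (neg_le_neg ?_)
        have : ε / 16 * (7 / 200 * K) = 7 / 3200 * (K * ε) := by ring
        rw [this]
        linarith
      linarith
    have e2 : (K : ℝ) / (N - 1) ≤ 2 := by
      rw [div_le_iff₀ hN1]; linarith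
    calc growth N K T ε δ Λ' * (K * (2 * Real.exp (ε / 16 * 2) * badPass K ε / ((N : ℝ) - 1)))
        = growth N K T ε δ Λ' * Real.exp (ε / 16 * 2) * (2 * badPass K ε) * (K / (N - 1)) := by ring
      _ ≤ Real.exp (19 / 40 * ε) * Real.exp (ε / 16 * 2) *
            (2 * (1 / 2 * (δ * Real.exp (-(14 + ε))))) * 2 := by
          have : 0 ≤ badPass K ε := by unfold badPass; positivity
          have e3 : badPass K ε ≤ 1 / 2 * (δ * Real.exp (-(14 + ε))) := by linarith
          gcongr
      _ = 2 * δ * (Real.exp (19 / 40 * ε) * Real.exp (ε / 16 * 2) * Real.exp (-(14 + ε))) := by ring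
      _ = 2 * δ * Real.exp (-14 + -(2 / 5 * ε)) := by
          rw [← Real.exp_add, ← Real.exp_add]; congr 2; ring
      _ ≤ 2 * δ * (1 / 1000) := by
          have := h14 (-(2 / 5 * ε)) (by linarith)
          gcongr
      _ ≤ _ := by linarith
  have p4 : growth N K T ε δ Λ' * (K * (T * ((1 + stepRate N (ε / 16) a (weight N K ε δ) (tilt ε)) *
      tailBound a + stepSlack N (ε / 16) a (weight N K ε δ) (tailBound a)))) ≤ δ / 50 := by
    have e0 : 0 ≤ stepSlack N (ε / 16) a (weight N K ε δ) (tailBound a) :=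
      stepSlack_nonneg hN2 hA hc0 hc1
    calc _ ≤ Real.exp (19 / 40 * ε) * (K * (T * (15 * Real.exp (-(x / 2))))) := by
          gcongr
      _ = 15 * Real.exp (19 / 40 * ε) * (K * T * Real.exp (-(x / 2))) := by ring
      _ ≤ 15 * Real.exp (19 / 40 * ε) * Real.exp (-(20 * Λ)) := by gcongr
      _ ≤ 15 * Real.exp (19 / 40 * ε) * (δ * Real.exp (-(14 + ε))) := by
          have := h.exp_neg_log_le (x := 20 * Λ) (by linarith)
          gcongr
      _ = 15 * δ * (Real.exp (19 / 40 * ε) * Real.exp (-(14 + ε))) := by ring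
      _ = 15 * δ * Real.exp (-14 + -(21 / 40 * ε)) := by
          rw [← Real.exp_add]; congr 2; ring
      _ ≤ 15 * δ * (1 / 1000) := by
          have := h14 (-(21 / 40 * ε)) (by linarith)
          gcongr
      _ ≤ _ := by linarith
  have e : growth N K T ε δ Λ' * (level ε δ + K * runSlack N (ε / 16) a (weight N K ε δ)
      (tilt ε) (badPass K ε) (tailBound a) T) = growth N K T ε δ Λ' * level ε δ +
      growth N K T ε δ Λ' * (K * (T * ((1 + stepRate N (ε / 16) a (weight N K ε δ) (tilt ε)) *
      tailBound a + stepSlack N (ε / 16) a (weight N K ε δ) (tailBound a)))) +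
      growth N K T ε δ Λ' * (K * (2 * Real.exp (ε / 16 * 2) * badPass K ε / ((N : ℝ) - 1))) := by
    rw [runSlack]; ring
  rw [e]
  linarith

/-- Privacy of one phase for a test function that is `0` or `1` on the halted runs. -/
lemma integral_runMean_le (h : PhaseBounds N K T ε δ Λ Λ') (hτ : 0 < τ)
    (hσ : σ = 1000 * τ * √(T : ℝ) * Λ' / (ε * N)) {St : Type*} [MeasurableSpace St] {d : ℕ}
    {q q' : ℕ → St → Fin N → Vec d} {next : ℕ → St → Vec d → St} {f : St → ℝ} {b : ℝ} {u : Fin N}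
    (hqm : ∀ t v, Measurable fun z => q t z v) (hqm' : ∀ t v, Measurable fun z => q' t z v)
    (hnext : ∀ t, Measurable (Function.uncurry (next t)))
    (hf : Measurable f) (hf0 : ∀ w, 0 ≤ f w) (hf1 : ∀ w, f w ≤ 1)
    (hq : ∀ t z v, v ≠ u → q t z v = q' t z v) (hb : b = 0 ∨ b = 1) (z : St) :
    ∫ ξ, runMean (ε / 16) τ σ (fun t z (_ : Fin K) v => q t z v) next ξ f b T 0 z ∂laplace (8 / ε) ≤
      Real.exp ε *
        ∫ ξ, runMean (ε / 16) τ σ (fun t z (_ : Fin K) v => q' t z v) next ξ f b T 0 z ∂laplace (8 / ε) +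
        δ / 2 := by
  have hε := h.eps_pos
  have hR := h.stepRegime hτ hσ
  have hK := h.batch_ge
  have hKN : (K : ℝ) ≤ N := by exact_mod_cast h.batch_le
  have hN0 : (0 : ℝ) < N := by linarith
  have hKs : (K : ℝ) * offset N ≤ 21 / 5 := by
    rw [offset, mul_div_assoc', div_le_iff₀ hN0]
    linarith
  have hs1 : K * offset N - K / 40 ≤ -((K : ℝ) / 50) := by linarith
  have hbA : 88 / 5 * Real.exp (ε / 16 * 2) / ((N : ℝ) - 1) * (1 / weight N K ε δ) =
      1 - 1 / power K ε δ := by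
    rw [one_sub_one_div_power, weight]
    change rate N ε * _ = _
    have := h.rate_pos
    have := h.deficit_pos
    field_simp
  have hmain := hR.integral_runMean_le h.one_le_power hbA (tailBound_pos _) h.tailBound_shift_le_one
    h.level_pos h.level_le_one hqm hqm' hnext hf hf0 hf1 hq hb (β := 8 / ε) (by positivity) hs1 T z
  change _ ≤ growth N K T ε δ Λ' * _ + _ at hmain
  have hsl := h.slack_le
  have hG := h.growth_le
  have hI : 0 ≤ ∫ ξ, runMean (ε / 16) τ σ (fun t z (_ : Fin K) v => q' t z v) next ξ f b T 0 z
      ∂laplace (8 / ε) := integral_nonneg fun ξ =>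
    (runMean_mem (by positivity) h.users_pos (fun t j v => hqm' t v) hnext hf hf0 hf1
      (by rcases hb with hh | hh <;> rw [hh]; norm_num)
      (by rcases hb with hh | hh <;> rw [hh]; norm_num) T 0 z).1
  set I := ∫ ξ, runMean (ε / 16) τ σ (fun t z (_ : Fin K) v => q' t z v) next ξ f b T 0 z
      ∂laplace (8 / ε)
  -- The hybrids use 19ε/40. The total threshold move of at most 21/5 against Laplace noise of scale
  -- 8/ε uses 21ε/40.
  have hE : growth N K T ε δ Λ' * Real.exp (K * offset N / (8 / ε)) ≤ Real.exp ε := by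
    calc _ ≤ Real.exp (19 / 40 * ε) * Real.exp (21 / 40 * ε) := by
          refine mul_le_mul hG (Real.exp_le_exp.2 ?_) (Real.exp_pos _).le (Real.exp_pos _).le
          rw [div_div_eq_mul_div]
          nlinarith
      _ = _ := by rw [← Real.exp_add]; congr 1; ring
  have := mul_le_mul_of_nonneg_right hE hI
  nlinarith

end PhaseBounds

/-! ### Measurability of optional values and of folds -/

section Option

variable {α β S : Type*} [MeasurableSpace α] [MeasurableSpace β] [MeasurableSpace S]

/-- The largest σ-algebra on `Option α` for which `some` is measurable. -/
instance : MeasurableSpace (Option α) := MeasurableSpace.map some inferInstance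

lemma measurable_some : Measurable (some : α → Option α) := fun _ hs => hs

lemma measurable_of_comp_some {g : Option α → β} (h : Measurable fun a => g (some a)) :
    Measurable g := fun _ hs => h hs

/-- Both `isSome` and `getD` are measurable for this σ-algebra, so a function on the product can be
defined by cases on the first coordinate. -/
lemma measurable_option_prod [Nonempty α] {G : Option α × S → β}
    (h0 : Measurable fun s => G (none, s)) (h1 : Measurable fun p : α × S => G (some p.1, p.2)) :
    Measurable G := by
  classical
  let a₀ : α := Classical.arbitrary α
  have hG : G = fun p => if p.1.isSome then G (some (p.1.getD a₀), p.2) else G (none, p.2) := by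
    funext ⟨o, s⟩
    cases o <;> rfl
  have hset : MeasurableSet {p : Option α × S | p.1.isSome} := by
    refine measurableSet_preimage (t := {o : Option α | o.isSome}) measurable_fst ?_
    change MeasurableSet (some ⁻¹' {o : Option α | o.isSome} : Set α)
    simp
  have hget : Measurable fun o : Option α => o.getD a₀ := measurable_of_comp_some measurable_id
  rw [hG]
  exact Measurable.ite hset
    (h1.comp ((hget.comp measurable_fst).prodMk measurable_snd)) (h0.comp measurable_snd)

lemma measurable_option_bind [Nonempty α] {G : S → α → Option β}
    (hG : Measurable fun p : α × S => G p.2 p.1) :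
    Measurable fun p : Option α × S => p.1.bind (G p.2) :=
  measurable_option_prod measurable_const hG

end Option

section Foldl

variable {A S : Type*} [MeasurableSpace A] [MeasurableSpace S]

lemma measurable_foldl {n : ℕ} {Ω : Fin n → Type*} [∀ i, MeasurableSpace (Ω i)]
    {F : ∀ i, S → A → Ω i → A} (hF : ∀ i, Measurable fun p : A × S × Ω i => F i p.2.1 p.1 p.2.2) :
    Measurable fun p : A × S × (∀ i, Ω i) =>
      Fin.foldl n (fun a i => F i p.2.1 a (p.2.2 i)) p.1 := by
  induction n with
  | zero => simpa using measurable_fst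
  | succ n ih =>
    simp only [Fin.foldl_succ]
    have h1 := ih (F := fun i => F i.succ) fun i => hF i.succ
    have h2 : Measurable fun p : A × S × (∀ i, Ω i) =>
        (F 0 p.2.1 p.1 (p.2.2 0), p.2.1, fun i : Fin n => p.2.2 i.succ) := by
      refine Measurable.prodMk ?_ (Measurable.prodMk (by fun_prop) ?_)
      · exact (hF 0).comp (measurable_fst.prodMk (Measurable.prodMk (by fun_prop)
          ((measurable_pi_apply 0).comp (by fun_prop))))
      · exact measurable_pi_lambda _ fun i => (measurable_pi_apply i.succ).comp (by fun_prop)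
    exact h1.comp h2

/-- The first step of a fold over independent seeds. -/
lemma lintegral_foldl_succ {n : ℕ} {Ω : Fin (n + 1) → Type*} [∀ i, MeasurableSpace (Ω i)]
    {μ : ∀ i, Measure (Ω i)} [∀ i, SigmaFinite (μ i)] {F : ∀ i, A → Ω i → A}
    (hF : ∀ i, Measurable (Function.uncurry (F i))) {h : A → ℝ≥0∞} (hh : Measurable h) (a : A) :
    ∫⁻ ω, h (Fin.foldl (n + 1) (fun a i => F i a (ω i)) a) ∂Measure.pi μ =
      ∫⁻ w, ∫⁻ ω, h (Fin.foldl n (fun a i => F i.succ a (ω i)) (F 0 a w))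
        ∂(Measure.pi fun i : Fin n => μ i.succ) ∂μ 0 := by
  have hmp := measurePreserving_piFinSuccAbove μ 0
  have hfold := measurable_foldl (S := Unit) (F := fun i (_ : Unit) => F i.succ) fun i =>
    (hF i.succ).comp (g := Function.uncurry (F i.succ))
      (measurable_fst.prodMk (measurable_snd.comp measurable_snd))
  have hG : Measurable fun p : Ω 0 × (∀ i : Fin n, Ω i.succ) =>
      h (Fin.foldl n (fun a i => F i.succ a (p.2 i)) (F 0 a p.1)) := by
    refine hh.comp (hfold.comp (g := fun p : A × Unit × (∀ i : Fin n, Ω i.succ) =>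
      Fin.foldl n (fun a i => F i.succ a (p.2.2 i)) p.1)
      (f := fun p : Ω 0 × (∀ i : Fin n, Ω i.succ) => (F 0 a p.1, (), p.2)) ?_)
    exact Measurable.prodMk ((hF 0).comp (measurable_const.prodMk measurable_fst)) (by fun_prop)
  have h1 := hmp.lintegral_comp (f := fun p : Ω 0 × (∀ i : Fin n, Ω (Fin.succAbove 0 i)) =>
      h (Fin.foldl n (fun a i => F i.succ a (p.2 i)) (F 0 a p.1))) hG
  simp only [Fin.foldl_succ]
  refine Eq.trans h1 ?_
  exact lintegral_prod _ hG.aemeasurable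

end Foldl

/-! ### The law of one step -/

section StepOut

variable {S St : Type*} [MeasurableSpace S] [MeasurableSpace St] {d K N : ℕ} {τ σ ξ ε : ℝ}

/-- The result of a step in terms of the gradients `q` of the users and the update `nx`. -/
def stepOut (τ ξ : ℝ) (q : Fin N → Vec d) (nx : Vec d → St) (seed : StepSeed d N K) : Option St :=
  if 4 * (K : ℝ) / 5 + ξ ≤ score (fun j => q (seed.1 j)) τ + seed.2.1 then
    some (nx (keptMean (fun j => q (seed.1 j)) τ seed.2.2.1 + seed.2.2.2))
  else none

lemma measurable_keptMean {g : S → Fin K → Vec d} (hg : ∀ j, Measurable fun s => g s j) (τ : ℝ)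
    {U : S → Fin K → ℝ} (hU : Measurable U) : Measurable fun s => keptMean (g s) τ (U s) := by
  classical
  have h : (fun s => keptMean (g s) τ (U s)) = fun s =>
      (1 / ∑ j, if U s j < keepProbs (g s) τ j then (1 : ℝ) else 0) •
        ∑ j, if U s j < keepProbs (g s) τ j then g s j else 0 := by
    funext s
    simp only [keptMean, kept, Finset.card_filter, Finset.sum_filter, keepProbs]
    push_cast
    congr
  have hs : ∀ j, MeasurableSet {s | U s j < keepProbs (g s) τ j} := fun j =>
    measurableSet_lt ((measurable_pi_apply j).comp hU) (measurable_keepProbs hg τ j)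
  rw [h]
  have h1 : Measurable fun s => ∑ j, if U s j < keepProbs (g s) τ j then (1 : ℝ) else 0 :=
    Finset.measurable_sum _ fun j _ => Measurable.ite (hs j) measurable_const measurable_const
  have h2 : Measurable fun s => ∑ j, if U s j < keepProbs (g s) τ j then g s j else 0 :=
    Finset.measurable_sum _ fun j _ => Measurable.ite (hs j) (hg j) measurable_const
  exact (h1.const_div 1).smul h2

lemma measurable_apply_index {E : Type*} [MeasurableSpace E] {q : S → Fin N → E} {k : S → Fin N}
    (hq : ∀ v, Measurable fun s => q s v) (hk : Measurable k) : Measurable fun s => q s (k s) := by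
  have h : Measurable fun p : Fin N × S => q p.2 p.1 := measurable_from_prod_countable_right hq
  exact h.comp (hk.prodMk measurable_id)

lemma measurable_stepOut (τ : ℝ) {ξ : S → ℝ} {q : S → Fin N → Vec d} {nx : S → Vec d → St}
    {seed : S → StepSeed d N K} (hξ : Measurable ξ) (hq : ∀ v, Measurable fun s => q s v)
    (hnx : Measurable (Function.uncurry nx)) (hseed : Measurable seed) :
    Measurable fun s => stepOut τ (ξ s) (q s) (nx s) (seed s) := by
  have hg : ∀ j, Measurable fun s => q s ((seed s).1 j) := fun j =>
    measurable_apply_index hq ((measurable_pi_apply j).comp (measurable_fst.comp hseed))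
  refine Measurable.ite (measurableSet_le (measurable_const.add hξ)
    ((measurable_score hg τ).add (by fun_prop))) ?_ measurable_const
  refine measurable_some.comp (hnx.comp (measurable_id.prodMk ?_))
  exact (measurable_keptMean hg τ (by fun_prop)).add (by fun_prop)

/-- The kept set has the product Bernoulli law. -/
lemma integral_kept (g : Fin K → Vec d) (τ : ℝ) (Φ : Finset (Fin K) → ℝ) :
    ∫ U, Φ (kept g τ U) ∂(Measure.pi fun _ : Fin K => volume.restrict (Set.Icc (0 : ℝ) 1)) =
      bern (keepProbs g τ) Φ := by
  classical
  have hset : ∀ A : Finset (Fin K), {U | kept g τ U = A} = Set.univ.pi fun j =>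
      if j ∈ A then Set.Iio (keepProbs g τ j) else Set.Ici (keepProbs g τ j) := by
    intro A
    ext U
    simp only [Set.mem_ofPred_eq, Set.mem_univ_pi, kept, Finset.ext_iff, Finset.mem_filter,
      Finset.mem_univ, true_and]
    refine forall_congr' fun j => ?_
    by_cases hj : j ∈ A
    · simp [hj, keepProbs]
    · simp [hj, keepProbs]
  have hms : ∀ A : Finset (Fin K), MeasurableSet {U | kept g τ U = A} := by
    intro A
    rw [hset]
    refine MeasurableSet.univ_pi fun j => ?_
    split_ifs
    exacts [measurableSet_Iio, measurableSet_Ici]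
  have hΦ : (fun U => Φ (kept g τ U)) = fun U => ∑ A, {U | kept g τ U = A}.indicator
      (fun _ => Φ A) U := by
    funext U
    simp [Set.indicator_apply]
  have hP : IsProbabilityMeasure (volume.restrict (Set.Icc (0 : ℝ) 1)) := ⟨by simp⟩
  rw [hΦ, integral_finsetSum]
  · refine Finset.sum_congr rfl fun A _ => ?_
    rw [integral_indicator_const _ (hms A), smul_eq_mul, hset, measureReal_def, Measure.pi_pi,
      ENNReal.toReal_prod]
    congr 1
    refine Finset.prod_congr rfl fun j _ => ?_
    have h0 : 0 ≤ keepProbs g τ j := keepProb_nonneg _ _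
    have h1 : keepProbs g τ j ≤ 1 := keepProb_le_one _ _
    split_ifs
    · rw [Measure.restrict_apply measurableSet_Iio]
      have : Set.Iio (keepProbs g τ j) ∩ Set.Icc 0 1 = Set.Ico 0 (keepProbs g τ j) := by
        ext x; simp only [Set.mem_inter_iff, Set.mem_Iio, Set.mem_Icc, Set.mem_Ico]
        constructor
        · rintro ⟨a, b, c⟩; exact ⟨b, a⟩
        · rintro ⟨a, b⟩; exact ⟨b, a, by linarith⟩
      rw [this, Real.volume_Ico, sub_zero, ENNReal.toReal_ofReal h0]
    · rw [Measure.restrict_apply measurableSet_Ici]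
      have : Set.Ici (keepProbs g τ j) ∩ Set.Icc 0 1 = Set.Icc (keepProbs g τ j) 1 := by
        ext x; simp only [Set.mem_inter_iff, Set.mem_Ici, Set.mem_Icc]
        constructor
        · rintro ⟨a, b, c⟩; exact ⟨a, c⟩
        · rintro ⟨a, b⟩; exact ⟨a, by linarith, b⟩
      rw [this, Real.volume_Icc, ENNReal.toReal_ofReal (by linarith)]
  · intro A _
    exact (integrable_const (Φ A)).indicator (hms A)

lemma isProbabilityMeasure_stepLaw (d : ℕ) (hε : 0 < ε) (σ : ℝ) [Nonempty (Fin K → Fin N)] :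
    IsProbabilityMeasure (stepLaw d N K ε σ) := by
  have h1 := isProbabilityMeasure_laplace (b := 16 / ε) (by positivity)
  have hP : IsProbabilityMeasure (volume.restrict (Set.Icc (0 : ℝ) 1)) := ⟨by simp⟩
  have h2 : IsProbabilityMeasure (uniformOn (Set.univ : Set (Fin K → Fin N))) :=
    isProbabilityMeasure_uniformOn Set.finite_univ Set.univ_nonempty
  unfold stepLaw
  infer_instance

lemma integral_laplace_threshold (hε : 0 < ε) (x y a h : ℝ) :
    ∫ v, (if x ≤ y + v then a else h) ∂laplace (16 / ε) =
      lapTail (ε / 16) (x - y) * a + (1 - lapTail (ε / 16) (x - y)) * h := by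
  have h1 := isProbabilityMeasure_laplace (b := 16 / ε) (by positivity)
  have hs : MeasurableSet (Set.Ici (x - y)) := measurableSet_Ici
  have e : (fun v : ℝ => if x ≤ y + v then a else h) =
      fun v => (Set.Ici (x - y)).indicator (fun _ => a - h) v + h := by
    funext v
    by_cases hv : x ≤ y + v
    · have : x - y ≤ v := by linarith
      simp [hv, this]
    · have : ¬ x - y ≤ v := fun h => hv (by linarith)
      simp [hv, this]
  rw [e, integral_add ((integrable_const _).indicator hs) (integrable_const _),
    integral_indicator_const _ hs,
    show (laplace (16 / ε)).real (Set.Ici (x - y)) = _ from laplace_real_ge (by positivity) _,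
    integral_const]
  simp only [probReal_univ, smul_eq_mul, one_div_div]
  ring

/-- The expectation of a test function after one step. -/
lemma integral_stepOut (hε : 0 < ε) [Nonempty (Fin K → Fin N)] (τ σ ξ : ℝ) {q : Fin N → Vec d}
    {nx : Vec d → St} (hnx : Measurable nx) {f : St → ℝ} (hf : Measurable f) (hf0 : ∀ s, 0 ≤ f s)
    (hf1 : ∀ s, f s ≤ 1) {h : ℝ} (hh0 : 0 ≤ h) (hh1 : h ≤ 1) :
    ∫ seed : StepSeed d N K, (stepOut τ ξ q nx seed).elim h f ∂stepLaw d N K ε σ =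
      stepMean (ε / 16) τ σ (fun _ : Fin K => q) ξ (fun w => f (nx w)) h := by
  have hl := isProbabilityMeasure_laplace (b := 16 / ε) (by positivity)
  have hP : IsProbabilityMeasure (volume.restrict (Set.Icc (0 : ℝ) 1)) := ⟨by simp⟩
  have hU : IsProbabilityMeasure (uniformOn (Set.univ : Set (Fin K → Fin N))) :=
    isProbabilityMeasure_uniformOn Set.finite_univ Set.univ_nonempty
  have hel : Measurable fun o : Option St => o.elim h f := measurable_of_comp_some hf
  have hm : Measurable fun seed : StepSeed d N K => (stepOut τ ξ q nx seed).elim h f :=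
    hel.comp (measurable_stepOut τ measurable_const (fun v => measurable_const)
      (hnx.comp measurable_snd) measurable_id)
  have hb0 : ∀ seed : StepSeed d N K, 0 ≤ (stepOut τ ξ q nx seed).elim h f := by
    intro seed
    cases stepOut τ ξ q nx seed
    exacts [hh0, hf0 _]
  have hb1 : ∀ seed : StepSeed d N K, (stepOut τ ξ q nx seed).elim h f ≤ 1 := by
    intro seed
    cases stepOut τ ξ q nx seed
    exacts [hh1, hf1 _]
  unfold stepLaw
  rw [integral_prod _ (integrable_of_mem_Icc hm hb0 hb1)]
  have hJ : ∀ J : Fin K → Fin N, ∫ r, (stepOut τ ξ q nx (J, r)).elim h f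
      ∂((laplace (16 / ε)).prod ((Measure.pi fun _ : Fin K => volume.restrict (Set.Icc (0 : ℝ) 1)).prod
        (gaussianNoise d σ))) =
      passProb (ε / 16) τ ξ (batch (fun _ => q) J) *
          estMean τ σ (fun w => f (nx w)) (batch (fun _ => q) J) +
        (1 - passProb (ε / 16) τ ξ (batch (fun _ => q) J)) * h := by
    intro J
    set g : Fin K → Vec d := batch (fun _ => q) J with hg
    rw [integral_prod _ (integrable_of_mem_Icc
      (f := fun r => (stepOut τ ξ q nx (J, r)).elim h f) (hm.comp measurable_prodMk_left)
      (fun _ => hb0 _) (fun _ => hb1 _))]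
    have hfn : Measurable fun w => f (nx w) := hf.comp hnx
    have hkm : Measurable fun r : (Fin K → ℝ) × Vec d => f (nx (keptMean g τ r.1 + r.2)) :=
      hfn.comp ((measurable_keptMean (g := fun _ => g) (fun _ => measurable_const) τ
        measurable_fst).add measurable_snd)
    have hv : ∀ v : ℝ, ∫ r : (Fin K → ℝ) × Vec d, (stepOut τ ξ q nx (J, v, r)).elim h f
        ∂((Measure.pi fun _ : Fin K => volume.restrict (Set.Icc (0 : ℝ) 1)).prod
        (gaussianNoise d σ)) =
        if 4 * (K : ℝ) / 5 + ξ ≤ score g τ + v then estMean τ σ (fun w => f (nx w)) g else h := by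
      intro v
      by_cases hc : 4 * (K : ℝ) / 5 + ξ ≤ score g τ + v
      · have e : ∀ r : (Fin K → ℝ) × Vec d, (stepOut τ ξ q nx (J, v, r)).elim h f =
            f (nx (keptMean g τ r.1 + r.2)) := fun r => by
          exact congrArg (fun o => Option.elim o h f) (if_pos hc)
        simp only [e, if_pos hc]
        rw [integral_prod _ (integrable_of_mem_Icc hkm (fun _ => hf0 _) (fun _ => hf1 _))]
        exact integral_kept g τ fun A => smooth σ (fun w => f (nx w)) (setMean g A)
      · have e : ∀ r : (Fin K → ℝ) × Vec d, (stepOut τ ξ q nx (J, v, r)).elim h f = h := fun r => by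
          exact congrArg (fun o => Option.elim o h f) (if_neg hc)
        simp only [e, if_neg hc, integral_const, probReal_univ, one_smul]
    simp only [hv]
    exact integral_laplace_threshold hε _ _ _ _
  simp only [hJ]
  rw [integral_fintype (Integrable.of_finite)]
  rw [stepMean, Finset.mul_sum]
  refine Finset.sum_congr rfl fun J _ => ?_
  have : (uniformOn (Set.univ : Set (Fin K → Fin N))).real {J} = 1 / (N : ℝ) ^ K := by
    rw [measureReal_def, uniformOn_univ]
    simp
  rw [this, smul_eq_mul]

end StepOut

/-! ### The law of a phase -/

section RunOut

variable {St : Type*} {d K N : ℕ}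

/-- The state after the steps `t₀, …, t₀ + n - 1` from the optional state `o`; `none` if some step
halts. -/
def runOut (τ ξ : ℝ) (q : ℕ → St → Fin N → Vec d) (next : ℕ → St → Vec d → St) (n t₀ : ℕ)
    (ω : Fin n → StepSeed d N K) (o : Option St) : Option St :=
  Fin.foldl n (fun o i => o.bind fun s => stepOut τ ξ (q (t₀ + i) s) (next (t₀ + i) s) (ω i)) o

lemma runOut_none (τ ξ : ℝ) (q : ℕ → St → Fin N → Vec d) (next : ℕ → St → Vec d → St) (n t₀ : ℕ)
    (ω : Fin n → StepSeed d N K) : runOut τ ξ q next n t₀ ω none = none := by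
  induction n generalizing t₀ with
  | zero => simp [runOut]
  | succ n ih =>
    have := ih (t₀ + 1) fun i => ω i.succ
    simp only [runOut, Fin.foldl_succ, Fin.val_succ, Option.bind_none] at this ⊢
    simpa only [add_assoc, add_comm 1] using this

variable [MeasurableSpace St] [Nonempty St] {q q' : ℕ → St → Fin N → Vec d}
  {next : ℕ → St → Vec d → St} {f : St → ℝ} {h τ σ ε : ℝ}

lemma measurable_runOut (τ : ℝ) (hq : ∀ t v, Measurable fun s => q t s v)
    (hnext : ∀ t, Measurable (Function.uncurry (next t))) (n t₀ : ℕ) :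
    Measurable fun p : Option St × ℝ × (Fin n → StepSeed d N K) =>
      runOut τ p.2.1 q next n t₀ p.2.2 p.1 := by
  refine measurable_foldl (F := fun (i : Fin n) (ξ : ℝ) (o : Option St)
      (w : StepSeed d N K) => o.bind fun s => stepOut τ ξ (q (t₀ + i) s) (next (t₀ + i) s) w) fun i => ?_
  refine measurable_option_bind (G := fun (p : ℝ × StepSeed d N K) s =>
    stepOut τ p.1 (q (t₀ + i) s) (next (t₀ + i) s) p.2) ?_
  refine measurable_stepOut τ (by fun_prop) (fun v => (hq _ v).comp measurable_fst) ?_ (by fun_prop)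
  exact (hnext (t₀ + i)).comp (f := fun p : (St × ℝ × StepSeed d N K) × Vec d => (p.1.1, p.2))
    (by fun_prop)

/-- Links the sampled algorithm to the recursion `runMean`. The seeds of the steps are independent,
so the first one can be integrated last, against the mean value of the rest of the run. -/
lemma lintegral_runOut (hε : 0 < ε) (hN : 0 < N) (τ σ ξ : ℝ)
    (hq : ∀ t v, Measurable fun s => q t s v)
    (hnext : ∀ t, Measurable (Function.uncurry (next t))) (hf : Measurable f)
    (hf0 : ∀ s, 0 ≤ f s) (hf1 : ∀ s, f s ≤ 1) (hh0 : 0 ≤ h) (hh1 : h ≤ 1) (n t₀ : ℕ) (s : St) :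
    ∫⁻ ω : Fin n → StepSeed d N K, ENNReal.ofReal ((runOut τ ξ q next n t₀ ω (some s)).elim h f)
        ∂(Measure.pi fun _ => stepLaw d N K ε σ) =
      ENNReal.ofReal
        (runMean (ε / 16) τ σ (fun t z (_ : Fin K) v => q t z v) next ξ f h n t₀ s) := by
  have hne : Nonempty (Fin K → Fin N) := ⟨fun _ => ⟨0, hN⟩⟩
  have hP := isProbabilityMeasure_stepLaw (K := K) (N := N) d hε σ
  induction n generalizing t₀ s with
  | zero => simp [runOut, runMean]
  | succ n ih =>
    have hR := measurable_runMean (ε / 16) τ σ ξ h (fun t (_ : Fin K) v => hq t v) hnext hf n (t₀ + 1)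
    have hR01 := runMean_mem (κ := ε / 16) (τ := τ) (σ := σ) (ξ := ξ) (h := h) (by positivity) hN
      (fun t (_ : Fin K) v => hq t v) hnext hf hf0 hf1 hh0 hh1 n (t₀ + 1)
    have hnz : Measurable (next t₀ s) := (hnext t₀).comp (measurable_const.prodMk measurable_id)
    have hel : Measurable fun o : Option St => ENNReal.ofReal (o.elim h f) :=
      measurable_of_comp_some hf.ennreal_ofReal
    have hpeel := lintegral_foldl_succ (μ := fun _ : Fin (n + 1) => stepLaw d N K ε σ)
      (F := fun i o w => o.bind fun s => stepOut τ ξ (q (t₀ + i) s) (next (t₀ + i) s) w)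
      (fun i => by
        refine measurable_option_bind (G := fun (w : StepSeed d N K) s =>
          stepOut τ ξ (q (t₀ + i) s) (next (t₀ + i) s) w) ?_
        refine measurable_stepOut τ (by fun_prop) (fun v => (hq _ v).comp measurable_fst) ?_
          (by fun_prop)
        exact (hnext (t₀ + i)).comp (f := fun p : (St × StepSeed d N K) × Vec d => (p.1.1, p.2))
          (by fun_prop)) hel (some s)
    refine hpeel.trans ?_
    have hinner : ∀ w : StepSeed d N K, ∫⁻ ω : Fin n → StepSeed d N K, ENNReal.ofReal
        ((Fin.foldl n (fun o i => o.bind fun s =>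
          stepOut τ ξ (q (t₀ + i.succ) s) (next (t₀ + i.succ) s) (ω i))
          ((some s).bind fun s => stepOut τ ξ (q (t₀ + (0 : Fin (n + 1))) s)
            (next (t₀ + (0 : Fin (n + 1))) s) w)).elim h f)
          ∂(Measure.pi fun _ => stepLaw d N K ε σ) =
        ENNReal.ofReal ((stepOut τ ξ (q t₀ s) (next t₀ s) w).elim h
          (runMean (ε / 16) τ σ (fun t z (_ : Fin K) v => q t z v) next ξ f h n (t₀ + 1))) := by
      intro w
      have e : ∀ (ω : Fin n → StepSeed d N K) (o : Option St), Fin.foldl n (fun o i => o.bind fun s =>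
          stepOut τ ξ (q (t₀ + i.succ) s) (next (t₀ + i.succ) s) (ω i)) o =
          runOut τ ξ q next n (t₀ + 1) ω o := by
        intro ω o
        simp only [runOut, Fin.val_succ, add_assoc, add_comm 1]
      simp only [e, Option.bind_some, Fin.val_zero, add_zero]
      cases stepOut τ ξ (q t₀ s) (next t₀ s) w with
      | none => simp [runOut_none]
      | some s' => exact ih (t₀ + 1) s'
    refine (lintegral_congr hinner).trans ?_
    rw [← ofReal_integral_eq_lintegral_ofReal, integral_stepOut hε τ σ ξ hnz hR (fun s => (hR01 s).1)
      (fun s => (hR01 s).2) hh0 hh1]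
    · rfl
    · refine integrable_of_mem_Icc (B := 1) ?_ (fun w => ?_) fun w => ?_
      · exact (measurable_of_comp_some hR : Measurable fun o : Option St => o.elim h
          (runMean (ε / 16) τ σ (fun t z (_ : Fin K) v => q t z v) next ξ f h n (t₀ + 1))).comp
          (measurable_stepOut τ measurable_const (fun _ => measurable_const)
            (hnz.comp measurable_snd) measurable_id)
      · cases stepOut τ ξ (q t₀ s) (next t₀ s) w
        exacts [hh0, (hR01 _).1]
      · cases stepOut τ ξ (q t₀ s) (next t₀ s) w
        exacts [hh1, (hR01 _).2]
    · refine Filter.Eventually.of_forall fun w => ?_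
      change 0 ≤ (stepOut τ ξ (q t₀ s) (next t₀ s) w).elim h _
      cases stepOut τ ξ (q t₀ s) (next t₀ s) w
      exacts [hh0, (hR01 _).1]

lemma lintegral_laplace_runOut (hε : 0 < ε) (hN : 0 < N) (τ σ : ℝ)
    (hq : ∀ t v, Measurable fun s => q t s v)
    (hnext : ∀ t, Measurable (Function.uncurry (next t))) (hf : Measurable f)
    (hf0 : ∀ s, 0 ≤ f s) (hf1 : ∀ s, f s ≤ 1) (hh0 : 0 ≤ h) (hh1 : h ≤ 1) (n : ℕ) (s : St) :
    ∫⁻ p : ℝ × (Fin n → StepSeed d N K),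
        ENNReal.ofReal ((runOut τ p.1 q next n 0 p.2 (some s)).elim h f)
        ∂((laplace (8 / ε)).prod (Measure.pi fun _ => stepLaw d N K ε σ)) =
      ENNReal.ofReal (∫ ξ, runMean (ε / 16) τ σ (fun t z (_ : Fin K) v => q t z v) next ξ f h n 0 s
        ∂laplace (8 / ε)) := by
  have hne : Nonempty (Fin K → Fin N) := ⟨fun _ => ⟨0, hN⟩⟩
  have hP := isProbabilityMeasure_stepLaw (K := K) (N := N) d hε σ
  have hl := isProbabilityMeasure_laplace (b := 8 / ε) (by positivity)
  have hel : Measurable fun o : Option St => ENNReal.ofReal (o.elim h f) :=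
    measurable_of_comp_some hf.ennreal_ofReal
  have hm : Measurable fun p : ℝ × (Fin n → StepSeed d N K) =>
      ENNReal.ofReal ((runOut τ p.1 q next n 0 p.2 (some s)).elim h f) :=
    hel.comp ((measurable_runOut τ hq hnext n 0).comp (measurable_const.prodMk measurable_id))
  rw [lintegral_prod _ hm.aemeasurable]
  simp only [lintegral_runOut hε hN τ σ _ hq hnext hf hf0 hf1 hh0 hh1]
  have h01 := fun ξ => runMean_mem (κ := ε / 16) (τ := τ) (σ := σ) (ξ := ξ) (h := h) (by positivity) hN
      (fun t (_ : Fin K) v => hq t v) hnext hf hf0 hf1 hh0 hh1 n 0 s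
  rw [ofReal_integral_eq_lintegral_ofReal]
  · exact integrable_of_mem_Icc ((measurable_runMean_prod (ε / 16) τ σ h
      (fun t (_ : Fin K) v => hq t v) hnext hf n 0).comp (measurable_id.prodMk measurable_const))
      (fun ξ => (h01 ξ).1) (fun ξ => (h01 ξ).2)
  · exact Filter.Eventually.of_forall fun ξ => (h01 ξ).1

lemma add_mul_le_of_le {a b a' b' e x w : ℝ≥0∞} (ha : a ≤ e * a' + x) (hb : b ≤ e * b' + x)
    (hw : w ≤ 1) : a + w * b ≤ e * (a' + w * b') + (x + x) :=
  calc a + w * b ≤ (e * a' + x) + w * (e * b' + x) := by gcongr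
    _ = e * (a' + w * b') + (x + w * x) := by ring
    _ ≤ e * (a' + w * b') + (x + 1 * x) := by gcongr
    _ = _ := by rw [one_mul]

/-- Privacy of one phase. -/
lemma PhaseBounds.lintegral_runOut_le {T : ℕ} {δ Λ Λ' : ℝ} (hB : PhaseBounds N K T ε δ Λ Λ')
    (hτ : 0 < τ) (hσ : σ = 1000 * τ * √(T : ℝ) * Λ' / (ε * N)) {u : Fin N}
    (hqm : ∀ t v, Measurable fun z => q t z v) (hqm' : ∀ t v, Measurable fun z => q' t z v)
    (hnext : ∀ t, Measurable (Function.uncurry (next t)))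
    (hq : ∀ t z v, v ≠ u → q t z v = q' t z v) {W : Option St → ℝ≥0∞} (hW : Measurable W)
    (hW1 : ∀ o, W o ≤ 1) (s : St) :
    ∫⁻ p : ℝ × (Fin T → StepSeed d N K), W (runOut τ p.1 q next T 0 p.2 (some s))
        ∂((laplace (8 / ε)).prod (Measure.pi fun _ => stepLaw d N K ε σ)) ≤
      ENNReal.ofReal (Real.exp ε) *
        ∫⁻ p : ℝ × (Fin T → StepSeed d N K), W (runOut τ p.1 q' next T 0 p.2 (some s))
          ∂((laplace (8 / ε)).prod (Measure.pi fun _ => stepLaw d N K ε σ)) + ENNReal.ofReal δ := by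
  have hε := hB.eps_pos
  have hN := hB.users_pos
  have hδ := hB.delta_pos
  set f : St → ℝ := fun s => (W (some s)).toReal with hfdef
  have hf : Measurable f := (hW.comp measurable_some).ennreal_toReal
  have hf0 : ∀ s, 0 ≤ f s := fun s => ENNReal.toReal_nonneg
  have hf1 : ∀ s, f s ≤ 1 := fun s => ENNReal.toReal_le_of_le_ofReal zero_le_one (by simpa using hW1 _)
  have hz : Measurable fun _ : St => (0 : ℝ) := measurable_const
  -- The values on surviving runs and the value at a halt are separated because
  -- `StepRegime.runMean_le` needs h to be 0 or 1. The two parts are compared under opposite moves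
  -- of the threshold, each with error δ/2.
  have hsplit : ∀ o : Option St, W o =
      ENNReal.ofReal (o.elim 0 f) + W none * ENNReal.ofReal (o.elim 1 fun _ => 0) := by
    intro o
    cases o with
    | none => simp
    | some s => simp [hfdef, ENNReal.ofReal_toReal ((hW1 _).trans_lt ENNReal.one_lt_top).ne]
  have hI : ∀ {q : ℕ → St → Fin N → Vec d}, (∀ t v, Measurable fun z => q t z v) →
      ∫⁻ p : ℝ × (Fin T → StepSeed d N K), W (runOut τ p.1 q next T 0 p.2 (some s))
        ∂((laplace (8 / ε)).prod (Measure.pi fun _ => stepLaw d N K ε σ)) =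
      ENNReal.ofReal (∫ ξ, runMean (ε / 16) τ σ (fun t z (_ : Fin K) v => q t z v) next ξ f 0 T 0 s
        ∂laplace (8 / ε)) + W none *
      ENNReal.ofReal (∫ ξ, runMean (ε / 16) τ σ (fun t z (_ : Fin K) v => q t z v) next ξ
        (fun _ => 0) 1 T 0 s ∂laplace (8 / ε)) := by
    intro q hq
    have hrm : Measurable fun p : ℝ × (Fin T → StepSeed d N K) =>
        runOut τ p.1 q next T 0 p.2 (some s) :=
      (measurable_runOut τ hq hnext T 0).comp (measurable_const.prodMk measurable_id)
    have hel1 : Measurable fun o : Option St => ENNReal.ofReal (o.elim 0 f) :=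
      measurable_of_comp_some hf.ennreal_ofReal
    have hel2 : Measurable fun o : Option St => ENNReal.ofReal (o.elim 1 fun _ => 0) :=
      measurable_of_comp_some (measurable_const (a := ENNReal.ofReal 0))
    have hm1 : Measurable fun p : ℝ × (Fin T → StepSeed d N K) =>
        ENNReal.ofReal ((runOut τ p.1 q next T 0 p.2 (some s)).elim 0 f) := hel1.comp hrm
    have hm2 : Measurable fun p : ℝ × (Fin T → StepSeed d N K) =>
        ENNReal.ofReal ((runOut τ p.1 q next T 0 p.2 (some s)).elim 1 fun _ => 0) := hel2.comp hrm
    rw [← lintegral_laplace_runOut hε hN τ σ hq hnext hf hf0 hf1 le_rfl zero_le_one,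
      ← lintegral_laplace_runOut hε hN τ σ hq hnext hz (fun _ => le_rfl) (fun _ => zero_le_one)
        zero_le_one le_rfl,
      ← lintegral_const_mul _ hm2, ← lintegral_add_left hm1]
    exact lintegral_congr fun p => hsplit _
  rw [hI hqm, hI hqm']
  have key : ∀ {f : St → ℝ} {b : ℝ}, Measurable f → (∀ s, 0 ≤ f s) → (∀ s, f s ≤ 1) → b = 0 ∨ b = 1 →
      ENNReal.ofReal (∫ ξ, runMean (ε / 16) τ σ (fun t z (_ : Fin K) v => q t z v) next ξ f b T 0 s
        ∂laplace (8 / ε)) ≤ ENNReal.ofReal (Real.exp ε) *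
      ENNReal.ofReal (∫ ξ, runMean (ε / 16) τ σ (fun t z (_ : Fin K) v => q' t z v) next ξ f b T 0 s
        ∂laplace (8 / ε)) + ENNReal.ofReal (δ / 2) := by
    intro f b hf hf0 hf1 hb
    rw [← ENNReal.ofReal_mul (Real.exp_pos _).le]
    refine (ENNReal.ofReal_le_ofReal
      (hB.integral_runMean_le hτ hσ hqm hqm' hnext hf hf0 hf1 hq hb s)).trans ENNReal.ofReal_add_le
  have h1 := key hf hf0 hf1 (Or.inl rfl)
  have h2 := key hz (fun _ => le_rfl) (fun _ => zero_le_one) (Or.inr rfl)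
  have hδ2 : ENNReal.ofReal δ = ENNReal.ofReal (δ / 2) + ENNReal.ofReal (δ / 2) := by
    rw [← ENNReal.ofReal_add (by positivity) (by positivity), add_halves]
  rw [hδ2]
  exact add_mul_le_of_le h1 h2 (hW1 none)

end RunOut

/-! ### AC-SA over a convex compact set -/

section Projection

variable {d : ℕ} {X : Set (Vec d)}

lemma proj_spec (hX : IsCompact X) (hne : X.Nonempty) (u : Vec d) :
    proj X u ∈ X ∧ ∀ x ∈ X, ‖u - proj X u‖ ≤ ‖u - x‖ := by
  have h : ∃ y ∈ X, ∀ x ∈ X, ‖u - y‖ ≤ ‖u - x‖ := by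
    obtain ⟨y, hy, hmin⟩ := hX.exists_isMinOn hne (f := fun x => ‖u - x‖)
      (by fun_prop : Continuous fun x => ‖u - x‖).continuousOn
    exact ⟨y, hy, fun x hx => hmin hx⟩
  rw [proj, dif_pos h]
  exact h.choose_spec

lemma inner_proj_le_zero (hc : Convex ℝ X) (hX : IsCompact X) {u x : Vec d} (hx : x ∈ X) :
    inner ℝ (u - proj X u) (x - proj X u) ≤ 0 := by
  obtain ⟨h1, h2⟩ := proj_spec hX ⟨x, hx⟩ u
  refine (norm_eq_iInf_iff_real_inner_le_zero hc h1).1 ?_ x hx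
  have : Nonempty X := ⟨⟨x, hx⟩⟩
  refine le_antisymm (le_ciInf fun w => h2 w w.2) ?_
  exact ciInf_le ⟨0, by rintro _ ⟨w, rfl⟩; exact norm_nonneg _⟩ (⟨proj X u, h1⟩ : X)

/-- The projection is nonexpansive: adding the two variational inequalities gives ‖p - r‖² ≤ ⟨u - v,
p - r⟩. -/
lemma continuous_proj (hc : Convex ℝ X) (hX : IsCompact X) (hne : X.Nonempty) :
    Continuous (proj X) := by
  refine LipschitzWith.continuous (K := 1) (LipschitzWith.of_dist_le_mul fun u v => ?_)
  rw [NNReal.coe_one, one_mul, dist_eq_norm, dist_eq_norm]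
  have hu := (proj_spec hX hne u).1
  have hv := (proj_spec hX hne v).1
  have h1 := inner_proj_le_zero hc hX (u := u) hv
  have h2 := inner_proj_le_zero hc hX (u := v) hu
  set p := proj X u
  set r := proj X v
  have h3 : ‖p - r‖ ^ 2 ≤ inner ℝ (u - v) (p - r) := by
    have e1 : inner ℝ (u - p) (r - p) = -inner ℝ (u - p) (p - r) := by
      rw [← inner_neg_right, neg_sub]
    have e2 : inner ℝ (u - v) (p - r) - inner ℝ (p - r) (p - r) =
        inner ℝ (u - p) (p - r) - inner ℝ (v - r) (p - r) := by
      rw [← inner_sub_left, ← inner_sub_left]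
      congr 1
      abel
    rw [← real_inner_self_eq_norm_sq]
    linarith
  have h4 := real_inner_le_norm (u - v) (p - r)
  by_contra hlt
  push Not at hlt
  have h5 : 0 < ‖p - r‖ := (norm_nonneg _).trans_lt hlt
  nlinarith

end Projection

section ACSA

variable {d : ℕ}

instance : MeasurableSpace (ACSAState d) :=
  MeasurableSpace.comap (fun s => (s.prox, s.ag)) inferInstance

instance : Nonempty (ACSAState d) := ⟨⟨0, 0⟩⟩

lemma ACSAState.measurable_prox : Measurable (ACSAState.prox (d := d)) :=
  measurable_fst.comp (comap_measurable fun s : ACSAState d => (s.prox, s.ag))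

lemma ACSAState.measurable_ag : Measurable (ACSAState.ag (d := d)) :=
  measurable_snd.comp (comap_measurable fun s : ACSAState d => (s.prox, s.ag))

variable {S : Type*} [MeasurableSpace S] {X : Set (Vec d)} {μ α γ : ℝ}

lemma ACSAState.measurable_mk {p a : S → Vec d} (hp : Measurable p) (ha : Measurable a) :
    Measurable fun s => ACSAState.mk (p s) (a s) :=
  measurable_comap_iff.2 (hp.prodMk ha)

lemma ACSAState.measurable_enter (b : Bool) : Measurable fun s : ACSAState d => s.enter b := by
  cases b
  · exact measurable_id
  · exact measurable_mk measurable_ag measurable_ag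

lemma ACSAState.measurable_query (μ α γ : ℝ) : Measurable fun s : ACSAState d => s.query μ α γ := by
  have h1 : Measurable fun s : ACSAState d => s.ag := measurable_ag
  have h2 : Measurable fun s : ACSAState d => s.prox := measurable_prox
  unfold query
  fun_prop

lemma ACSAState.measurable_update (hX : Measurable (proj X)) (μ α γ : ℝ) {s : S → ACSAState d}
    {G : S → Vec d} (hs : Measurable s) (hG : Measurable G) :
    Measurable fun p => (s p).update X μ α γ (G p) := by
  have h1 : Measurable fun p => proj X ((1 / (μ + γ)) •
      ((α * μ) • (s p).query μ α γ + ((1 - α) * μ + γ) • (s p).prox - α • G p)) := by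
    have h2 : Measurable fun p => (s p).query μ α γ := (measurable_query μ α γ).comp hs
    have h3 : Measurable fun p => (s p).prox := measurable_prox.comp hs
    refine hX.comp ?_
    fun_prop
  have h4 : Measurable fun p => (s p).ag := measurable_ag.comp hs
  exact measurable_mk h1 (by fun_prop)

/-- Both iterates lie in `X`. -/
def ACSAState.InDomain (s : ACSAState d) (X : Set (Vec d)) : Prop := s.prox ∈ X ∧ s.ag ∈ X

lemma ACSAState.InDomain.enter {s : ACSAState d} (hs : s.InDomain X) (b : Bool) :
    (s.enter b).InDomain X := by
  cases b
  · exact hs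
  · exact ⟨hs.2, hs.2⟩

/-- The two coefficients are nonnegative and sum to one, so the query point is a convex combination
of the iterates. -/
lemma ACSAState.InDomain.query_mem {s : ACSAState d} (hs : s.InDomain X) (hc : Convex ℝ X)
    (hμ : 0 < μ) (hα : 0 < α) (hα1 : α ≤ 1) (hγ : 0 < γ) : s.query μ α γ ∈ X := by
  have h1 : 0 ≤ 1 - α := by linarith
  have h2 : 0 ≤ 1 - α ^ 2 := by nlinarith
  have h3 : 0 < γ + (1 - α ^ 2) * μ := by positivity
  refine hc hs.2 hs.1 (by positivity) (by positivity) ?_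
  rw [← add_div, div_eq_one_iff_eq h3.ne']
  ring

lemma ACSAState.InDomain.update {s : ACSAState d} (hs : s.InDomain X) (hc : Convex ℝ X)
    (hX : IsCompact X) (hα : 0 < α) (hα1 : α ≤ 1) (G : Vec d) :
    (s.update X μ α γ G).InDomain X := by
  have h1 := fun u => (proj_spec hX ⟨_, hs.1⟩ u).1
  exact ⟨h1 _, hc (h1 _) hs.2 hα.le (by linarith) (by ring)⟩

end ACSA

/-! ### The algorithm with gradients cut off outside of the domain -/

section Cutoff

variable {Z : Type*} (P : Params) (X : Set (Vec P.d)) (grad : Vec P.d → Z → Vec P.d)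

lemma foldl_rel {A B : Type*} {n : ℕ} {F : A → Fin n → A} {G : B → Fin n → B} (R : A → B → Prop)
    (hR : ∀ a b i, R a b → R (F a i) (G b i)) {a : A} {b : B} (h : R a b) :
    R (Fin.foldl n F a) (Fin.foldl n G b) := by
  induction n generalizing a b with
  | zero => simpa using h
  | succ n ih =>
    rw [Fin.foldl_succ, Fin.foldl_succ]
    exact ih (fun a b i => hR a b i.succ) (hR a b 0 h)

/-- The averaged gradient of user `v` of phase `i` at the query point of step `t`, and zero if
the query point is not in `X`; a state is a center and an AC-SA state. -/
def phaseGrad (i : ℕ) (Di : Fin (P.size i) → Fin P.m → Z) (t : ℕ) (z : Vec P.d × ACSAState P.d)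
    (v : Fin (P.size i)) : Vec P.d :=
  userGrad (fun x z => X.indicator (fun x => grad x z) x)
    ((z.2.enter (P.restart i t)).query (P.reg i) (P.α i t) (P.γ i t)) (Di v)

/-- The state after step `t` of phase `i` with the noisy gradient `w`. -/
def phaseNext (i t : ℕ) (z : Vec P.d × ACSAState P.d) (w : Vec P.d) : Vec P.d × ACSAState P.d :=
  (z.1, (z.2.enter (P.restart i t)).update X (P.reg i) (P.α i t) (P.γ i t)
    (w + P.reg i • ((z.2.enter (P.restart i t)).query (P.reg i) (P.α i t) (P.γ i t) - z.1)))

/-- The result of phase `i` with gradients cut off outside of `X`. -/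
def phaseOut (i : ℕ) (Di : Fin (P.size i) → Fin P.m → Z) (x : Vec P.d) (seed : PhaseSeed P i) :
    Option (Vec P.d) :=
  (runOut P.τ seed.1 (phaseGrad P X grad i Di) (phaseNext P X i) (P.T i) 0 seed.2
    (some (x, ⟨x, x⟩))).map fun z => z.2.ag

variable {P X grad}

/-- Nothing is known about `grad` outside of X, not even measurability. All query points of a phase
started in X lie in X, so cutting the gradients off changes nothing there and makes the phase
measurable. -/
lemma phase_eq_phaseOut (hc : Convex ℝ X) (hX : IsCompact X) {i : ℕ} (hreg : 0 < P.reg i)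
    (hα : ∀ i t, 0 < P.α i t ∧ P.α i t ≤ 1) (hγ : ∀ i t, 0 < P.γ i t)
    (Di : Fin (P.size i) → Fin P.m → Z) {x : Vec P.d} (hx : x ∈ X) (seed : PhaseSeed P i) :
    phase P X grad i Di x seed = phaseOut P X grad i Di x seed ∧
      ∀ y ∈ phase P X grad i Di x seed, y ∈ X := by
  have key := foldl_rel (n := P.T i)
    (F := fun (o : Option (ACSAState P.d)) t =>
      o.bind (step P X grad i Di x seed.1 t (seed.2 t)))
    (G := fun o t => o.bind fun s =>
      stepOut P.τ seed.1 (phaseGrad P X grad i Di (0 + t) s) (phaseNext P X i (0 + t) s) (seed.2 t))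
    (fun o o' => o' = o.map (fun s => (x, s)) ∧ ∀ s ∈ o, s.InDomain X)
    (fun o o' t h => by
      obtain ⟨rfl, h⟩ := h
      cases o with
      | none => simp
      | some s =>
        have hs := (h s rfl).enter (P.restart i t)
        have hq := hs.query_mem hc hreg (hα i t).1 (hα i t).2 (hγ i t)
        have hgrad : ∀ v, userGrad grad ((s.enter (P.restart i t)).query (P.reg i) (P.α i t) (P.γ i t))
            (Di v) = phaseGrad P X grad i Di t (x, s) v := by
          intro v
          simp only [phaseGrad, userGrad, Set.indicator_of_mem hq]
        simp only [Option.map_some, Option.bind_some, zero_add, step, hgrad, stepOut]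
        split_ifs with hcond
        · refine ⟨rfl, ?_⟩
          intro s' hs'
          obtain rfl := Option.some.inj hs'
          exact hs.update hc hX (hα i t).1 (hα i t).2 _
        · simp)
    (a := some ⟨x, x⟩) (b := some (x, ⟨x, x⟩))
    ⟨rfl, fun s hs => by obtain rfl := Option.some.inj hs; exact ⟨hx, hx⟩⟩
  obtain ⟨h1, h2⟩ := key
  constructor
  · rw [phaseOut, runOut, h1, Option.map_map]
    rfl
  · intro y hy
    obtain ⟨s, hs, rfl⟩ := Option.mem_map.1 hy
    exact (h2 s hs).2

/-- Smoothness makes the gradient Lipschitz, hence continuous, on the closed set X. Extension by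
zero is then measurable. -/
lemma measurable_indicator_grad {L β : ℝ} {R : ℝ} {f : Vec P.d → Z → ℝ}
    (hloss : LossAssumptions X f grad R L β) (z : Z) :
    Measurable fun x => X.indicator (fun x => grad x z) x := by
  classical
  have hcont : ContinuousOn (fun x => grad x z) X := by
    refine LipschitzOnWith.continuousOn (K := β.toNNReal) (LipschitzOnWith.of_dist_le_mul ?_)
    intro x hx y hy
    rw [dist_eq_norm, dist_eq_norm]
    refine (hloss.smooth_loss z x hx y hy).trans ?_
    exact mul_le_mul_of_nonneg_right (Real.le_coe_toNNReal β) (norm_nonneg _)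
  have h := hcont.measurable_piecewise (g := fun _ => 0) continuousOn_const
    hloss.compact_domain.isClosed.measurableSet
  convert h using 1
  exact (Set.piecewise_eq_indicator (s := X)).symm

lemma measurable_phaseGrad {L β : ℝ} {R : ℝ} {f : Vec P.d → Z → ℝ}
    (hloss : LossAssumptions X f grad R L β) (i : ℕ) (Di : Fin (P.size i) → Fin P.m → Z) (t : ℕ)
    (v : Fin (P.size i)) : Measurable fun z => phaseGrad P X grad i Di t z v := by
  have hq : Measurable fun z : Vec P.d × ACSAState P.d =>
      (z.2.enter (P.restart i t)).query (P.reg i) (P.α i t) (P.γ i t) :=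
    (ACSAState.measurable_query _ _ _).comp
      ((ACSAState.measurable_enter _).comp measurable_snd)
  have h : ∀ j, Measurable fun z : Vec P.d × ACSAState P.d =>
      X.indicator (fun x => grad x (Di v j))
        ((z.2.enter (P.restart i t)).query (P.reg i) (P.α i t) (P.γ i t)) :=
    fun j => (measurable_indicator_grad hloss (Di v j)).comp hq
  unfold phaseGrad userGrad
  fun_prop

lemma measurable_phaseNext (hX : Measurable (proj X)) (i t : ℕ) :
    Measurable (Function.uncurry (phaseNext P X i t)) := by
  have he : Measurable fun p : (Vec P.d × ACSAState P.d) × Vec P.d =>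
      p.1.2.enter (P.restart i t) :=
    (ACSAState.measurable_enter _).comp (measurable_snd.comp measurable_fst)
  have hq : Measurable fun p : (Vec P.d × ACSAState P.d) × Vec P.d =>
      (p.1.2.enter (P.restart i t)).query (P.reg i) (P.α i t) (P.γ i t) :=
    (ACSAState.measurable_query (P.reg i) (P.α i t) (P.γ i t)).comp he
  have hG : Measurable fun p : (Vec P.d × ACSAState P.d) × Vec P.d => p.2 + P.reg i •
      ((p.1.2.enter (P.restart i t)).query (P.reg i) (P.α i t) (P.γ i t) - p.1.1) := by
    fun_prop
  have hU : Measurable fun p : (Vec P.d × ACSAState P.d) × Vec P.d =>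
      (p.1.2.enter (P.restart i t)).update X (P.reg i) (P.α i t) (P.γ i t) (p.2 + P.reg i •
        ((p.1.2.enter (P.restart i t)).query (P.reg i) (P.α i t) (P.γ i t) - p.1.1)) :=
    ACSAState.measurable_update hX (P.reg i) (P.α i t) (P.γ i t) he hG
  have h1 : Measurable fun p : (Vec P.d × ACSAState P.d) × Vec P.d => p.1.1 :=
    measurable_fst.comp measurable_fst
  exact h1.prodMk hU

lemma measurable_option_map {α β : Type*} [MeasurableSpace α] [MeasurableSpace β] {g : α → β}
    (hg : Measurable g) : Measurable (Option.map g) :=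
  measurable_of_comp_some (measurable_some.comp hg)

lemma measurable_phaseOut {L β : ℝ} {R : ℝ} {f : Vec P.d → Z → ℝ}
    (hloss : LossAssumptions X f grad R L β) (hX : Measurable (proj X)) (i : ℕ)
    (Di : Fin (P.size i) → Fin P.m → Z) :
    Measurable fun p : Vec P.d × PhaseSeed P i => phaseOut P X grad i Di p.1 p.2 := by
  have h := measurable_runOut (K := P.K i) P.τ (measurable_phaseGrad hloss i Di)
    (measurable_phaseNext hX i) (P.T i) 0
  refine (measurable_option_map (ACSAState.measurable_ag.comp measurable_snd)).comp (h.comp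
    (Measurable.prodMk (measurable_some.comp ?_) measurable_snd))
  exact measurable_fst.prodMk (ACSAState.measurable_mk measurable_fst measurable_fst)

end Cutoff

/-! ### Composition of the phases -/

section Composition

variable {A : Type*} [MeasurableSpace A]

/-- Privacy of a fold in which only one step depends on the data. -/
lemma lintegral_foldl_le {n : ℕ} {Ω : Fin n → Type*} [∀ i, MeasurableSpace (Ω i)]
    {μ : ∀ i, Measure (Ω i)} [∀ i, IsProbabilityMeasure (μ i)] {F F' : ∀ i, A → Ω i → A}
    (hF : ∀ i, Measurable (Function.uncurry (F i))) (hF' : ∀ i, Measurable (Function.uncurry (F' i)))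
    {e δ : ℝ≥0∞} {j : Fin n} (heq : ∀ i, i ≠ j → F i = F' i)
    (hj : ∀ W : A → ℝ≥0∞, Measurable W → (∀ a, W a ≤ 1) → ∀ a,
      ∫⁻ w, W (F j a w) ∂μ j ≤ e * ∫⁻ w, W (F' j a w) ∂μ j + δ)
    {h : A → ℝ≥0∞} (hh : Measurable h) (hh1 : ∀ a, h a ≤ 1) (a : A) :
    ∫⁻ ω, h (Fin.foldl n (fun a i => F i a (ω i)) a) ∂Measure.pi μ ≤
      e * ∫⁻ ω, h (Fin.foldl n (fun a i => F' i a (ω i)) a) ∂Measure.pi μ + δ := by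
  induction n generalizing a with
  | zero => exact j.elim0
  | succ n ih =>
    have hW : ∀ {G : ∀ i, A → Ω i → A}, (∀ i, Measurable (Function.uncurry (G i))) →
        Measurable fun b => ∫⁻ ω, h (Fin.foldl n (fun a i => G i.succ a (ω i)) b)
          ∂(Measure.pi fun i : Fin n => μ i.succ) := by
      intro G hG
      have hfold := measurable_foldl (S := Unit) (F := fun (i : Fin n) (_ : Unit) => G i.succ)
        fun i => (hG i.succ).comp (g := Function.uncurry (G i.succ))
          (measurable_fst.prodMk (measurable_snd.comp measurable_snd))
      have hjoint : Measurable fun p : A × (∀ i : Fin n, Ω i.succ) =>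
          h (Fin.foldl n (fun a i => G i.succ a (p.2 i)) p.1) :=
        hh.comp (hfold.comp (g := fun p : A × Unit × (∀ i : Fin n, Ω i.succ) =>
          Fin.foldl n (fun a i => G i.succ a (p.2.2 i)) p.1)
          (f := fun p : A × (∀ i : Fin n, Ω i.succ) => (p.1, (), p.2)) (by fun_prop))
      exact hjoint.lintegral_prod_right'
    rw [lintegral_foldl_succ hF hh, lintegral_foldl_succ hF' hh]
    induction j using Fin.cases with
    | zero =>
      have e1 : ∀ i : Fin n, F i.succ = F' i.succ := fun i => heq _ (Fin.succ_ne_zero i)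
      simp only [e1]
      -- Post-processing: all later steps agree, so their mean is a common test function with values
      -- in [0,1] of the output of the first step.
      refine hj _ (hW hF') (fun b => ?_) a
      exact (lintegral_mono fun ω => hh1 _).trans (by simp)
    | succ j =>
      rw [heq 0 (Fin.succ_ne_zero j).symm]
      -- The first step is common to both runs. The inequality for the rest holds from every state
      -- and is integrated over the output of that step.
      have hstep := ih (μ := fun i : Fin n => μ i.succ) (F := fun i => F i.succ)
        (F' := fun i => F' i.succ) (fun i => hF i.succ) (fun i => hF' i.succ) (j := j)
        (fun i hi => heq _ fun h => hi (Fin.succ_injective _ h)) hj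
      have hm : Measurable fun w => ∫⁻ ω, h (Fin.foldl n (fun a i => F' i.succ a (ω i)) (F' 0 a w))
          ∂(Measure.pi fun i : Fin n => μ i.succ) :=
        (hW hF').comp ((hF' 0).comp (measurable_const.prodMk measurable_id))
      refine (lintegral_mono fun w => hstep (F' 0 a w)).trans ?_
      rw [lintegral_add_right _ measurable_const, lintegral_const_mul _ hm]
      simp

end Composition

/-! ### Privacy of a phase of the algorithm -/

section Phase

variable {Z : Type*} {P : Params} {X : Set (Vec P.d)} {grad : Vec P.d → Z → Vec P.d}

lemma isProbabilityMeasure_phaseLaw (hε : 0 < P.ε) (i : ℕ) : IsProbabilityMeasure (phaseLaw P i) := by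
  have hl := isProbabilityMeasure_laplace (b := 8 / P.ε) (by positivity)
  have hne : Nonempty (Fin (P.K i) → Fin (P.size i)) := by
    rcases Nat.eq_zero_or_pos (P.size i) with h | h
    -- For an empty group the logarithm in the batch size is log 0 = 0, so the minibatch is empty
    -- and there is still one way to draw it.
    · have hK : P.K i = 0 := by simp [Params.K, h]
      rw [hK]
      exact ⟨Fin.elim0⟩
    · exact ⟨fun _ => ⟨0, h⟩⟩
  have hs := isProbabilityMeasure_stepLaw (K := P.K i) (N := P.size i) P.d hε (P.σ i)
  unfold phaseLaw
  infer_instance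

/-- The batch size is a multiple of a sum of two nonnegative terms, and each term separately gives
one of the two lower bounds on K. -/
lemma Params.phaseBounds (hm : 1 ≤ P.m) (hd : 1 ≤ P.d) (hε : 0 < P.ε) (hε10 : P.ε ≤ 10)
    (hδ : 0 < P.δ) (hδ1 : P.δ < 1) {i : ℕ} (hT : 1 ≤ P.T i) (hK : P.K i ≤ P.size i)
    (hpos : 0 < P.size i) (hle : P.size i ≤ P.n) :
    PhaseBounds (P.size i) (P.K i) (P.T i) P.ε P.δ
      (Real.log ((P.size i : ℝ) ^ 2 * (P.m : ℝ) ^ 2 * Real.exp P.ε / P.δ))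
      (Real.log ((P.n : ℝ) * P.d * Real.exp P.ε / P.δ)) := by
  have hN : (1 : ℝ) ≤ P.size i := by exact_mod_cast hpos
  have hNn : (P.size i : ℝ) ≤ P.n := by exact_mod_cast hle
  have hm' : (1 : ℝ) ≤ P.m := by exact_mod_cast hm
  have hd' : (1 : ℝ) ≤ P.d := by exact_mod_cast hd
  have hT' : (1 : ℝ) ≤ P.T i := by exact_mod_cast hT
  have hN0 : (0 : ℝ) < P.size i := by linarith
  have hm0 : (0 : ℝ) < P.m := by linarith
  have hlogN : 0 ≤ Real.log (P.size i) := Real.log_nonneg hN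
  have hlogm : 0 ≤ Real.log P.m := Real.log_nonneg hm'
  have hlogδ : 0 < Real.log (1 / P.δ) := Real.log_pos (by rw [lt_div_iff₀ hδ]; linarith)
  have hΛ : Real.log ((P.size i : ℝ) ^ 2 * (P.m : ℝ) ^ 2 * Real.exp P.ε / P.δ) =
      2 * Real.log (P.size i) + 2 * Real.log P.m + P.ε + Real.log (1 / P.δ) := by
    rw [div_eq_mul_one_div, Real.log_mul (by positivity) (by positivity),
      Real.log_mul (by positivity) (by positivity), Real.log_mul (by positivity) (by positivity),
      Real.log_pow, Real.log_pow, Real.log_exp]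
    norm_num
  have hΛ' : Real.log (P.size i) + P.ε + Real.log (1 / P.δ) ≤
      Real.log ((P.n : ℝ) * P.d * Real.exp P.ε / P.δ) := by
    have hn0 : (0 : ℝ) < P.n := by linarith
    have hd0 : (0 : ℝ) < P.d := by linarith
    rw [div_eq_mul_one_div (_ * _), Real.log_mul (by positivity) (by positivity),
      Real.log_mul (by positivity) (by positivity), Real.log_exp]
    have : Real.log (P.size i) ≤ Real.log ((P.n : ℝ) * P.d) :=
      Real.log_le_log hN0 (by nlinarith)
    linarith
  set Λ := Real.log ((P.size i : ℝ) ^ 2 * (P.m : ℝ) ^ 2 * Real.exp P.ε / P.δ) with hΛdef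
  have hΛ0 : 0 < Λ := by linarith
  have hceil : 500 * Λ * (1 / P.ε + P.size i * P.ε / √((P.T i : ℝ) * Real.log (1 / P.δ))) ≤ P.K i :=
    Nat.le_ceil _
  have hsq : √((P.T i : ℝ) * Real.log (1 / P.δ)) = √(P.T i : ℝ) * √(Real.log (1 / P.δ)) :=
    Real.sqrt_mul (by positivity) _
  have hT0 : 0 < √(P.T i : ℝ) := Real.sqrt_pos.2 (by linarith)
  have hl0 : 0 < √(Real.log (1 / P.δ)) := Real.sqrt_pos.2 hlogδ
  rw [hsq, mul_add] at hceil
  refine ⟨hε, hε10, hδ, hδ1, hpos, hT, hK, by linarith, hΛ', ?_, ?_⟩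
  · refine le_trans ?_ hceil
    have : 0 ≤ 500 * Λ * (P.size i * P.ε / (√(P.T i : ℝ) * √(Real.log (1 / P.δ)))) := by positivity
    rw [mul_one_div]
    linarith
  · have h1 : 500 * Λ * (P.size i * P.ε / (√(P.T i : ℝ) * √(Real.log (1 / P.δ)))) ≤ P.K i := by
      have : 0 ≤ 500 * Λ * (1 / P.ε) := by positivity
      linarith
    rw [mul_div_assoc', div_le_iff₀ (by positivity)] at h1
    linarith

lemma Params.tau_pos (hm : 1 ≤ P.m) (hd : 1 ≤ P.d) (hn : 2 ≤ P.n) (hL : 0 < P.L) (hc : 0 < P.c) :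
    0 < P.τ := by
  have hm' : (1 : ℝ) ≤ P.m := by exact_mod_cast hm
  have hd' : (1 : ℝ) ≤ P.d := by exact_mod_cast hd
  have hn' : (2 : ℝ) ≤ P.n := by exact_mod_cast hn
  have h1 : (1 : ℝ) < (P.n : ℝ) * P.d * P.m := by
    have : (2 : ℝ) ≤ (P.n : ℝ) * P.d := by nlinarith
    nlinarith
  have h2 := Real.log_pos h1
  have h3 : 0 < √(P.m : ℝ) := Real.sqrt_pos.2 (by linarith)
  unfold Params.τ
  positivity

/-- Privacy of phase `i` with respect to the user `u` of its group. -/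
lemma lintegral_phaseOut_le {f : Vec P.d → Z → ℝ} {R β : ℝ}
    (hloss : LossAssumptions X f grad R P.L β) (hX : Measurable (proj X)) {i : ℕ}
    {Λ Λ' : ℝ} (hB : PhaseBounds (P.size i) (P.K i) (P.T i) P.ε P.δ Λ Λ') (hτ : 0 < P.τ)
    (hσ : P.σ i = 1000 * P.τ * √(P.T i : ℝ) * Λ' / (P.ε * P.size i))
    {Di Di' : Fin (P.size i) → Fin P.m → Z} {u : Fin (P.size i)} (hD : ∀ v, v ≠ u → Di v = Di' v)
    {W : Option (Vec P.d) → ℝ≥0∞} (hW : Measurable W) (hW1 : ∀ o, W o ≤ 1) (x : Vec P.d) :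
    ∫⁻ w, W (phaseOut P X grad i Di x w) ∂phaseLaw P i ≤
      ENNReal.ofReal (Real.exp P.ε) * ∫⁻ w, W (phaseOut P X grad i Di' x w) ∂phaseLaw P i +
        ENNReal.ofReal P.δ :=
  hB.lintegral_runOut_le hτ hσ (u := u) (measurable_phaseGrad hloss i Di)
    (measurable_phaseGrad hloss i Di') (measurable_phaseNext hX i)
    (fun t z v hv => by rw [phaseGrad, phaseGrad, hD v hv])
    (W := fun o => W (o.map fun z : Vec P.d × ACSAState P.d => z.2.ag))
    (hW.comp (measurable_option_map (ACSAState.measurable_ag.comp measurable_snd)))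
    (fun o => hW1 _) (x, ⟨x, x⟩)

end Phase

/-! ### The whole run -/

section Outer

variable {Z : Type*} {P : Params} {X : Set (Vec P.d)} {grad : Vec P.d → Z → Vec P.d}

lemma measurable_afterPhase (r : HaltRule) {d : ℕ} :
    Measurable (afterPhase r : Option (Vec d) → Option (Vec d)) :=
  measurable_of_comp_some measurable_some

variable (P X grad) in
/-- Phase `i + 1` as the outer loop sees it, with gradients cut off outside of `X`. -/
def outerStep (D : Dataset P.n P.m Z) (sel : Selection P) (i : Fin P.l) (o : Option (Vec P.d))
    (w : PhaseSeed P (i + 1)) : Option (Vec P.d) :=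
  o.bind fun x => afterPhase P.halt
    (phaseOut P X grad (i + 1) (fun j => D (sel.toFun ⟨i, j⟩)) x w)

lemma measurable_outerStep {f : Vec P.d → Z → ℝ} {R β : ℝ}
    (hloss : LossAssumptions X f grad R P.L β) (hX : Measurable (proj X))
    (D : Dataset P.n P.m Z) (sel : Selection P) (i : Fin P.l) :
    Measurable (Function.uncurry (outerStep P X grad D sel i)) :=
  measurable_option_bind (G := fun (w : PhaseSeed P (i + 1)) x => afterPhase P.halt
    (phaseOut P X grad (i + 1) (fun j => D (sel.toFun ⟨i, j⟩)) x w))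
    ((measurable_afterPhase P.halt).comp (measurable_phaseOut hloss hX (i + 1) _))

/-- Every phase must start in X for the cutoff to be invisible. After a halt that returns 0 this is
the assumption that 0 belongs to X. -/
lemma acceleratedPhasedERM_eq (hc : Convex ℝ X) (hX : IsCompact X) (hreg : ∀ i, 0 < P.reg i)
    (hα : ∀ i t, 0 < P.α i t ∧ P.α i t ≤ 1) (hγ : ∀ i t, 0 < P.γ i t) (h0 : (0 : Vec P.d) ∈ X)
    {x₀ : Vec P.d} (hx₀ : x₀ ∈ X) (D : Dataset P.n P.m Z) (ω : Seed P) :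
    acceleratedPhasedERM P X grad x₀ D ω =
      (Fin.foldl P.l (fun o i => outerStep P X grad D ω.1 i o (ω.2 i)) (some x₀)).getD 0 := by
  have key := foldl_rel (n := P.l)
    (F := fun (o : Option (Vec P.d)) i =>
      o.bind fun x => afterPhase P.halt
        (phase P X grad (i + 1) (fun j => D (ω.1.toFun ⟨i, j⟩)) x (ω.2 i)))
    (G := fun o i => outerStep P X grad D ω.1 i o (ω.2 i))
    (fun o o' => o = o' ∧ ∀ x ∈ o, x ∈ X)
    (fun o o' i h => by
      obtain ⟨rfl, h⟩ := h
      cases o with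
      | none => simp [outerStep]
      | some x =>
        obtain ⟨h1, h2⟩ := phase_eq_phaseOut (grad := grad) hc hX (hreg (i + 1)) hα hγ
          (fun j => D (ω.1.toFun ⟨i, j⟩)) (h x rfl) (ω.2 i)
        refine ⟨?_, ?_⟩
        · simp only [outerStep, Option.bind_some, h1]
        · intro y hy
          simp only [Option.bind_some] at hy
          cases hph : phase P X grad (i + 1) (fun j => D (ω.1.toFun ⟨i, j⟩)) x (ω.2 i) with
          | none =>
            rw [hph] at hy
            cases hr : P.halt with
            | returnZero =>
              rw [hr] at hy
              obtain rfl := Option.some.inj hy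
              exact h0
            | stopAll =>
              rw [hr] at hy
              exact absurd hy (by simp [afterPhase])
          | some z =>
            rw [hph] at hy
            exact h2 y (by rw [hph]; exact hy))
    (a := some x₀) (b := some x₀) ⟨rfl, fun x hx => by obtain rfl := Option.some.inj hx; exact hx₀⟩
  rw [acceleratedPhasedERM, key.1]

/-- Privacy of the run for a fixed choice of the groups. -/
lemma lintegral_outer_le {f : Vec P.d → Z → ℝ} {R β : ℝ}
    (hloss : LossAssumptions X f grad R P.L β) (hX : Measurable (proj X))
    (hm : 1 ≤ P.m) (hd : 1 ≤ P.d) (hε : 0 < P.ε) (hε10 : P.ε ≤ 10) (hδ : 0 < P.δ) (hδ1 : P.δ < 1)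
    (hL : 0 < P.L) (hc : 0 < P.c) (hT : ∀ i, 1 ≤ P.T i)
    (hK : ∀ i, 1 ≤ i → i ≤ P.l → P.K i ≤ P.size i) {D D' : Dataset P.n P.m Z}
    (hD : Neighbors D D') (sel : Selection P) {h : Option (Vec P.d) → ℝ≥0∞} (hh : Measurable h)
    (hh1 : ∀ o, h o ≤ 1) (o : Option (Vec P.d)) :
    ∫⁻ ω, h (Fin.foldl P.l (fun o i => outerStep P X grad D sel i o (ω i)) o)
        ∂(Measure.pi fun i : Fin P.l => phaseLaw P (i + 1)) ≤
      ENNReal.ofReal (Real.exp P.ε) *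
        ∫⁻ ω, h (Fin.foldl P.l (fun o i => outerStep P X grad D' sel i o (ω i)) o)
          ∂(Measure.pi fun i : Fin P.l => phaseLaw P (i + 1)) + ENNReal.ofReal P.δ := by
  obtain ⟨u, hu⟩ := hD
  have hP : ∀ i : Fin P.l, IsProbabilityMeasure (phaseLaw P (i + 1)) :=
    fun i => isProbabilityMeasure_phaseLaw hε _
  have he : (1 : ℝ≥0∞) ≤ ENNReal.ofReal (Real.exp P.ε) :=
    ENNReal.one_le_ofReal.2 (Real.one_le_exp hε.le)
  by_cases hsel : ∃ p, sel.toFun p = u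
  -- The changed user is user v of a single group i, since the selection is injective. All other
  -- phases see the same data.
  · obtain ⟨⟨i, v⟩, hp⟩ := hsel
    refine lintegral_foldl_le (j := i) (measurable_outerStep hloss hX D sel)
      (measurable_outerStep hloss hX D' sel) ?_ ?_ hh hh1 o
    · intro i' hi'
      have : (fun j => D (sel.toFun ⟨i', j⟩)) = fun j => D' (sel.toFun ⟨i', j⟩) := by
        funext j
        refine hu _ fun hj => hi' ?_
        have := sel.injective (hj.trans hp.symm)
        exact congrArg Sigma.fst this
      funext o w
      simp only [outerStep]
      rw [this]
    · intro W hW hW1 o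
      -- A group embeds into the set of all users.
      have hle : P.size (i + 1) ≤ P.n := by
        have hinj : Function.Injective fun j : Fin (P.size (i + 1)) => sel.toFun ⟨i, j⟩ := by
          intro j j' hjj
          simpa using sel.injective hjj
        simpa using Fintype.card_le_of_injective _ hinj
      have hB := P.phaseBounds hm hd hε hε10 hδ hδ1 (hT (i + 1)) (hK (i + 1) (by omega) (by omega))
        v.pos hle
      -- The batch bound K ≥ 1120 together with K ≤ size ≤ n gives far more. It is needed for
      -- log(ndm) > 0, that is τ > 0.
      have hn : 2 ≤ P.n := by
        have h1 := hB.batch_ge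
        have h2 : 1120 ≤ P.K (i + 1) := by exact_mod_cast h1
        have h3 := hB.batch_le
        omega
      have hτ := P.tau_pos hm hd hn hL hc
      cases o with
      | none =>
        -- An earlier phase has stopped the whole run, so this phase does not look at the data.
        simp only [outerStep, Option.bind_none, lintegral_const, measure_univ, mul_one]
        exact le_add_right (le_mul_of_one_le_left zero_le he)
      | some x =>
        refine lintegral_phaseOut_le hloss hX hB hτ rfl (u := v) (fun j hj => ?_)
          (W := fun o => W (afterPhase P.halt o)) (hW.comp (measurable_afterPhase _))
          (fun o => hW1 _) x
        refine hu _ fun h => hj ?_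
        simpa using sel.injective (h.trans hp.symm)
  · have : ∀ i : Fin P.l, (fun j => D (sel.toFun ⟨i, j⟩)) = fun j => D' (sel.toFun ⟨i, j⟩) := by
      intro i
      funext j
      exact hu _ fun h => hsel ⟨_, h⟩
    simp only [outerStep, this]
    exact le_add_right (le_mul_of_one_le_left zero_le he)

end Outer

end UserDP

end

open UserDP in
theorem mainTheorem4 {Z : Type*} (P : Params) (X : Set (Vec P.d))
    (f : Vec P.d → Z → ℝ) (grad : Vec P.d → Z → Vec P.d) (R β : ℝ)
    (hloss : LossAssumptions X f grad R P.L β)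
    (hm : 1 ≤ P.m) (hd : 1 ≤ P.d)
    (hε : 0 < P.ε) (hε10 : P.ε ≤ 10) (hδ : 0 < P.δ) (hδ1 : P.δ < 1)
    (hp : 0 < P.p) (hq : 0 < P.q) (hlam : 0 < P.lam) (hL : 0 < P.L) (hc : 0 < P.c)
    (hT : ∀ i, 1 ≤ P.T i)
    (hα : ∀ i t, 0 < P.α i t ∧ P.α i t ≤ 1) (hγ : ∀ i t, 0 < P.γ i t)
    (hn : 100 * Real.log (20 * P.n * P.m * P.d * Real.exp P.ε / P.δ) /
        (P.ε * (1 - (1 / 2 : ℝ) ^ P.q)) < (P.n : ℝ) ^ (1 - P.q))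
    (hK : ∀ i, 1 ≤ i → i ≤ P.l → P.K i ≤ P.size i)
    (h0 : (0 : Vec P.d) ∈ X) (x₀ : Vec P.d) (hx₀ : x₀ ∈ X)
    (draw : PMF (Selection P)) :
    IsUserLevelDP (seedLaw P draw) (acceleratedPhasedERM P X grad x₀) P.ε P.δ := by
  have hne : X.Nonempty := ⟨0, h0⟩
  have hX := hloss.compact_domain
  have hcv := hloss.convex_domain
  have hproj : Measurable (proj X) := (continuous_proj hcv hX hne).measurable
  have hreg : ∀ i, 0 < P.reg i := fun i => by
    unfold Params.reg
    positivity
  intro D D' hD S hS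
  -- There are finitely many selections. Joint measurability of the run thus reduces to
  -- measurability for each fixed choice of the groups.
  have : Countable (Selection P) := by
    unfold Selection
    infer_instance
  have hP : ∀ i : Fin P.l, IsProbabilityMeasure (phaseLaw P (i + 1)) :=
    fun i => isProbabilityMeasure_phaseLaw hε _
  have hh : Measurable fun o : Option (Vec P.d) => S.indicator (1 : Vec P.d → ℝ≥0∞) (o.getD 0) :=
    measurable_of_comp_some (measurable_one.indicator hS)
  have hh1 : ∀ o : Option (Vec P.d), S.indicator (1 : Vec P.d → ℝ≥0∞) (o.getD 0) ≤ 1 := fun o =>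
    Set.indicator_le_self' (fun _ _ => zero_le) _
  have hprob : ∀ D : Dataset P.n P.m Z, seedLaw P draw {ω | acceleratedPhasedERM P X grad x₀ D ω ∈ S} =
      ∫⁻ sel, ∫⁻ ω, S.indicator (1 : Vec P.d → ℝ≥0∞)
        ((Fin.foldl P.l (fun o i => outerStep P X grad D sel i o (ω i)) (some x₀)).getD 0)
        ∂(Measure.pi fun i : Fin P.l => phaseLaw P (i + 1)) ∂draw.toMeasure := by
    intro D
    have hfold : Measurable fun ω : Seed P =>
        Fin.foldl P.l (fun o i => outerStep P X grad D ω.1 i o (ω.2 i)) (some x₀) := by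
      refine measurable_from_prod_countable_right fun sel => ?_
      have := measurable_foldl (S := Unit) (F := fun i (_ : Unit) => outerStep P X grad D sel i)
        fun i => (measurable_outerStep hloss hproj D sel i).comp
          (g := Function.uncurry (outerStep P X grad D sel i))
          (measurable_fst.prodMk (measurable_snd.comp measurable_snd))
      exact this.comp (f := fun ω : (i : Fin P.l) → PhaseSeed P (i + 1) => (some x₀, (), ω))
        (by fun_prop)
    have hset : {ω | acceleratedPhasedERM P X grad x₀ D ω ∈ S} = (fun ω : Seed P =>
        Fin.foldl P.l (fun o i => outerStep P X grad D ω.1 i o (ω.2 i)) (some x₀)) ⁻¹'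
          {o | o.getD 0 ∈ S} := by
      ext ω
      change acceleratedPhasedERM P X grad x₀ D ω ∈ S ↔ _
      rw [acceleratedPhasedERM_eq hcv hX hreg hα hγ h0 hx₀]
      rfl
    have hS' : MeasurableSet {o : Option (Vec P.d) | o.getD 0 ∈ S} := hS
    rw [hset, ← lintegral_indicator_one (hfold hS'), seedLaw,
      lintegral_prod _ (measurable_one.indicator (hfold hS')).aemeasurable]
    rfl
  rw [hprob, hprob]
  -- The groups are drawn independently of the data, so the inequality for each fixed selection is
  -- averaged under the same law on both sides.
  refine (lintegral_mono fun sel => lintegral_outer_le hloss hproj hm hd hε hε10 hδ hδ1 hL hc hT hK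
    hD sel hh hh1 (some x₀)).trans ?_
  rw [lintegral_add_right _ measurable_const, lintegral_const_mul _ (measurable_of_countable _),
    lintegral_const, measure_univ, mul_one]
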